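/- **Sorted first-order LTL (FOLTL).** A signature $\sigma$ consists of a non-empty finite set of sorts, finitely many constant symbols (each with a sort) and finitely many relation symbols (each with a finite sequence of sorts as arity); each sort has countably infinitely many variables. Well-sorted FOLTL formulas are built from $\mathit{true}$, $t=t'$, $R(t_1,\dots,t_k)$ with $t,t',t_i$ variables or constants, by $\neg,\vee,\wedge,\exists x{:}s,\forall x{:}s$ and the temporal operators $\bigcirc$ (next), $\mathcal U$ (until), $\mathcal R$ (release); $\Diamond\varphi:=\mathit{true}\,\mathcal U\,\varphi$ and $\Box\varphi:=\neg\Diamond\neg\varphi$. They are interpreted in temporal structures: non-empty universes $U_s$ and constants that do not depend on time, and for each time point $n\in\mathbb N$ an interpretation of the relation symbols, with the usual LTL semantics. A formula is in **BS-FOLTL** if it is closed, in negation normal form, and for each sort $s$ its projection on $s$ (remove all quantifications and terms of other sorts) has the form $\exists x_1,\dots,x_k.\,\varphi'$ with $k\ge 0$ and $\varphi'$ without existential quantifiers. **Workflows.** Let the relation symbols of $\sigma$ be split into workflow relations $\mathcal R_{\mathit{wf}}$ and high-input relations $\mathcal R_{\mathit{high}}$. Workflows over $\sigma$ are given by $$w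 ::= b \mid b\;w \mid \mathbf{loop}\,\{w\} \mid \mathbf{choose}\;w\;\mathbf{or}\;w,\qquad b ::= \mathbf{forall}\;\bar x{:}\bar s.\,[\mathbf{may}]\ \theta_1\to R_1\pm\!=\bar u_1;\dots;\theta_n\to R_n\pm\!=\bar u_n\quad(n\ge 1),$$ where $R_j\in\mathcal R_{\mathit{wf}}$, $\theta_j$ is a first-order formula over $\sigma$, $\bar u_j$ is a tuple of terms of the sorts of $R_j$, and all free variables of $\theta_j$ and $\bar u_j$ are among $\bar x$. The workflow is **non-omitting** if for all statements of all its blocks $\theta_j$ is quantifier-free and the set of variables of $\bar u_j$ is exactly $\bar x$. **Control flow graph.** The nodes of the graph $(V,E)$ of $w$ are the entry node $n_0$, the end node $n_{\mathit{end}}$ and the inner nodes introduced below; its edges are labelled with blocks or with the empty block $\mathit{id}$. The node $n_{\mathit{end}}$ has an edge to itself labelled $\mathit{id}$, and $w$ leads from $n_0$ to $n_{\mathit{end}}$, where "$w$ leads from $n$ to $e$" is as follows. A block $b$: an edge $n\to e$ labelled $b$. A sequence $b\;w$: an edge $n\to m$ labelled $b$ with $m$ new, and $w$ leads from $m$ to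 $e$. $\mathbf{loop}\,\{w\}$: an edge $n\to e$ labelled $\mathit{id}$, and $w$ leads from $n$ to $n$; but if $w$ is itself a loop, then there is an edge $n\to m$ labelled $\mathit{id}$ with $m$ new, and $w$ leads from $m$ to $n$. $\mathbf{choose}\;w\;\mathbf{or}\;w'$: edges $n\to m$ and $n\to m'$ labelled $\mathit{id}$ with $m,m'$ new, $w$ leads from $m$ to $e$ and $w'$ leads from $m'$ to $e$. **Semantics.** Let $\sigma'$ be $\sigma$ with a proposition $n$ for each node $n\in V$ and, for the $i$-th block of $w$ in textual order, if it is a $\mathbf{may}$ block, a relation symbol $\mathrm{aux}_i$ of arity $\bar s$. The formula $\mathrm{wf}(w)$ over $\sigma'$ is the conjunction of * $\Box\bigwedge_{n\in V}\big(n\to\bigcirc\bigvee_{(n,n')\in E}n'\big)$ and $\Box\bigwedge_{n\ne n'}\neg(n\wedge n')$; * $n_0\wedge\bigwedge_{n\neq n_0}\neg n\wedge\bigwedge_{R\in\mathcal R_{\mathit{wf}}}\forall\bar y.\,\neg R(\bar y)$; * $\Box\bigwedge_{(n,n')\in E}\Big((n\wedge\bigcirc n')\to\bigwedge_{R\in\mathcal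 R_{\mathit{wf}}}\forall\bar y.\,\big(\bigcirc R(\bar y)\leftrightarrow\Phi_{b,R}(\bar y)\big)\Big)$, where $b$ is the label of $(n,n')$. Here $\Phi_{b,R}(\bar y)$ starts as $R(\bar y)$ and is changed by the statements $\theta_j\to R_j\pm\!=\bar u_j$ of $b$ with $R_j=R$ in their order: $\Phi$ becomes $\Phi\vee\chi_j$ for $+\!=$ and $\Phi\wedge\neg\chi_j$ for $-\!=$, where $\chi_j=\exists\bar x.\,\theta_j\wedge\mathrm{aux}_i(\bar x)\wedge\bar y=\bar u_j$ if $b$ is the $i$-th block and a $\mathbf{may}$ block, and $\chi_j=\exists\bar x.\,\theta_j\wedge\bar y=\bar u_j$ otherwise. For a closed FOLTL formula $\psi$ over $\sigma'$ we write $w\models\psi$ if every temporal structure over $\sigma'$ that satisfies $\mathrm{wf}(w)$ satisfies $\psi$ (at time $0$). **Theorem.** It is decidable, given a signature $\sigma$, a non-omitting workflow $w$ over $\sigma$ and a BS-FOLTL formula $\varphi$ over $\sigma'$, whether $w\models\neg\varphi$. That is, there is a computable function which, applied to the Gödel numbers of any such $\sigma$, $w$ and $\varphi$, returns $\mathrm{true}$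 if and only if $w\models\neg\varphi$. -/

import Mathlib

universe u

namespace FOWorkflow

/-! ### Signatures -/

/-- The signature `σ` of a workflow. Sorts, constants and relations are numbered. The sorts are
`0, …, numSorts - 1`; `consts` lists the sorts of the constant symbols; `wfRels` and `highRels`
list the arities (sequences of sorts) of the updatable workflow relations and of the non-updatable
high-input relations. -/
structure Signature where
  numSorts : ℕ
  consts : List ℕ
  wfRels : List (List ℕ)
  highRels : List (List ℕ)

/-- There is at least one sort, and all arities only mention existing sorts. -/
def Signature.WellFormed (σ : Signature) : Prop :=
  0 < σ.numSorts ∧ (∀ s ∈ σ.consts, s < σ.numSorts) ∧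
    (∀ l ∈ σ.wfRels, ∀ s ∈ l, s < σ.numSorts) ∧ (∀ l ∈ σ.highRels, ∀ s ∈ l, s < σ.numSorts)

/-- Names of relation symbols: workflow relations, high-input relations, the propositions for the
nodes of the control flow graph, and the low-input (choice) relations of `may` blocks. -/
inductive RelSym
  | wf (k : ℕ)
  | high (k : ℕ)
  | node (n : ℕ)
  | aux (i : ℕ)

/-- A signature over which formulas are read: it says which symbols exist and gives their arity
(`none` for a symbol that does not belong to the signature). -/
structure Vocab where
  numSorts : ℕ
  constSort : ℕ → Option ℕ
  arity : RelSym → Option (List ℕ)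

/-- The signature `σ` itself, without node propositions and choice relations. -/
def Signature.vocab (σ : Signature) : Vocab where
  numSorts := σ.numSorts
  constSort := fun c => σ.consts[c]?
  arity := fun
    | .wf k => σ.wfRels[k]?
    | .high k => σ.highRels[k]?
    | .node _ => none
    | .aux _ => none

/-! ### Syntax of sorted first-order LTL -/

/-- Terms; `var s i` is the `i`-th variable of sort `s`. -/
inductive Term
  | var (s i : ℕ)
  | const (c : ℕ)

/-- Formulas of sorted first-order LTL. The connectives `and`, `all`, `release` are primitive, so
that negation normal forms are formulas. The atom `tru` is primitive, so that `true` is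
available over signatures without constants. -/
inductive Formula
  | tru
  | eq (t t' : Term)
  | rel (R : RelSym) (ts : List Term)
  | not (φ : Formula)
  | or (φ ψ : Formula)
  | and (φ ψ : Formula)
  | ex (s i : ℕ) (φ : Formula)
  | all (s i : ℕ) (φ : Formula)
  | next (φ : Formula)
  | untl (φ ψ : Formula)
  | release (φ ψ : Formula)

def Term.HasSort (V : Vocab) : Term → ℕ → Prop
  | .var s _, s' => s = s' ∧ s < V.numSorts
  | .const c, s' => V.constSort c = some s'

def Term.fv : Term → Finset (ℕ × ℕ)
  | .var s i => {(s, i)}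
  | .const _ => ∅

def termsFv (ts : List Term) : Finset (ℕ × ℕ) :=
  ts.foldr (fun t a => t.fv ∪ a) ∅

namespace Formula

/-- The formula is well-sorted and only uses symbols of the given signature. -/
def WellSorted (V : Vocab) : Formula → Prop
  | tru => True
  | eq t t' => ∃ s, t.HasSort V s ∧ t'.HasSort V s
  | rel R ts => ∃ l, V.arity R = some l ∧ List.Forall₂ (fun t s => t.HasSort V s) ts l
  | not φ => φ.WellSorted V
  | or φ ψ => φ.WellSorted V ∧ ψ.WellSorted V
  | and φ ψ => φ.WellSorted V ∧ ψ.WellSorted V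
  | ex s _ φ => s < V.numSorts ∧ φ.WellSorted V
  | all s _ φ => s < V.numSorts ∧ φ.WellSorted V
  | next φ => φ.WellSorted V
  | untl φ ψ => φ.WellSorted V ∧ ψ.WellSorted V
  | release φ ψ => φ.WellSorted V ∧ ψ.WellSorted V

/-- Free variables. -/
def fv : Formula → Finset (ℕ × ℕ)
  | tru => ∅
  | eq t t' => t.fv ∪ t'.fv
  | rel _ ts => termsFv ts
  | not φ => φ.fv
  | or φ ψ => φ.fv ∪ ψ.fv
  | and φ ψ => φ.fv ∪ ψ.fv
  | ex s i φ => φ.fv.erase (s, i)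
  | all s i φ => φ.fv.erase (s, i)
  | next φ => φ.fv
  | untl φ ψ => φ.fv ∪ ψ.fv
  | release φ ψ => φ.fv ∪ ψ.fv

def Closed (φ : Formula) : Prop := φ.fv = ∅

/-- First-order formulas: no temporal operators. -/
def FirstOrder : Formula → Prop
  | tru => True
  | eq _ _ => True
  | rel _ _ => True
  | not φ => φ.FirstOrder
  | or φ ψ => φ.FirstOrder ∧ ψ.FirstOrder
  | and φ ψ => φ.FirstOrder ∧ ψ.FirstOrder
  | ex _ _ φ => φ.FirstOrder
  | all _ _ φ => φ.FirstOrder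
  | next _ => False
  | untl _ _ => False
  | release _ _ => False

def QuantifierFree : Formula → Prop
  | tru => True
  | eq _ _ => True
  | rel _ _ => True
  | not φ => φ.QuantifierFree
  | or φ ψ => φ.QuantifierFree ∧ ψ.QuantifierFree
  | and φ ψ => φ.QuantifierFree ∧ ψ.QuantifierFree
  | ex _ _ _ => False
  | all _ _ _ => False
  | next φ => φ.QuantifierFree
  | untl φ ψ => φ.QuantifierFree ∧ ψ.QuantifierFree
  | release φ ψ => φ.QuantifierFree ∧ ψ.QuantifierFree

def IsAtom : Formula → Prop
  | tru => True
  | eq _ _ => True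
  | rel _ _ => True
  | _ => False

/-- Negation normal form: negation only in front of atoms. -/
def NNF : Formula → Prop
  | tru => True
  | eq _ _ => True
  | rel _ _ => True
  | not φ => φ.IsAtom
  | or φ ψ => φ.NNF ∧ ψ.NNF
  | and φ ψ => φ.NNF ∧ ψ.NNF
  | ex _ _ φ => φ.NNF
  | all _ _ φ => φ.NNF
  | next φ => φ.NNF
  | untl φ ψ => φ.NNF ∧ ψ.NNF
  | release φ ψ => φ.NNF ∧ ψ.NNF

/-! ### The Bernays–Schönfinkel-like fragment -/

end Formula

/-- Sort of a term, as a decidable test. -/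
def Term.isOfSort (V : Vocab) (s : ℕ) : Term → Bool
  | .var s' _ => s' == s
  | .const c => V.constSort c == some s

namespace Formula

/-- Projection of a formula on the sort `s`: quantifications and terms of other sorts are removed.
An equality between terms of another sort loses both its terms and becomes the trivial atom. -/
def proj (V : Vocab) (s : ℕ) : Formula → Formula
  | tru => tru
  | eq t t' => if t.isOfSort V s then eq t t' else tru
  | rel R ts => rel R (ts.filter (Term.isOfSort V s))
  | not φ => not (φ.proj V s)
  | or φ ψ => or (φ.proj V s) (ψ.proj V s)
  | and φ ψ => and (φ.proj V s) (ψ.proj V s)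
  | ex s' i φ => if s' = s then ex s' i (φ.proj V s) else φ.proj V s
  | all s' i φ => if s' = s then all s' i (φ.proj V s) else φ.proj V s
  | next φ => next (φ.proj V s)
  | untl φ ψ => untl (φ.proj V s) (ψ.proj V s)
  | release φ ψ => release (φ.proj V s) (ψ.proj V s)

/-- No existential quantifier occurs (used for formulas in negation normal form). -/
def NoEx : Formula → Prop
  | tru => True
  | eq _ _ => True
  | rel _ _ => True
  | not φ => φ.NoEx
  | or φ ψ => φ.NoEx ∧ ψ.NoEx
  | and φ ψ => φ.NoEx ∧ ψ.NoEx
  | ex _ _ _ => False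
  | all _ _ φ => φ.NoEx
  | next φ => φ.NoEx
  | untl φ ψ => φ.NoEx ∧ ψ.NoEx
  | release φ ψ => φ.NoEx ∧ ψ.NoEx

/-- The formula has the form `∃ x₁, …, x_k. φ'` with `k ≥ 0` and `φ'` without existential
quantifiers. -/
inductive ExPrefix : Formula → Prop
  | base {φ : Formula} (h : φ.NoEx) : ExPrefix φ
  | ex (s i : ℕ) {φ : Formula} (h : ExPrefix φ) : ExPrefix (ex s i φ)

/-- The fragment BS-FOLTL over a signature: closed well-sorted formulas in negation normal form
whose projection on each sort consists of a prefix of existential quantifiers followed by a formula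
without existential quantifiers. -/
structure BSFOLTL (V : Vocab) (φ : Formula) : Prop where
  wellSorted : φ.WellSorted V
  closed : φ.Closed
  nnf : φ.NNF
  proj : ∀ s < V.numSorts, ExPrefix (φ.proj V s)

end Formula

/-! ### Semantics -/

/-- A temporal structure: time-independent nonempty universes and constants, and for each time
point an interpretation of the relation symbols by sets of tuples of the right sorts. -/
structure TemporalStructure (V : Vocab) where
  U : ℕ → Type u
  nonempty : ∀ s, Nonempty (U s)
  const : ℕ → Σ s, U s
  const_sort : ∀ c s, V.constSort c = some s → (const c).1 = s
  rel : ℕ → RelSym → List (Σ s, U s) → Prop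
  rel_sort : ∀ t R ds, rel t R ds → V.arity R = some (ds.map Sigma.fst)

/-- A valuation maps the `i`-th variable of sort `s` to an element of the universe of `s`. -/
abbrev Valuation {V : Vocab} (T : TemporalStructure.{u} V) : Type u := ∀ s : ℕ, ℕ → T.U s

def Valuation.update {V : Vocab} {T : TemporalStructure.{u} V} (ν : Valuation T) (s i : ℕ)
    (d : T.U s) : Valuation T :=
  Function.update ν s (Function.update (ν s) i d)

def Term.eval {V : Vocab} (T : TemporalStructure.{u} V) (ν : Valuation T) : Term → Σ s, T.U s
  | .var s i => ⟨s, ν s i⟩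
  | .const c => T.const c

/-- `φ.Sat T ν n` says that the suffix of `T` starting at time `n` satisfies `φ` under `ν`. -/
def Formula.Sat {V : Vocab} (T : TemporalStructure.{u} V) :
    Valuation T → ℕ → Formula → Prop
  | _, _, .tru => True
  | ν, _, .eq t t' => t.eval T ν = t'.eval T ν
  | ν, n, .rel R ts => T.rel n R (ts.map (Term.eval T ν))
  | ν, n, .not φ => ¬ Sat T ν n φ
  | ν, n, .or φ ψ => Sat T ν n φ ∨ Sat T ν n ψ
  | ν, n, .and φ ψ => Sat T ν n φ ∧ Sat T ν n ψ
  | ν, n, .ex s i φ => ∃ d : T.U s, Sat T (ν.update s i d) n φ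
  | ν, n, .all s i φ => ∀ d : T.U s, Sat T (ν.update s i d) n φ
  | ν, n, .next φ => Sat T ν (n + 1) φ
  | ν, n, .untl φ ψ => ∃ j, Sat T ν (n + j) ψ ∧ ∀ k < j, Sat T ν (n + k) φ
  | ν, n, .release φ ψ => ¬ ∃ j, ¬ Sat T ν (n + j) ψ ∧ ∀ k < j, ¬ Sat T ν (n + k) φ

/-! ### Derived connectives -/

namespace Formula

def imp (φ ψ : Formula) : Formula := or (not φ) ψ

def iff (φ ψ : Formula) : Formula := and (imp φ ψ) (imp ψ φ)

/-- `◇ φ`, that is, `true U φ`. -/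
def eventually (φ : Formula) : Formula := untl tru φ

/-- `□ φ`, that is, `¬ ◇ ¬ φ`. -/
def globally (φ : Formula) : Formula := not (eventually (not φ))

def bigAnd (l : List Formula) : Formula := l.foldr and tru

def bigOr (l : List Formula) : Formula := l.foldr or (not tru)

def exN (xs : List (ℕ × ℕ)) (φ : Formula) : Formula := xs.foldr (fun x ψ => ex x.1 x.2 ψ) φ

def allN (xs : List (ℕ × ℕ)) (φ : Formula) : Formula := xs.foldr (fun x ψ => all x.1 x.2 ψ) φ

/-- The proposition saying that the workflow is in node `n`. -/
def atNode (n : ℕ) : Formula := rel (.node n) []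

end Formula

def Term.ofVar (x : ℕ × ℕ) : Term := .var x.1 x.2

/-! ### Workflows -/

/-- A statement `guard → R += args` (`add = true`) or `guard → R -= args` (`add = false`), where
`R` is the workflow relation with number `rel`. -/
structure Stmt where
  guard : Formula
  add : Bool
  rel : ℕ
  args : List Term

/-- A block `forall x̄. [may] stmts`; the list `vars` holds the variables `x̄` with their sorts. -/
structure Block where
  vars : List (ℕ × ℕ)
  may : Bool
  stmts : List Stmt

/-- `w ::= block | block w | loop {w} | choose w or w`. -/
inductive Workflow
  | block (b : Block)
  | seq (b : Block) (w : Workflow)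
  | loop (w : Workflow)
  | choose (w w' : Workflow)

structure Stmt.WellFormed (σ : Signature) (xs : List (ℕ × ℕ)) (st : Stmt) : Prop where
  firstOrder : st.guard.FirstOrder
  wellSorted : st.guard.WellSorted σ.vocab
  args_sort : ∃ l, σ.wfRels[st.rel]? = some l ∧
    List.Forall₂ (fun t s => t.HasSort σ.vocab s) st.args l
  fv_subset : st.guard.fv ∪ termsFv st.args ⊆ xs.toFinset

structure Block.WellFormed (σ : Signature) (b : Block) : Prop where
  vars_sort : ∀ x ∈ b.vars, x.1 < σ.numSorts
  stmts_ne : b.stmts ≠ []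
  stmts_wf : ∀ st ∈ b.stmts, st.WellFormed σ b.vars

/-- The empty block, which labels the edges that do not correspond to a block of the workflow. -/
def idBlock : Block := ⟨[], false, []⟩

/-- An edge of the control flow graph from node `src` to node `dst`, labelled with `block`, whose
index in the linearisation of the workflow is `idx` (irrelevant for the empty block). -/
structure Edge where
  src : ℕ
  dst : ℕ
  idx : ℕ
  block : Block

namespace Workflow

/-- The linearisation of the workflow: its blocks in textual order. -/
def blocks : Workflow → List Block
  | block b => [b]
  | seq b w => b :: w.blocks
  | loop w => w.blocks
  | choose w w' => w.blocks ++ w'.blocks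

/-- The workflow is well-sorted and well-formed over the signature `σ`. -/
def WellFormed (σ : Signature) (w : Workflow) : Prop := ∀ b ∈ w.blocks, b.WellFormed σ

/-- In every statement of every block the guard is quantifier-free and the variables of the updated
tuple are exactly the variables of the block. -/
def NonOmitting (w : Workflow) : Prop :=
  ∀ b ∈ w.blocks, ∀ st ∈ b.stmts, termsFv st.args = b.vars.toFinset ∧ st.guard.QuantifierFree

/-! ### Control flow graph -/

def isLoop : Workflow → Bool
  | loop _ => true
  | _ => false

/-- The number of inner nodes that `edgesFrom` creates. -/
def numInner : Workflow → ℕ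
  | block _ => 0
  | seq _ w => 1 + w.numInner
  | loop w => (if w.isLoop then 1 else 0) + w.numInner
  | choose w w' => 2 + w.numInner + w'.numInner

/-- The edges of the part of the control flow graph that belongs to a workflow which is entered in
node `n` and left to node `e`. Inner nodes are numbered from `m`, blocks from `i`. A loop has its
entry `n` as its head: the body leads from `n` back to `n`, and an empty edge leaves the loop; a
loop that is itself the body of a loop gets a head of its own. The branches of a choice have
entries of their own, reached by empty edges. Hence parallel edges never arise. -/
def edgesFrom : Workflow → (n e m i : ℕ) → List Edge
  | block b, n, e, _, i => [⟨n, e, i, b⟩]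
  | seq b w, n, e, m, i => ⟨n, m, i, b⟩ :: w.edgesFrom m e (m + 1) (i + 1)
  | loop w, n, e, m, i =>
      ⟨n, e, 0, idBlock⟩ ::
        (if w.isLoop then ⟨n, m, 0, idBlock⟩ :: w.edgesFrom m n (m + 1) i
         else w.edgesFrom n n m i)
  | choose w w', n, e, m, i =>
      ⟨n, m, 0, idBlock⟩ :: ⟨n, m + 1, 0, idBlock⟩ ::
        (w.edgesFrom m e (m + 2) i ++
          w'.edgesFrom (m + 1) e (m + 2 + w.numInner) (i + w.blocks.length))

/-- The entry node of the control flow graph. -/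
def entryNode : ℕ := 0

/-- The additional node, with a looping edge only, in which a terminated execution stays. -/
def endNode : ℕ := 1

/-- The nodes of the control flow graph. -/
def nodes (w : Workflow) : List ℕ := List.range (2 + w.numInner)

/-- The edges of the control flow graph. -/
def edges (w : Workflow) : List Edge :=
  ⟨endNode, endNode, 0, idBlock⟩ :: w.edgesFrom entryNode endNode 2 0

/-- The signature `σ'`: `σ` extended with the node propositions and with a choice relation for
each `may` block. -/
def vocab (σ : Signature) (w : Workflow) : Vocab where
  numSorts := σ.numSorts
  constSort := σ.vocab.constSort
  arity := fun
    | .wf k => σ.wfRels[k]?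
    | .high k => σ.highRels[k]?
    | .node n => if n ∈ w.nodes then some [] else none
    | .aux i => w.blocks[i]?.bind fun b => if b.may then some (b.vars.map Prod.fst) else none

end Workflow

/-! ### Semantics of workflows -/

open Formula

/-- A tuple `ȳ` of distinct variables of the sorts `l`, disjoint from the variables of the block. -/
def Block.tuple (b : Block) (l : List ℕ) : List (ℕ × ℕ) :=
  l.zipIdx.map fun p => (p.1, (b.vars.map Prod.snd).foldr max 0 + 1 + p.2)

/-- `∃ x̄. θ ∧ aux_i(x̄) ∧ ȳ = ū`, where the conjunct `aux_i(x̄)` is omitted for non-`may` blocks. -/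
def Block.selects (b : Block) (i : ℕ) (st : Stmt) (ys : List (ℕ × ℕ)) : Formula :=
  exN b.vars (.and st.guard
    (.and (if b.may then .rel (.aux i) (b.vars.map Term.ofVar) else .tru)
      (bigAnd (List.zipWith (fun y t => .eq (Term.ofVar y) t) ys st.args))))

/-- `Φ_{b,R}(ȳ)` for the `k`-th workflow relation `R`: the content of `R` after execution of the
block `b` with index `i`, in terms of the state before. Several statements updating `R` are
composed sequentially. -/
def Block.post (b : Block) (i k : ℕ) (ys : List (ℕ × ℕ)) : Formula :=
  b.stmts.foldl
    (fun acc st =>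
      if st.rel = k then
        if st.add then .or acc (b.selects i st ys) else .and acc (.not (b.selects i st ys))
      else acc)
    (.rel (.wf k) (ys.map Term.ofVar))

/-- `(n ∧ ○ n') → ⋀_R ∀ ȳ. (○ R(ȳ)) ↔ Φ_{b,R}(ȳ)` for an edge `(n, n')` with label `b`. -/
def Edge.exec (σ : Signature) (e : Edge) : Formula :=
  imp (.and (atNode e.src) (.next (atNode e.dst)))
    (bigAnd (σ.wfRels.zipIdx.map fun p =>
      let ys := e.block.tuple p.1
      allN ys (iff (.next (.rel (.wf p.2) (ys.map Term.ofVar))) (e.block.post e.idx p.2 ys))))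

namespace Workflow

/-- Control flow: from each node the workflow moves on to a successor. -/
def cfg (w : Workflow) : Formula :=
  globally (bigAnd (w.nodes.map fun n =>
    imp (atNode n)
      (.next (bigOr ((w.edges.filter fun e => e.src = n).map fun e => atNode e.dst)))))

/-- The workflow is never in two nodes at once. -/
def sanity (w : Workflow) : Formula :=
  globally (bigAnd (((w.nodes ×ˢ w.nodes).filter fun p => p.1 ≠ p.2).map fun p =>
    .not (.and (atNode p.1) (atNode p.2))))

/-- Initially the workflow is in its entry node, and all workflow relations are empty. -/
def init (σ : Signature) (w : Workflow) : Formula :=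
  .and
    (.and (atNode entryNode)
      (bigAnd ((w.nodes.filter fun n => n ≠ entryNode).map fun n => .not (atNode n))))
    (bigAnd (σ.wfRels.zipIdx.map fun p =>
      let ys := idBlock.tuple p.1
      allN ys (.not (.rel (.wf p.2) (ys.map Term.ofVar)))))

/-- Every step along an edge executes the block that labels the edge. -/
def exec (σ : Signature) (w : Workflow) : Formula :=
  globally (bigAnd (w.edges.map (Edge.exec σ)))

/-- The specification of the workflow as a formula over `σ'`. -/
def wf (σ : Signature) (w : Workflow) : Formula :=
  .and w.cfg (.and w.sanity (.and (w.init σ) (w.exec σ)))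

/-- The semantics of the workflow: all temporal structures over `σ'` that satisfy `wf`. -/
def sem (σ : Signature) (w : Workflow) : Set (TemporalStructure.{u} (w.vocab σ)) :=
  {T | ∀ ν : Valuation T, (w.wf σ).Sat T ν 0}

/-- `w ⊨ φ` -/
def Satisfies (σ : Signature) (w : Workflow) (φ : Formula) : Prop :=
  ∀ T ∈ sem.{u} σ w, ∀ ν : Valuation T, φ.Sat T ν 0

end Workflow

/-! ### Gödel numbers

The standard numbering of syntax trees, by means of pairing functions. -/

def Signature.code (σ : Signature) : ℕ :=
  Nat.pair σ.numSorts (Nat.pair (Encodable.encode σ.consts)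
    (Nat.pair (Encodable.encode σ.wfRels) (Encodable.encode σ.highRels)))

def RelSym.code : RelSym → ℕ
  | .wf k => Nat.pair 0 k
  | .high k => Nat.pair 1 k
  | .node n => Nat.pair 2 n
  | .aux i => Nat.pair 3 i

def Term.code : Term → ℕ
  | .var s i => Nat.pair 0 (Nat.pair s i)
  | .const c => Nat.pair 1 c

def Formula.code : Formula → ℕ
  | .tru => Nat.pair 0 0
  | .eq t t' => Nat.pair 1 (Nat.pair t.code t'.code)
  | .rel R ts => Nat.pair 2 (Nat.pair R.code (Encodable.encode (ts.map Term.code)))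
  | .not φ => Nat.pair 3 φ.code
  | .or φ ψ => Nat.pair 4 (Nat.pair φ.code ψ.code)
  | .and φ ψ => Nat.pair 5 (Nat.pair φ.code ψ.code)
  | .ex s i φ => Nat.pair 6 (Nat.pair (Nat.pair s i) φ.code)
  | .all s i φ => Nat.pair 7 (Nat.pair (Nat.pair s i) φ.code)
  | .next φ => Nat.pair 8 φ.code
  | .untl φ ψ => Nat.pair 9 (Nat.pair φ.code ψ.code)
  | .release φ ψ => Nat.pair 10 (Nat.pair φ.code ψ.code)

def Stmt.code (st : Stmt) : ℕ :=
  Nat.pair st.guard.code (Nat.pair (Encodable.encode st.add)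
    (Nat.pair st.rel (Encodable.encode (st.args.map Term.code))))

def Block.code (b : Block) : ℕ :=
  Nat.pair (Encodable.encode b.vars)
    (Nat.pair (Encodable.encode b.may) (Encodable.encode (b.stmts.map Stmt.code)))

def Workflow.code : Workflow → ℕ
  | .block b => Nat.pair 0 b.code
  | .seq b w => Nat.pair 1 (Nat.pair b.code w.code)
  | .loop w => Nat.pair 2 w.code
  | .choose w w' => Nat.pair 3 (Nat.pair w.code w'.code)

end FOWorkflow

/-! ### Primitive recursive functions -/

section PrimrecTools

variable {α β γ : Type*} [Primcodable α] [Primcodable β] [Primcodable γ]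

attribute [fun_prop] Primrec

namespace Primrec

@[fun_prop] theorem fun_id : Primrec (fun a : α => a) := Primrec.id

@[fun_prop] theorem fun_const (b : β) : Primrec (fun _ : α => b) := Primrec.const b

@[fun_prop] theorem fun_comp {f : β → γ} {g : α → β} (hf : Primrec f) (hg : Primrec g) :
    Primrec (fun a => f (g a)) := hf.comp hg

@[fun_prop] theorem fun_fst {f : α → β × γ} (hf : Primrec f) : Primrec (fun a => (f a).1) :=
  Primrec.fst.comp hf

@[fun_prop] theorem fun_snd {f : α → β × γ} (hf : Primrec f) : Primrec (fun a => (f a).2) :=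
  Primrec.snd.comp hf

@[fun_prop] theorem fun_mk {f : α → β} {g : α → γ} (hf : Primrec f) (hg : Primrec g) :
    Primrec (fun a => (f a, g a)) := hf.pair hg

@[fun_prop] theorem fun_natPair {f g : α → ℕ} (hf : Primrec f) (hg : Primrec g) :
    Primrec (fun a => Nat.pair (f a) (g a)) := Primrec₂.natPair.comp hf hg

@[fun_prop] theorem fun_unpair {f : α → ℕ} (hf : Primrec f) :
    Primrec (fun a => Nat.unpair (f a)) := Primrec.unpair.comp hf

@[fun_prop] theorem fun_add {f g : α → ℕ} (hf : Primrec f) (hg : Primrec g) :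
    Primrec (fun a => f a + g a) := Primrec.nat_add.comp hf hg

@[fun_prop] theorem fun_mul {f g : α → ℕ} (hf : Primrec f) (hg : Primrec g) :
    Primrec (fun a => f a * g a) := Primrec.nat_mul.comp hf hg

@[fun_prop] theorem fun_div {f g : α → ℕ} (hf : Primrec f) (hg : Primrec g) :
    Primrec (fun a => f a / g a) := Primrec.nat_div.comp hf hg

@[fun_prop] theorem fun_mod {f g : α → ℕ} (hf : Primrec f) (hg : Primrec g) :
    Primrec (fun a => f a % g a) := Primrec.nat_mod.comp hf hg

@[fun_prop] theorem fun_max {f g : α → ℕ} (hf : Primrec f) (hg : Primrec g) :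
    Primrec (fun a => max (f a) (g a)) := Primrec.nat_max.comp hf hg

@[fun_prop] theorem fun_min {f g : α → ℕ} (hf : Primrec f) (hg : Primrec g) :
    Primrec (fun a => min (f a) (g a)) := Primrec.nat_min.comp hf hg

@[fun_prop] theorem fun_pow {f g : α → ℕ} (hf : Primrec f) (hg : Primrec g) :
    Primrec (fun a => f a ^ g a) :=
  (Primrec₂.unpaired'.1 Nat.Primrec.pow).comp hf hg

@[fun_prop] theorem fun_decide_eq [DecidableEq β] {f g : α → β} (hf : Primrec f)
    (hg : Primrec g) : Primrec (fun a => decide (f a = g a)) :=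
  (Primrec.eq.comp hf hg).decide

@[fun_prop] theorem fun_decide_le {f g : α → ℕ} (hf : Primrec f) (hg : Primrec g) :
    Primrec (fun a => decide (f a ≤ g a)) := (Primrec.nat_le.comp hf hg).decide

@[fun_prop] theorem fun_not {f : α → Bool} (hf : Primrec f) : Primrec (fun a => !f a) :=
  Primrec.not.comp hf

@[fun_prop] theorem fun_and {f g : α → Bool} (hf : Primrec f) (hg : Primrec g) :
    Primrec (fun a => f a && g a) := Primrec.and.comp hf hg

@[fun_prop] theorem fun_or {f g : α → Bool} (hf : Primrec f) (hg : Primrec g) :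
    Primrec (fun a => f a || g a) := Primrec.or.comp hf hg

@[fun_prop] theorem fun_cond {c : α → Bool} {f g : α → β} (hc : Primrec c) (hf : Primrec f)
    (hg : Primrec g) : Primrec (fun a => bif c a then f a else g a) := Primrec.cond hc hf hg

@[fun_prop] theorem fun_testBit {f g : α → ℕ} (hf : Primrec f) (hg : Primrec g) :
    Primrec (fun a => (f a).testBit (g a)) := by
  have : (fun a => (f a).testBit (g a)) = fun a => decide (f a / 2 ^ g a % 2 = 1) := by
    funext a; exact Nat.testBit_eq_decide_div_mod_eq
  rw [this]; fun_prop

@[fun_prop] theorem fun_cons {f : α → β} {g : α → List β} (hf : Primrec f) (hg : Primrec g) :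
    Primrec (fun a => f a :: g a) := Primrec.list_cons.comp hf hg

@[fun_prop] theorem fun_append {f g : α → List β} (hf : Primrec f) (hg : Primrec g) :
    Primrec (fun a => f a ++ g a) := Primrec.list_append.comp hf hg

@[fun_prop] theorem fun_range {f : α → ℕ} (hf : Primrec f) :
    Primrec (fun a => List.range (f a)) := Primrec.list_range.comp hf

@[fun_prop] theorem fun_length {f : α → List β} (hf : Primrec f) :
    Primrec (fun a => (f a).length) := Primrec.list_length.comp hf

@[fun_prop] theorem fun_tail {f : α → List β} (hf : Primrec f) :
    Primrec (fun a => (f a).tail) := Primrec.list_tail.comp hf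

@[fun_prop] theorem fun_getD {f : α → List β} {g : α → ℕ} {d : α → β} (hf : Primrec f)
    (hg : Primrec g) (hd : Primrec d) : Primrec (fun a => (f a).getD (g a) (d a)) := by
  simp only [List.getD_eq_getElem?_getD]
  exact Primrec.option_getD.comp (Primrec.list_getElem?.comp hf hg) hd

@[fun_prop] theorem fun_map {f : α → List β} {g : α → β → γ} (hf : Primrec f)
    (hg : Primrec (fun p : α × β => g p.1 p.2)) : Primrec (fun a => (f a).map (g a)) :=
  Primrec.list_map hf hg

@[fun_prop] theorem fun_flatMap {f : α → List β} {g : α → β → List γ} (hf : Primrec f)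
    (hg : Primrec (fun p : α × β => g p.1 p.2)) : Primrec (fun a => (f a).flatMap (g a)) :=
  Primrec.list_flatMap hf hg

@[fun_prop] theorem fun_foldr {f : α → List β} {g : α → β → γ → γ} {h : α → γ} (hf : Primrec f)
    (hg : Primrec (fun p : α × β × γ => g p.1 p.2.1 p.2.2)) (hh : Primrec h) :
    Primrec (fun a => (f a).foldr (g a) (h a)) :=
  Primrec.list_foldr (h := fun a p => g a p.1 p.2) hf hh hg

@[fun_prop] theorem fun_foldl {f : α → List β} {g : α → γ → β → γ} {h : α → γ} (hf : Primrec f)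
    (hg : Primrec (fun p : α × γ × β => g p.1 p.2.1 p.2.2)) (hh : Primrec h) :
    Primrec (fun a => (f a).foldl (g a) (h a)) :=
  Primrec.list_foldl (h := fun a p => g a p.1 p.2) hf hh hg

@[fun_prop] theorem fun_iterate {f : α → ℕ} {g : α → β → β} {h : α → β} (hf : Primrec f)
    (hg : Primrec (fun p : α × β => g p.1 p.2)) (hh : Primrec h) :
    Primrec (fun a => (g a)^[f a] (h a)) := Primrec.nat_iterate hf hh hg

@[fun_prop] theorem fun_filter {f : α → List β} {p : α → β → Bool} (hf : Primrec f)
    (hp : Primrec (fun q : α × β => p q.1 q.2)) : Primrec (fun a => (f a).filter (p a)) := by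
  have : (fun a => (f a).filter (p a)) = fun a => (f a).flatMap fun b => bif p a b then [b] else [] := by
    funext a
    induction f a with
    | nil => rfl
    | cons b l ih => cases h : p a b <;> simp [h, ih, List.flatMap_cons]
  rw [this]; fun_prop

@[fun_prop] theorem fun_ofNat {δ : Type*} [Denumerable δ] {f : α → ℕ} (hf : Primrec f) :
    Primrec (fun a => Denumerable.ofNat δ (f a)) := (Primrec.ofNat δ).comp hf

@[fun_prop] theorem fun_encode {f : α → β} (hf : Primrec f) :
    Primrec (fun a => Encodable.encode (f a)) := Primrec.encode.comp hf

end Primrec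

/-- Boolean bounded universal quantifier. -/
def allBelow (n : ℕ) (f : ℕ → Bool) : Bool := (List.range n).foldr (fun i b => f i && b) true

/-- Boolean bounded existential quantifier. -/
def anyBelow (n : ℕ) (f : ℕ → Bool) : Bool := !allBelow n fun i => !f i

@[simp] theorem allBelow_iff {n : ℕ} {f : ℕ → Bool} :
    allBelow n f = true ↔ ∀ i < n, f i = true := by
  have : ∀ l : List ℕ, l.foldr (fun i b => f i && b) true = true ↔ ∀ i ∈ l, f i = true := by
    intro l; induction l <;> simp_all
  simp [allBelow, this]

@[simp] theorem anyBelow_iff {n : ℕ} {f : ℕ → Bool} :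
    anyBelow n f = true ↔ ∃ i < n, f i = true := by
  rw [anyBelow, Bool.not_eq_true', ← Bool.not_eq_true, allBelow_iff]; push Not; simp

@[fun_prop] theorem Primrec.fun_allBelow {n : α → ℕ} {f : α → ℕ → Bool} (hn : Primrec n)
    (hf : Primrec (fun p : α × ℕ => f p.1 p.2)) : Primrec (fun a => allBelow (n a) (f a)) := by
  unfold allBelow; fun_prop

@[fun_prop] theorem Primrec.fun_anyBelow {n : α → ℕ} {f : α → ℕ → Bool} (hn : Primrec n)
    (hf : Primrec (fun p : α × ℕ => f p.1 p.2)) : Primrec (fun a => anyBelow (n a) (f a)) := by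
  unfold anyBelow; fun_prop

end PrimrecTools

namespace FOWorkflow

/-! ### Satisfiability over bounded universes as an arithmetical predicate -/

/-- Digit `p` of `ν` in base `B`. -/
def dig (B ν p : ℕ) : ℕ := ν / B ^ p % B

/-- Value of the term with code `t` when constants and variables are given by digits. -/
def termVal (B cst ν t : ℕ) : ℕ :=
  bif t.unpair.1 = 0 then dig B ν t.unpair.2 else dig B cst t.unpair.2

def termVals (B cst ν c : ℕ) : List ℕ :=
  (Denumerable.ofNat (List ℕ) c).map fun t => termVal B cst ν t

/-- All digits of `ν` respect the sizes of the universes. -/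
def validVal (B K sz ν : ℕ) : Bool :=
  allBelow K fun p => decide (dig B ν p ≤ dig B sz p.unpair.1)

def agreeOff (B K ν ν' p : ℕ) : Bool :=
  allBelow K fun p' => decide (p' = p) || decide (dig B ν p' = dig B ν' p')

def subClosed (K Sub : ℕ) : Bool :=
  allBelow K fun ψ => !Sub.testBit ψ ||
    bif decide (ψ.unpair.1 ≤ 2) then true
    else bif decide (ψ.unpair.1 = 3) || decide (ψ.unpair.1 = 8) then Sub.testBit ψ.unpair.2
    else bif decide (ψ.unpair.1 = 6) || decide (ψ.unpair.1 = 7) then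
      Sub.testBit ψ.unpair.2.unpair.2
    else Sub.testBit ψ.unpair.2.unpair.1 && Sub.testBit ψ.unpair.2.unpair.2

/-- In the type `A`, the relational atom with code `ψ` agrees under the valuation `ν` with all
relational atoms that speak about the same tuple. -/
def atomStep (B K sz cst Sub A ψ ν : ℕ) : Bool :=
  allBelow K fun ψ' => allBelow (B ^ K) fun ν' =>
    !(Sub.testBit ψ' && validVal B K sz ν' && decide (ψ'.unpair.1 = 2) &&
      decide (ψ'.unpair.2.unpair.1 = ψ.unpair.2.unpair.1) &&
      decide (termVals B cst ν ψ.unpair.2.unpair.2 =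
        termVals B cst ν' ψ'.unpair.2.unpair.2)) ||
    decide (A.testBit (Nat.pair ψ ν) = A.testBit (Nat.pair ψ' ν'))

/-- Some valuation differing from `ν` at most in `p` gives the formula with code `φ` the truth
value `b` in the type `A`. -/
def anyVariant (B K sz A ν p φ : ℕ) (b : Bool) : Bool :=
  anyBelow (B ^ K) fun ν' => validVal B K sz ν' && agreeOff B K ν ν' p &&
    decide (A.testBit (Nat.pair φ ν') = b)

/-- The truth value that local consistency requires for the non-relational formula with code `ψ`
under `ν` in the type `A` with successor `A'`. -/
def localValue (B K sz cst A A' ψ ν : ℕ) : Bool :=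
  let arg := ψ.unpair.2
  let l := A.testBit (Nat.pair arg.unpair.1 ν)
  let r := A.testBit (Nat.pair arg.unpair.2 ν)
  [true,
    decide (termVal B cst ν arg.unpair.1 = termVal B cst ν arg.unpair.2),
    true,
    !A.testBit (Nat.pair arg ν),
    l || r,
    l && r,
    anyVariant B K sz A ν arg.unpair.1 arg.unpair.2 true,
    !anyVariant B K sz A ν arg.unpair.1 arg.unpair.2 false,
    A'.testBit (Nat.pair arg ν),
    r || (l && A'.testBit (Nat.pair ψ ν)),
    r && (l || A'.testBit (Nat.pair ψ ν))].getD ψ.unpair.1 true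

/-- Local consistency of the type `A` with its successor `A'` at the formula code `ψ` and the
valuation `ν`. -/
def localStep (B K sz cst Sub A A' ψ ν : ℕ) : Bool :=
  bif decide (ψ.unpair.1 = 2) then atomStep B K sz cst Sub A ψ ν
  else decide (A.testBit (Nat.pair ψ ν) = localValue B K sz cst A A' ψ ν)

def typeStep (B K sz cst Sub A A' : ℕ) : Bool :=
  allBelow K fun ψ => allBelow (B ^ K) fun ν =>
    !(Sub.testBit ψ && validVal B K sz ν) || localStep B K sz cst Sub A A' ψ ν

/-- The obligation `u` (a pair of a formula code and a valuation) is pending in the type `A`. -/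
def pending (u A : ℕ) : Bool :=
  let ψ := u.unpair.1
  let r := A.testBit (Nat.pair ψ.unpair.2.unpair.2 u.unpair.2)
  (decide (ψ.unpair.1 = 9) && A.testBit u && !r) ||
    (decide (ψ.unpair.1 = 10) && !A.testBit u && r)

def typeBound (B K : ℕ) : ℕ := 2 ^ ((K + B ^ K) ^ 2)

/-- The obligation `u` can be discharged from every type in `G`. -/
def fairFor (B K sz cst Sub G u : ℕ) : Bool :=
  let M := typeBound B K
  allBelow (2 ^ M) fun Z =>
    !(allBelow M fun A => !G.testBit A ||
      ((pending u A || Z.testBit A) &&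
        allBelow M fun A' => !(G.testBit A' && Z.testBit A' && typeStep B K sz cst Sub A A') ||
          Z.testBit A)) ||
    allBelow M fun A => !G.testBit A || Z.testBit A

def initialType (B K sz X A : ℕ) : Bool :=
  allBelow (B ^ K) fun ν => !validVal B K sz ν || A.testBit (Nat.pair X ν)

def constsOk (B sz cst : ℕ) (cs : List ℕ) : Bool :=
  allBelow cs.length fun c => decide (dig B cst c ≤ dig B sz (cs.getD c 0))

/-- There is a temporal structure with universes of size at most `B` in which the formula
with code `X` holds under all valuations. -/
def boundedSat (B K X : ℕ) (cs : List ℕ) : Bool :=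
  let N := B ^ K
  let M := typeBound B K
  anyBelow N fun sz => anyBelow N fun cst => constsOk B sz cst cs &&
    anyBelow (2 ^ K) fun Sub => subClosed K Sub && Sub.testBit X &&
      anyBelow (2 ^ M) fun G =>
        (anyBelow M fun A => G.testBit A && initialType B K sz X A) &&
        (allBelow M fun A => !G.testBit A ||
          anyBelow M fun A' => G.testBit A' && typeStep B K sz cst Sub A A') &&
        allBelow K fun ψ => allBelow N fun ν =>
          !Sub.testBit ψ || fairFor B K sz cst Sub G (Nat.pair ψ ν)

section
variable {α : Type*} [Primcodable α]

@[fun_prop] theorem primrec_dig {f g h : α → ℕ} (hf : Primrec f) (hg : Primrec g)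
    (hh : Primrec h) : Primrec (fun a => dig (f a) (g a) (h a)) := by unfold dig; fun_prop

@[fun_prop] theorem primrec_termVal {b c f g : α → ℕ} (hb : Primrec b) (hc : Primrec c)
    (hf : Primrec f) (hg : Primrec g) : Primrec (fun a => termVal (b a) (c a) (f a) (g a)) := by
  unfold termVal; fun_prop

@[fun_prop] theorem primrec_termVals {b c f g : α → ℕ} (hb : Primrec b) (hc : Primrec c)
    (hf : Primrec f) (hg : Primrec g) : Primrec (fun a => termVals (b a) (c a) (f a) (g a)) := by
  unfold termVals; fun_prop

@[fun_prop] theorem primrec_validVal {b c f g : α → ℕ} (hb : Primrec b) (hc : Primrec c)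
    (hf : Primrec f) (hg : Primrec g) : Primrec (fun a => validVal (b a) (c a) (f a) (g a)) := by
  unfold validVal; fun_prop

@[fun_prop] theorem primrec_agreeOff {b c f g h : α → ℕ} (hb : Primrec b) (hc : Primrec c)
    (hf : Primrec f) (hg : Primrec g) (hh : Primrec h) :
    Primrec (fun a => agreeOff (b a) (c a) (f a) (g a) (h a)) := by
  unfold agreeOff; fun_prop

@[fun_prop] theorem primrec_subClosed {f g : α → ℕ} (hf : Primrec f) (hg : Primrec g) :
    Primrec (fun a => subClosed (f a) (g a)) := by unfold subClosed; fun_prop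

@[fun_prop] theorem primrec_atomStep {b k s c f g h i : α → ℕ} (hb : Primrec b)
    (hk : Primrec k) (hs : Primrec s) (hc : Primrec c) (hf : Primrec f) (hg : Primrec g)
    (hh : Primrec h) (hi : Primrec i) :
    Primrec (fun a => atomStep (b a) (k a) (s a) (c a) (f a) (g a) (h a) (i a)) := by
  unfold atomStep; fun_prop

@[fun_prop] theorem primrec_anyVariant {b k s f g h i : α → ℕ} {c : α → Bool}
    (hb : Primrec b) (hk : Primrec k) (hs : Primrec s) (hf : Primrec f) (hg : Primrec g)
    (hh : Primrec h) (hi : Primrec i) (hc : Primrec c) :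
    Primrec (fun a => anyVariant (b a) (k a) (s a) (f a) (g a) (h a) (i a) (c a)) := by
  unfold anyVariant; fun_prop

@[fun_prop] theorem primrec_localValue {b k s c g h i j : α → ℕ} (hb : Primrec b)
    (hk : Primrec k) (hs : Primrec s) (hc : Primrec c) (hg : Primrec g)
    (hh : Primrec h) (hi : Primrec i) (hj : Primrec j) :
    Primrec (fun a => localValue (b a) (k a) (s a) (c a) (g a) (h a) (i a) (j a)) := by
  unfold localValue; fun_prop

@[fun_prop] theorem primrec_localStep {b k s c f g h i j : α → ℕ} (hb : Primrec b)
    (hk : Primrec k) (hs : Primrec s) (hc : Primrec c) (hf : Primrec f) (hg : Primrec g)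
    (hh : Primrec h) (hi : Primrec i) (hj : Primrec j) :
    Primrec (fun a => localStep (b a) (k a) (s a) (c a) (f a) (g a) (h a) (i a) (j a)) := by
  unfold localStep; fun_prop

@[fun_prop] theorem primrec_typeStep {b k s c f g h : α → ℕ} (hb : Primrec b)
    (hk : Primrec k) (hs : Primrec s) (hc : Primrec c) (hf : Primrec f) (hg : Primrec g)
    (hh : Primrec h) :
    Primrec (fun a => typeStep (b a) (k a) (s a) (c a) (f a) (g a) (h a)) := by
  unfold typeStep; fun_prop

@[fun_prop] theorem primrec_pending {f g : α → ℕ} (hf : Primrec f) (hg : Primrec g) :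
    Primrec (fun a => pending (f a) (g a)) := by unfold pending; fun_prop

@[fun_prop] theorem primrec_typeBound {f g : α → ℕ} (hf : Primrec f) (hg : Primrec g) :
    Primrec (fun a => typeBound (f a) (g a)) := by unfold typeBound; fun_prop

@[fun_prop] theorem primrec_fairFor {b k s c f g h : α → ℕ} (hb : Primrec b)
    (hk : Primrec k) (hs : Primrec s) (hc : Primrec c) (hf : Primrec f) (hg : Primrec g)
    (hh : Primrec h) :
    Primrec (fun a => fairFor (b a) (k a) (s a) (c a) (f a) (g a) (h a)) := by
  unfold fairFor; fun_prop

@[fun_prop] theorem primrec_initialType {b k s f g : α → ℕ} (hb : Primrec b)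
    (hk : Primrec k) (hs : Primrec s) (hf : Primrec f) (hg : Primrec g) :
    Primrec (fun a => initialType (b a) (k a) (s a) (f a) (g a)) := by
  unfold initialType; fun_prop

@[fun_prop] theorem primrec_constsOk {b s c : α → ℕ} {l : α → List ℕ} (hb : Primrec b)
    (hs : Primrec s) (hc : Primrec c) (hl : Primrec l) :
    Primrec (fun a => constsOk (b a) (s a) (c a) (l a)) := by
  unfold constsOk; fun_prop

@[fun_prop] theorem primrec_boundedSat {b k f : α → ℕ} {l : α → List ℕ} (hb : Primrec b)
    (hk : Primrec k) (hf : Primrec f) (hl : Primrec l) :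
    Primrec (fun a => boundedSat (b a) (k a) (f a) (l a)) := by
  unfold boundedSat; fun_prop

end

/-! ### Digits, bits, fair paths -/

theorem dig_eq_zero {B K ν p : ℕ} (h : ν < B ^ K) (hp : K ≤ p) : dig B ν p = 0 := by
  rcases Nat.eq_zero_or_pos B with rfl | hB
  · rcases Nat.eq_zero_or_pos K with rfl | hK
    · have : ν = 0 := by simpa using h
      simp [dig, this]
    · simp [zero_pow hK.ne'] at h
  · simp [dig, Nat.div_eq_of_lt (h.trans_le (Nat.pow_le_pow_right hB hp))]

theorem exists_dig_eq (B K : ℕ) (f : ℕ → ℕ) (hf : ∀ p < K, f p < B) :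
    ∃ ν < B ^ K, ∀ p < K, dig B ν p = f p := by
  induction K with
  | zero => exact ⟨0, by simp⟩
  | succ K ih =>
    obtain ⟨ν, hν, h⟩ := ih fun p hp => hf p (by omega)
    have hK := hf K (by omega)
    have hB : 0 < B := by omega
    refine ⟨ν + B ^ K * f K, ?_, fun p hp => ?_⟩
    · calc ν + B ^ K * f K < B ^ K + B ^ K * f K := by omega
        _ = B ^ K * (f K + 1) := by ring
        _ ≤ B ^ K * B := Nat.mul_le_mul_left _ hK
        _ = B ^ (K + 1) := by ring
    · rcases Nat.lt_succ_iff_lt_or_eq.1 hp with hp | rfl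
      · rw [← h p hp]
        obtain ⟨k, rfl⟩ := Nat.exists_eq_add_of_lt hp
        have : ν + B ^ (p + k + 1) * f (p + k + 1) = ν + B ^ p * (B * (B ^ k * f (p + k + 1))) := by
          ring
        rw [dig, dig, this, Nat.add_mul_div_left _ _ (by positivity), Nat.add_mul_mod_self_left]
      · rw [dig, Nat.add_mul_div_left _ _ (by positivity), Nat.div_eq_of_lt hν, zero_add,
          Nat.mod_eq_of_lt hK]

theorem exists_testBit_iff (Q : ℕ) (P : ℕ → Prop) :
    ∃ A < 2 ^ Q, ∀ q < Q, A.testBit q = true ↔ P q := by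
  classical
  refine ⟨Nat.ofBits fun i : Fin Q => decide (P i), Nat.ofBits_lt_two_pow _, fun q hq => ?_⟩
  rw [Nat.testBit_ofBits_lt _ _ hq]; simp

theorem lt_of_testBit {A Q q : ℕ} (hA : A < 2 ^ Q) (h : A.testBit q = true) : q < Q := by
  by_contra hq
  rw [Nat.testBit_lt_two_pow (hA.trans_le (Nat.pow_le_pow_right (by norm_num) (not_lt.1 hq)))] at h
  exact absurd h (by simp)

theorem pair_lt_sq {K N ψ ν : ℕ} (hψ : ψ < K) (hν : ν < N) : Nat.pair ψ ν < (K + N) ^ 2 :=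
  (Nat.pair_lt_max_add_one_sq ψ ν).trans_le (Nat.pow_le_pow_left (by omega) 2)

/-- Every element of `G` starts a path in `G` along which every obligation is infinitely often not
pending, provided that each obligation can be discharged from every element of `G`. -/
theorem exists_fair_path {S : Type*} (G : Set S) (R : S → S → Prop) (pend : ℕ → S → Prop)
    (hsucc : ∀ A ∈ G, ∃ A' ∈ G, R A A')
    (hfair : ∀ u, ∀ Z : Set S, (∀ A ∈ G, ¬ pend u A → A ∈ Z) →
      (∀ A ∈ G, ∀ A' ∈ G, A' ∈ Z → R A A' → A ∈ Z) → G ⊆ Z)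
    {A₀ : S} (h₀ : A₀ ∈ G) :
    ∃ f : ℕ → S, f 0 = A₀ ∧ (∀ t, f t ∈ G) ∧ (∀ t, R (f t) (f (t + 1))) ∧
      ∀ u t, ∃ s ≥ t, ¬ pend u (f s) := by
  classical
  let D : ℕ → ℕ → S → Prop := fun u n => Nat.rec (motive := fun _ => S → Prop) (fun A => ¬ pend u A)
    (fun _ d A => ∃ A' ∈ G, d A' ∧ R A A') n
  have hD : ∀ u, ∀ A ∈ G, ∃ n, D u n A := fun u A hA =>
    hfair u {A | ∃ n, D u n A} (fun A _ h => ⟨0, h⟩)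
      (fun A _ A' hA' ⟨n, hn⟩ hR => ⟨n + 1, A', hA', hn, hR⟩) hA
  let rank : ℕ → {A // A ∈ G} → ℕ := fun u A => Nat.find (hD u A.1 A.2)
  have hnext : ∀ (A : {A // A ∈ G}) (u : ℕ), ∃ A' : {A // A ∈ G}, R A.1 A'.1 ∧
      (pend u A.1 → rank u A' < rank u A) := by
    intro A u
    by_cases hp : pend u A.1
    · have hspec : D u (rank u A) A.1 := Nat.find_spec (hD u A.1 A.2)
      cases hr : rank u A with
      | zero => rw [hr] at hspec; exact absurd hp hspec
      | succ n =>
        rw [hr] at hspec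
        obtain ⟨A', hA', hn, hR⟩ := hspec
        exact ⟨⟨A', hA'⟩, hR, fun _ => Nat.lt_succ_of_le (Nat.find_min' _ hn)⟩
    · obtain ⟨A', hA', hR⟩ := hsucc A.1 A.2
      exact ⟨⟨A', hA'⟩, hR, fun h => absurd h hp⟩
  choose nxt hR hrank using hnext
  let st : ℕ → {A // A ∈ G} × ℕ := fun t => Nat.rec (motive := fun _ => {A // A ∈ G} × ℕ) (⟨A₀, h₀⟩, 0)
    (fun _ p => (nxt p.1 p.2.unpair.1, if pend p.2.unpair.1 p.1.1 then p.2 else p.2 + 1)) t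
  have stay : ∀ n t, rank (st t).2.unpair.1 (st t).1 = n →
      ∃ s ≥ t, (st s).2 = (st t).2 ∧ ¬ pend (st s).2.unpair.1 (st s).1.1 := by
    intro n
    induction n using Nat.strong_induction_on with
    | _ n ih =>
      intro t ht
      by_cases hp : pend (st t).2.unpair.1 (st t).1.1
      · have h2 : (st (t + 1)).2 = (st t).2 := if_pos hp
        have h3 := hrank (st t).1 (st t).2.unpair.1 hp
        obtain ⟨s, hs, hs2, hs3⟩ := ih _ (by rw [← ht]; exact h3) (t + 1) (by rw [h2])
        exact ⟨s, by omega, hs2.trans h2, hs3⟩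
      · exact ⟨t, le_rfl, rfl, hp⟩
  have reach : ∀ t k, (st t).2 ≤ k → ∃ s ≥ t, (st s).2 = k ∧ ¬ pend k.unpair.1 (st s).1.1 := by
    intro t k hk
    induction k, hk using Nat.le_induction with
    | base => obtain ⟨s, hs, h2, h3⟩ := stay _ t rfl; exact ⟨s, hs, h2, h2 ▸ h3⟩
    | succ k _ ih =>
      obtain ⟨s, hs, rfl, h3⟩ := ih
      have h2 : (st (s + 1)).2 = (st s).2 + 1 := if_neg h3
      obtain ⟨r, hr, h4, h5⟩ := stay _ (s + 1) rfl
      exact ⟨r, by omega, h4.trans h2, by rw [h4, h2] at h5; exact h5⟩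
  refine ⟨fun t => (st t).1.1, rfl, fun t => (st t).1.2, fun t => hR _ _, fun u t => ?_⟩
  obtain ⟨s, hs, -, h⟩ := reach t (Nat.pair u (st t).2) (Nat.right_le_pair _ _)
  exact ⟨s, hs, by simpa using h⟩

/-- A solution of the expansion law of `until` that is not postponed for ever. -/
theorem until_of_expansion {q l r : ℕ → Prop} (hq : ∀ t, q t ↔ r t ∨ (l t ∧ q (t + 1)))
    (hio : ∀ t, ∃ s ≥ t, ¬ (q s ∧ ¬ r s)) (t : ℕ) :
    q t ↔ ∃ j, r (t + j) ∧ ∀ k < j, l (t + k) := by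
  constructor
  · intro h
    obtain ⟨s, hs, hns⟩ := hio t
    obtain ⟨n, rfl⟩ := Nat.exists_eq_add_of_le hs
    clear hs
    induction n generalizing t with
    | zero =>
      exact ⟨0, by by_contra hr; exact hns ⟨h, hr⟩, fun k hk => absurd hk (by omega)⟩
    | succ n ih =>
      by_cases hr : r t
      · exact ⟨0, hr, fun k hk => absurd hk (by omega)⟩
      · obtain ⟨hl, hq'⟩ := ((hq t).1 h).resolve_left hr
        obtain ⟨j, hj, hk⟩ := ih (t + 1) hq' (by rwa [show t + 1 + n = t + (n + 1) by omega])
        refine ⟨j + 1, by rwa [show t + (j + 1) = t + 1 + j by omega], fun k hkj => ?_⟩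
        cases k with
        | zero => exact hl
        | succ k => rw [show t + (k + 1) = t + 1 + k by omega]; exact hk k (by omega)
  · rintro ⟨j, hj, hl⟩
    induction j generalizing t with
    | zero => exact (hq t).2 (Or.inl hj)
    | succ j ih =>
      refine (hq t).2 (Or.inr ⟨hl 0 (by omega), ih (t + 1) ?_ fun k hk => ?_⟩)
      · rwa [show t + 1 + j = t + (j + 1) by omega]
      · rw [show t + 1 + k = t + (k + 1) by omega]; exact hl _ (by omega)

theorem le_encode_of_mem {l : List ℕ} {x : ℕ} (h : x ∈ l) : x ≤ Encodable.encode l := by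
  induction l with
  | nil => simp at h
  | cons a l ih =>
    rw [Encodable.encode_list_cons]
    rcases List.mem_cons.1 h with rfl | h
    · exact (Nat.left_le_pair _ _).trans (Nat.le_succ _)
    · exact ((ih h).trans (Nat.right_le_pair _ _)).trans (Nat.le_succ _)

/-! ### From a table of types to a structure -/

theorem Valuation.update_self {V : Vocab} {T : TemporalStructure.{u} V} (ν : Valuation T)
    (s i : ℕ) (d : T.U s) : ν.update s i d s i = d := by
  simp [Valuation.update]

theorem Valuation.update_of_ne {V : Vocab} {T : TemporalStructure.{u} V} (ν : Valuation T)
    {s i s' i' : ℕ} (d : T.U s) (h : (s', i') ≠ (s, i)) : ν.update s i d s' i' = ν s' i' := by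
  by_cases hs : s' = s
  · subst hs
    have hi : i' ≠ i := fun hi => h (by rw [hi])
    simp [Valuation.update, hi]
  · simp [Valuation.update, Function.update_of_ne hs]

section Realization

variable {V : Vocab} (B K sz cst Sub : ℕ) (f : ℕ → ℕ)

/-- The temporal structure described by the sequence `f` of types. -/
def realization (V : Vocab) (B K sz cst Sub : ℕ) (f : ℕ → ℕ) : TemporalStructure.{u} V where
  U s := ULift (Fin (dig B sz s + 1))
  nonempty s := ⟨⟨0⟩⟩
  const c := ⟨(V.constSort c).getD 0, ⟨Fin.ofNat _ (dig B cst c)⟩⟩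
  const_sort c s h := by simp [h]
  rel t R ds := V.arity R = some (ds.map Sigma.fst) ∧ ∃ ψ < K, ∃ ν < B ^ K,
    Sub.testBit ψ = true ∧ validVal B K sz ν = true ∧ ψ.unpair.1 = 2 ∧
    ψ.unpair.2.unpair.1 = R.code ∧
    termVals B cst ν ψ.unpair.2.unpair.2 = ds.map (fun d => d.2.down.val) ∧
    (f t).testBit (Nat.pair ψ ν) = true
  rel_sort _ _ _ h := h.1

variable {B K sz cst Sub f}

/-- `n` is the number of the valuation `ν`. -/
def IsNumberOf (ν : Valuation (realization.{u} V B K sz cst Sub f)) (n : ℕ) : Prop :=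
  n < B ^ K ∧ ∀ s i, Nat.pair s i < K → (ν s i).down.val = dig B n (Nat.pair s i)

theorem IsNumberOf.valid {ν : Valuation (realization.{u} V B K sz cst Sub f)} {n : ℕ}
    (h : IsNumberOf ν n) : validVal B K sz n = true := by
  simp only [validVal, allBelow_iff, decide_eq_true_eq]
  intro p hp
  have := h.2 p.unpair.1 p.unpair.2 (by simpa using hp)
  rw [Nat.pair_unpair] at this
  rw [← this]
  exact Nat.lt_succ_iff.1 (ν p.unpair.1 p.unpair.2).down.isLt

theorem exists_isNumberOf (hsz : sz < B ^ K)
    (ν : Valuation (realization.{u} V B K sz cst Sub f)) : ∃ n, IsNumberOf ν n := by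
  rcases Nat.eq_zero_or_pos K with rfl | hK
  · exact ⟨0, by simp, fun s i h => absurd h (by omega)⟩
  have hB : 0 < B := by
    rcases Nat.eq_zero_or_pos B with rfl | hB
    · simp [zero_pow hK.ne'] at hsz
    · exact hB
  obtain ⟨n, hn, h⟩ := exists_dig_eq B K (fun p => (ν p.unpair.1 p.unpair.2).down.val)
    fun p _ => (ν p.unpair.1 p.unpair.2).down.isLt.trans_le
      (Nat.succ_le_iff.2 (Nat.mod_lt _ hB))
  exact ⟨n, hn, fun s i hp => by rw [h _ hp, Nat.unpair_pair]⟩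

theorem IsNumberOf.update {ν : Valuation (realization.{u} V B K sz cst Sub f)} {n n' s i : ℕ}
    (h : IsNumberOf ν n) (hn' : n' < B ^ K) (ha : agreeOff B K n n' (Nat.pair s i) = true)
    {d : (realization.{u} V B K sz cst Sub f).U s} (hd : d.down.val = dig B n' (Nat.pair s i)) :
    IsNumberOf (ν.update s i d) n' := by
  refine ⟨hn', fun s' i' hp => ?_⟩
  by_cases he : (s', i') = (s, i)
  · obtain ⟨rfl, rfl⟩ := Prod.mk.inj he
    rw [Valuation.update_self, hd]
  · rw [Valuation.update_of_ne _ _ he, h.2 _ _ hp]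
    simp only [agreeOff, allBelow_iff, Bool.or_eq_true, decide_eq_true_eq] at ha
    refine (ha _ hp).resolve_left fun h' => he ?_
    obtain ⟨rfl, rfl⟩ := Nat.pair_eq_pair.1 h'
    rfl

/-- Updates of a valuation correspond to variants of its number. -/
theorem exists_update_iff {ν : Valuation (realization.{u} V B K sz cst Sub f)} {n s i : ℕ}
    (h : IsNumberOf ν n) (hp : Nat.pair s i < K) (hsz : sz < B ^ K)
    {P : Valuation (realization.{u} V B K sz cst Sub f) → Prop} {A φ : ℕ} {b : Bool}
    (hP : ∀ ν n, IsNumberOf ν n → (P ν ↔ A.testBit (Nat.pair φ n) = b)) :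
    (∃ d, P (ν.update s i d)) ↔ anyVariant B K sz A n (Nat.pair s i) φ b = true := by
  simp only [anyVariant, anyBelow_iff, Bool.and_eq_true, decide_eq_true_eq]
  constructor
  · rintro ⟨d, hd⟩
    obtain ⟨n', hn'⟩ := exists_isNumberOf hsz (ν.update s i d)
    refine ⟨n', hn'.1, ⟨hn'.valid, ?_⟩, (hP _ _ hn').1 hd⟩
    simp only [agreeOff, allBelow_iff, Bool.or_eq_true, decide_eq_true_eq]
    intro p hp'
    by_cases he : p = Nat.pair s i
    · exact Or.inl he
    · right
      have h1 := h.2 p.unpair.1 p.unpair.2 (by simpa using hp')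
      have h2 := hn'.2 p.unpair.1 p.unpair.2 (by simpa using hp')
      rw [Valuation.update_of_ne] at h2
      · rw [Nat.pair_unpair] at h1 h2; rw [← h1, ← h2]
      · rintro he'
        obtain ⟨rfl, rfl⟩ := Prod.mk.inj he'
        exact he (by simp)
  · rintro ⟨n', hn', ⟨hv, ha⟩, ht⟩
    simp only [validVal, allBelow_iff, decide_eq_true_eq] at hv
    have hlt := hv _ hp
    rw [Nat.unpair_pair] at hlt
    exact ⟨⟨⟨dig B n' (Nat.pair s i), Nat.lt_succ_of_le hlt⟩⟩,
      (hP _ _ (h.update hn' ha rfl)).2 ht⟩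

end Realization

section Realization

variable {V : Vocab} {B K sz cst Sub : ℕ} {f : ℕ → ℕ} {cs : List ℕ}

theorem eval_fst {T : TemporalStructure.{u} V} {ν : Valuation T} {t : Term} {s : ℕ}
    (h : t.HasSort V s) : (t.eval T ν).1 = s := by
  cases t with
  | var s' i => exact h.1
  | const c => exact T.const_sort c s h

theorem val_eval {ν : Valuation (realization.{u} V B K sz cst Sub f)} {n : ℕ}
    (hn : IsNumberOf ν n) (hV : ∀ c, V.constSort c = cs[c]?) (hcs : constsOk B sz cst cs = true)
    {t : Term} {s : ℕ} (h : t.HasSort V s) (ht : t.code < K) :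
    (t.eval _ ν).2.down.val = termVal B cst n t.code := by
  cases t with
  | var s' i =>
    have : Nat.pair s' i < K := (Nat.right_le_pair 0 _).trans_lt ht
    simpa [Term.eval, termVal, Term.code] using hn.2 _ _ this
  | const c =>
    have h1 : cs[c]? = some s := (hV c).symm.trans h
    obtain ⟨hc, h2⟩ := List.getElem?_eq_some_iff.1 h1
    simp only [constsOk, allBelow_iff, decide_eq_true_eq] at hcs
    have h3 := hcs c hc
    have h4 : (V.constSort c).getD 0 = cs.getD c 0 := by rw [hV, List.getD_eq_getElem?_getD]
    simp only [Term.eval, termVal, Term.code, Nat.unpair_pair, realization, Fin.val_ofNat]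
    rw [h4, Nat.mod_eq_of_lt (Nat.lt_succ_of_le h3)]
    rfl

theorem eval_eq_iff {x y : Σ s, (realization.{u} V B K sz cst Sub f).U s} (h : x.1 = y.1) :
    x = y ↔ x.2.down.val = y.2.down.val := by
  obtain ⟨s, x⟩ := x
  obtain ⟨s', y⟩ := y
  obtain rfl : s = s' := h
  constructor
  · intro h; rw [h]
  · intro h
    have : x = y := ULift.down_injective (Fin.ext h)
    rw [this]

theorem code_le_of_mem {R : RelSym} {ts : List Term} {t : Term} (h : t ∈ ts) :
    t.code ≤ (Formula.rel R ts).code :=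
  (le_encode_of_mem (List.mem_map_of_mem h)).trans
    ((Nat.right_le_pair _ _).trans (Nat.right_le_pair _ _))

theorem map_val_eval {ν : Valuation (realization.{u} V B K sz cst Sub f)} {n : ℕ}
    (hn : IsNumberOf ν n) (hV : ∀ c, V.constSort c = cs[c]?) (hcs : constsOk B sz cst cs = true)
    {ts : List Term} {l : List ℕ} (h : List.Forall₂ (fun t s => t.HasSort V s) ts l)
    (ht : ∀ t ∈ ts, t.code < K) :
    (ts.map (Term.eval _ ν)).map Sigma.fst = l ∧
      termVals B cst n (Encodable.encode (ts.map Term.code)) =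
        (ts.map (Term.eval _ ν)).map (fun d => d.2.down.val) := by
  rw [termVals, Denumerable.ofNat_encode]
  induction h with
  | nil => exact ⟨rfl, rfl⟩
  | cons h _ ih =>
    obtain ⟨h1, h2⟩ := ih fun t h => ht t (List.mem_cons_of_mem _ h)
    simp only [List.map_cons, h1, h2, eval_fst h, true_and, List.cons.injEq, and_true]
    exact (val_eval hn hV hcs h (ht _ List.mem_cons_self)).symm

theorem realization_rel {t : ℕ} {R : RelSym}
    {ds : List (Σ s, (realization.{u} V B K sz cst Sub f).U s)} :
    (realization.{u} V B K sz cst Sub f).rel t R ds ↔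
      V.arity R = some (ds.map Sigma.fst) ∧ ∃ ψ < K, ∃ ν < B ^ K,
        Sub.testBit ψ = true ∧ validVal B K sz ν = true ∧ ψ.unpair.1 = 2 ∧
        ψ.unpair.2.unpair.1 = R.code ∧
        termVals B cst ν ψ.unpair.2.unpair.2 = ds.map (fun d => d.2.down.val) ∧
        (f t).testBit (Nat.pair ψ ν) = true := Iff.rfl

/-- In the structure described by a fair sequence of locally consistent types, exactly the formulas
listed in the types hold. -/
theorem sat_realization_iff (hV : ∀ c, V.constSort c = cs[c]?)
    (hcs : constsOk B sz cst cs = true) (hsz : sz < B ^ K)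
    (hSub : Sub < 2 ^ K) (hcl : subClosed K Sub = true)
    (hstep : ∀ t, typeStep B K sz cst Sub (f t) (f (t + 1)) = true)
    (hfair : ∀ ψ, Sub.testBit ψ = true → ∀ ν < B ^ K, ∀ t, ∃ s ≥ t,
      pending (Nat.pair ψ ν) (f s) = false) :
    ∀ (ψ : Formula), ψ.WellSorted V → Sub.testBit ψ.code = true →
      ∀ (ν : Valuation (realization.{u} V B K sz cst Sub f)) (n : ℕ), IsNumberOf ν n → ∀ t,
        (ψ.Sat _ ν t ↔ (f t).testBit (Nat.pair ψ.code n) = true) := by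
  have hlt : ∀ {ψ : ℕ}, Sub.testBit ψ = true → ψ < K := fun h => lt_of_testBit hSub h
  have hloc : ∀ {ψ : ℕ}, Sub.testBit ψ = true →
      ∀ {ν : Valuation (realization.{u} V B K sz cst Sub f)} {n : ℕ}, IsNumberOf ν n → ∀ t,
        localStep B K sz cst Sub (f t) (f (t + 1)) ψ n = true := by
    intro ψ hψ ν n hn t
    have := hstep t
    simp only [typeStep, allBelow_iff] at this
    simpa [hψ, hn.valid] using this ψ (hlt hψ) n hn.1
  have hsub : ∀ {ψ : ℕ}, Sub.testBit ψ = true → _ := fun {ψ} h =>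
    (allBelow_iff.1 hcl) ψ (hlt h)
  intro ψ
  induction ψ with
  | tru =>
    intro _ hS ν n hn t
    have := hloc hS hn t
    simp [localStep, localValue, Formula.code] at this
    simp [Formula.Sat, this, Formula.code]
  | eq a b =>
    rintro ⟨s, ha, hb⟩ hS ν n hn t
    have := hloc hS hn t
    simp only [localStep, localValue, Formula.code, Nat.unpair_pair] at this
    simp at this
    have hK := hlt hS
    have h1 : a.code ≤ Formula.code (.eq a b) :=
      (Nat.left_le_pair _ b.code).trans (Nat.right_le_pair _ _)
    have h2 : b.code ≤ Formula.code (.eq a b) :=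
      (Nat.right_le_pair a.code _).trans (Nat.right_le_pair _ _)
    rw [Formula.Sat, eval_eq_iff ((eval_fst ha).trans (eval_fst hb).symm),
      val_eval hn hV hcs ha (h1.trans_lt hK), val_eval hn hV hcs hb (h2.trans_lt hK)]
    simp [Formula.code, this]
  | rel R ts =>
    rintro ⟨l, hR, hl⟩ hS ν n hn t
    have hK := hlt hS
    obtain ⟨h1, h2⟩ := map_val_eval hn hV hcs hl
      fun t h => (code_le_of_mem (R := R) h).trans_lt hK
    have hloc := hloc hS hn t
    simp only [localStep, atomStep, Formula.code, Nat.unpair_pair, decide_true, cond_true,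
      allBelow_iff] at hloc
    rw [Formula.Sat, realization_rel, h1, hR, ← h2]
    simp only [true_and]
    constructor
    · rintro ⟨ψ', hψ', ν', hν', hS', hv', htag, hR', hvals, hbit⟩
      have := hloc ψ' hψ' ν' hν'
      simp only [hS', hv', htag, hR', hvals] at this
      simpa [hbit, Formula.code] using this
    · intro hbit
      exact ⟨_, hK, n, hn.1, hS, hn.valid, by simp [Formula.code], by simp [Formula.code],
        by simp [Formula.code], hbit⟩
  | not φ ih =>
    intro hw hS ν n hn t
    have h1 := hloc hS hn t
    have h2 := hsub hS
    simp [localStep, localValue, Formula.code] at h1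
    simp [Formula.code] at h2 hS
    rw [Formula.Sat, ih hw (h2.resolve_left (by simp [hS])) ν n hn t]
    simp [Formula.code, h1]
  | or φ χ ih₁ ih₂ =>
    intro hw hS ν n hn t
    have h1 := hloc hS hn t
    have h2 := hsub hS
    simp [localStep, localValue, Formula.code] at h1
    simp [Formula.code] at h2 hS
    have h3 := h2.resolve_left (by simp [hS])
    rw [Formula.Sat, ih₁ hw.1 h3.1 ν n hn t, ih₂ hw.2 h3.2 ν n hn t]
    simp [Formula.code, h1]
  | and φ χ ih₁ ih₂ =>
    intro hw hS ν n hn t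
    have h1 := hloc hS hn t
    have h2 := hsub hS
    simp [localStep, localValue, Formula.code] at h1
    simp [Formula.code] at h2 hS
    have h3 := h2.resolve_left (by simp [hS])
    rw [Formula.Sat, ih₁ hw.1 h3.1 ν n hn t, ih₂ hw.2 h3.2 ν n hn t]
    simp [Formula.code, h1]
  | ex s i φ ih =>
    intro hw hS ν n hn t
    have h1 := hloc hS hn t
    have h2 := hsub hS
    have hK : Nat.pair s i < K := lt_of_le_of_lt
      ((Nat.left_le_pair _ φ.code).trans (Nat.right_le_pair 6 _)) (hlt hS)
    simp [localStep, localValue, Formula.code] at h1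
    simp [Formula.code] at h2 hS
    rw [Formula.Sat, exists_update_iff (P := fun ν => φ.Sat _ ν t) (b := true) hn hK hsz
      fun ν n hn => ih hw.2 (h2.resolve_left (by simp [hS])) ν n hn t]
    simp [Formula.code, h1]
  | all s i φ ih =>
    intro hw hS ν n hn t
    have h1 := hloc hS hn t
    have h2 := hsub hS
    have hK : Nat.pair s i < K := lt_of_le_of_lt
      ((Nat.left_le_pair _ φ.code).trans (Nat.right_le_pair 7 _)) (hlt hS)
    simp [localStep, localValue, Formula.code] at h1
    simp [Formula.code] at h2 hS
    have h3 := exists_update_iff (P := fun ν => ¬ φ.Sat _ ν t) (b := false) hn hK hsz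
      fun ν n hn => by
        rw [ih hw.2 (h2.resolve_left (by simp [hS])) ν n hn t, Bool.not_eq_true]
    rw [Formula.Sat]
    simp only [Formula.code, h1, Bool.not_eq_true', ← Bool.not_eq_true, ← h3]
    push Not
    rfl
  | next φ ih =>
    intro hw hS ν n hn t
    have h1 := hloc hS hn t
    have h2 := hsub hS
    simp [localStep, localValue, Formula.code] at h1
    simp [Formula.code] at h2 hS
    rw [Formula.Sat, ih hw (h2.resolve_left (by simp [hS])) ν n hn (t + 1)]
    simp [Formula.code, h1]
  | untl φ χ ih₁ ih₂ =>
    intro hw hS ν n hn t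
    have h1 := hloc hS hn
    have h2 := hsub hS
    have hf := hfair _ hS _ hn.1
    simp [localStep, localValue, Formula.code] at h1
    simp [Formula.code, pending] at h2 hS hf
    have h3 := h2.resolve_left (by simp [hS])
    simp only [Formula.Sat, ih₁ hw.1 h3.1 ν n hn, ih₂ hw.2 h3.2 ν n hn]
    refine (until_of_expansion (q := fun t => (f t).testBit (Nat.pair (φ.untl χ).code n) = true)
      (r := fun t => (f t).testBit (Nat.pair χ.code n) = true)
      (l := fun t => (f t).testBit (Nat.pair φ.code n) = true)
      (fun t => ?_) (fun t => ?_) t).symm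
    · simp only [Formula.code]; rw [h1 t]; simp
    · obtain ⟨s, hs, h⟩ := hf t
      exact ⟨s, hs, fun h' => h'.2 (h h'.1)⟩
  | release φ χ ih₁ ih₂ =>
    intro hw hS ν n hn t
    have h1 := hloc hS hn
    have h2 := hsub hS
    have hf := hfair _ hS _ hn.1
    simp [localStep, localValue, Formula.code] at h1
    simp [Formula.code, pending] at h2 hS hf
    have h3 := h2.resolve_left (by simp [hS])
    simp only [Formula.Sat, ih₁ hw.1 h3.1 ν n hn, ih₂ hw.2 h3.2 ν n hn]
    rw [not_iff_comm]
    refine until_of_expansion (q := fun t => ¬ (f t).testBit (Nat.pair (φ.release χ).code n) = true)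
      (r := fun t => ¬ (f t).testBit (Nat.pair χ.code n) = true)
      (l := fun t => ¬ (f t).testBit (Nat.pair φ.code n) = true)
      (fun t => ?_) (fun t => ?_) t
    · simp only [Formula.code]; rw [h1 t, Bool.and_eq_true, Bool.or_eq_true]; tauto
    · obtain ⟨s, hs, h⟩ := hf t
      exact ⟨s, hs, fun h' => h'.2 (by simpa using h (by simpa [Formula.code] using h'.1))⟩

end Realization

theorem exists_structure_of_boundedSat {V : Vocab} {B K : ℕ} {ψ : Formula} {cs : List ℕ}
    (hV : ∀ c, V.constSort c = cs[c]?) (hψ : ψ.WellSorted V)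
    (h : boundedSat B K ψ.code cs = true) :
    ∃ T : TemporalStructure.{u} V, ∀ ν : Valuation T, ψ.Sat T ν 0 := by
  simp only [boundedSat, anyBelow_iff, allBelow_iff, Bool.and_eq_true, Bool.or_eq_true,
    Bool.not_eq_true', ← Bool.not_eq_true, initialType, fairFor] at h
  obtain ⟨sz, hsz, cst, -, hcs, Sub, hSub, ⟨hcl, hX⟩, G, -, ⟨⟨A₀, hA₀, hG₀, hinit⟩, hsucc⟩,
    hfair⟩ := h
  obtain ⟨f, hf0, hfG, hfR, hfp⟩ := exists_fair_path
    {A | A < typeBound B K ∧ G.testBit A = true}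
    (fun A A' => typeStep B K sz cst Sub A A' = true)
    (fun u A => (Sub.testBit u.unpair.1 = true ∧ u.unpair.2 < B ^ K) ∧ pending u A = true)
    (fun A hA => by
      obtain ⟨A', h1, h2, h3⟩ := (hsucc A hA.1).resolve_left (fun h => h hA.2)
      exact ⟨A', ⟨h1, h2⟩, h3⟩)
    (fun u Z h1 h2 A hA => by
      by_cases hu : Sub.testBit u.unpair.1 = true ∧ u.unpair.2 < B ^ K
      · obtain ⟨z, hz, hzZ⟩ := exists_testBit_iff (typeBound B K) (· ∈ Z)
        have h3 := (hfair _ (lt_of_testBit hSub hu.1) _ hu.2).resolve_left (fun h => h hu.1) z hz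
        rw [Nat.pair_unpair] at h3
        refine (hzZ A hA.1).1 (((h3.resolve_left fun h4 => h4 fun A hA => ?_) A hA.1).resolve_left
          fun h => h hA.2)
        by_cases hAG : G.testBit A = true
        · right
          constructor
          · by_cases hp : pending u A = true
            · exact Or.inl hp
            · exact Or.inr ((hzZ A hA).2 (h1 A ⟨hA, hAG⟩ fun h => hp h.2))
          · intro A' hA'
            by_cases h5 : (G.testBit A' = true ∧ z.testBit A' = true) ∧
                typeStep B K sz cst Sub A A' = true
            · exact Or.inr ((hzZ A hA).2
                (h2 A ⟨hA, hAG⟩ A' ⟨hA', h5.1.1⟩ ((hzZ A' hA').1 h5.1.2) h5.2))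
            · exact Or.inl (by simpa using h5)
        · exact Or.inl hAG
      · exact h1 A hA fun h => hu h.1)
    (A₀ := A₀) ⟨hA₀, hG₀⟩
  refine ⟨realization V B K sz cst Sub f, fun ν => ?_⟩
  obtain ⟨n, hn⟩ := exists_isNumberOf hsz ν
  rw [sat_realization_iff hV hcs hsz hSub hcl hfR (fun φ hφ m hm t => ?_) ψ hψ hX ν n hn 0, hf0]
  · exact (hinit n hn.1).resolve_left fun h => h hn.valid
  · obtain ⟨s, hs, h⟩ := hfp (Nat.pair φ m) t
    exact ⟨s, hs, by simpa [hφ, hm] using h⟩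

theorem RelSym.code_injective : Function.Injective RelSym.code := by
  intro a b h
  cases a <;> cases b <;> simp_all [RelSym.code, Nat.pair_eq_pair]

theorem Term.code_injective : Function.Injective Term.code := by
  intro a b h
  cases a <;> cases b <;> simp_all [Term.code, Nat.pair_eq_pair]

theorem Formula.code_injective : Function.Injective Formula.code := by
  intro a
  induction a with
  | rel R ts =>
    intro b h
    cases b <;> simp [Formula.code, Nat.pair_eq_pair] at h ⊢
    exact ⟨RelSym.code_injective h.1, List.map_injective_iff.2 Term.code_injective h.2⟩
  | eq s t =>
    intro b h
    cases b <;> simp [Formula.code, Nat.pair_eq_pair] at h ⊢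
    exact ⟨Term.code_injective h.1, Term.code_injective h.2⟩
  | tru => intro b h; cases b <;> simp_all [Formula.code, Nat.pair_eq_pair]
  | not φ ih =>
    intro b h
    cases b <;> simp [Formula.code, Nat.pair_eq_pair] at h ⊢
    exact ih h
  | next φ ih =>
    intro b h
    cases b <;> simp [Formula.code, Nat.pair_eq_pair] at h ⊢
    exact ih h
  | ex s i φ ih =>
    intro b h
    cases b <;> simp [Formula.code, Nat.pair_eq_pair] at h ⊢
    exact ⟨h.1.1, h.1.2, ih h.2⟩
  | all s i φ ih =>
    intro b h
    cases b <;> simp [Formula.code, Nat.pair_eq_pair] at h ⊢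
    exact ⟨h.1.1, h.1.2, ih h.2⟩
  | or φ ψ ih₁ ih₂ | and φ ψ ih₁ ih₂ | untl φ ψ ih₁ ih₂ | release φ ψ ih₁ ih₂ =>
    intro b h
    cases b <;> simp [Formula.code, Nat.pair_eq_pair] at h ⊢
    exact ⟨ih₁ h.1, ih₂ h.2⟩

/-! ### From a structure to a table of types -/

section Numbering

variable {V : Vocab} (T : TemporalStructure.{u} V) (e : ∀ s, T.U s → ℕ) (dec : ∀ s, ℕ → T.U s)

/-- The valuation with number `n`. -/
def decodeVal (B n : ℕ) : Valuation T := fun s i => dec s (dig B n (Nat.pair s i))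

variable {T e dec} {B K sz cst : ℕ} {cs : List ℕ} {size : ℕ → ℕ}

theorem decodeVal_eq_update {n n' s i : ℕ} (hn : n < B ^ K) (hn' : n' < B ^ K)
    (h : agreeOff B K n n' (Nat.pair s i) = true) :
    decodeVal T dec B n' = (decodeVal T dec B n).update s i (decodeVal T dec B n' s i) := by
  funext s' i'
  by_cases he : (s', i') = (s, i)
  · obtain ⟨rfl, rfl⟩ := Prod.mk.inj he
    rw [Valuation.update_self]
  · rw [Valuation.update_of_ne _ _ he]
    simp only [agreeOff, allBelow_iff, Bool.or_eq_true, decide_eq_true_eq] at h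
    by_cases hp : Nat.pair s' i' < K
    · refine congrArg (dec s') ((h _ hp).resolve_left fun h' => he ?_).symm
      obtain ⟨rfl, rfl⟩ := Nat.pair_eq_pair.1 h'
      rfl
    · rw [decodeVal, decodeVal, dig_eq_zero hn (not_lt.1 hp), dig_eq_zero hn' (not_lt.1 hp)]

/-- `e` and `dec` number the universes of `T`, whose sizes are listed in `sz`. -/
structure IsNumbering (T : TemporalStructure.{u} V) (e : ∀ s, T.U s → ℕ) (dec : ∀ s, ℕ → T.U s)
    (B K sz : ℕ) : Prop where
  dec_e : ∀ s x, dec s (e s x) = x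
  e_lt : ∀ s x, e s x < B
  e_le : ∀ s < K, ∀ x, e s x ≤ dig B sz s
  e_dec : ∀ s < K, ∀ d ≤ dig B sz s, e s (dec s d) = d

theorem fst_lt_of_pair_lt {s i K : ℕ} (h : Nat.pair s i < K) : s < K :=
  (Nat.left_le_pair _ _).trans_lt h

theorem exists_variant (h : IsNumbering T e dec B K sz) {n s i : ℕ}
    (hn : n < B ^ K) (hv : validVal B K sz n = true) (hp : Nat.pair s i < K) {P : Valuation T → Prop}
    {A φ : ℕ} {b : Bool} (hP : ∀ n < B ^ K, validVal B K sz n = true →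
      (P (decodeVal T dec B n) ↔ A.testBit (Nat.pair φ n) = b)) :
    (∃ d, P ((decodeVal T dec B n).update s i d)) ↔
      anyVariant B K sz A n (Nat.pair s i) φ b = true := by
  simp only [anyVariant, anyBelow_iff, Bool.and_eq_true, decide_eq_true_eq]
  have hv' := hv
  simp only [validVal, allBelow_iff, decide_eq_true_eq] at hv'
  constructor
  · rintro ⟨d, hd⟩
    obtain ⟨n', hn', hdig⟩ := exists_dig_eq B K
      (fun p => if p = Nat.pair s i then e s d else dig B n p) (fun p hp => by
        have hB := (Nat.zero_le _).trans_lt (h.e_lt s d)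
        split
        · exact h.e_lt s d
        · exact Nat.mod_lt _ hB)
    have ha : agreeOff B K n n' (Nat.pair s i) = true := by
      simp only [agreeOff, allBelow_iff, Bool.or_eq_true, decide_eq_true_eq]
      intro p hp
      rw [hdig p hp]
      by_cases he : p = Nat.pair s i <;> simp [he]
    have hvn : validVal B K sz n' = true := by
      simp only [validVal, allBelow_iff, decide_eq_true_eq]
      intro p hp
      rw [hdig p hp]
      split
      · next he => subst he; rw [Nat.unpair_pair]; exact h.e_le s (fst_lt_of_pair_lt hp) d
      · exact hv' p hp
    have hs : decodeVal T dec B n' s i = d := by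
      rw [decodeVal, hdig _ hp, if_pos rfl, h.dec_e]
    refine ⟨n', hn', ⟨hvn, ha⟩, (hP n' hn' hvn).1 ?_⟩
    rwa [decodeVal_eq_update hn hn' ha, hs]
  · rintro ⟨n', hn', ⟨hvn, ha⟩, ht⟩
    exact ⟨decodeVal T dec B n' s i, decodeVal_eq_update hn hn' ha ▸ (hP n' hn' hvn).2 ht⟩

theorem e_eval (h : IsNumbering T e dec B K sz) (hV : ∀ c, V.constSort c = cs[c]?)
    (hcst : ∀ c < cs.length, dig B cst c = e _ (T.const c).2) {n : ℕ}
    (hv : validVal B K sz n = true) {t : Term} {s : ℕ} (ht : t.HasSort V s) (hK : t.code < K) :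
    e _ (t.eval T (decodeVal T dec B n)).2 = termVal B cst n t.code := by
  cases t with
  | var s' i =>
    have hp : Nat.pair s' i < K := (Nat.right_le_pair 0 _).trans_lt hK
    simp only [validVal, allBelow_iff, decide_eq_true_eq] at hv
    have := hv _ hp
    rw [Nat.unpair_pair] at this
    simpa [Term.eval, termVal, Term.code, decodeVal] using h.e_dec s' (fst_lt_of_pair_lt hp) _ this
  | const c =>
    have h1 : cs[c]? = some s := (hV c).symm.trans ht
    obtain ⟨hc, h2⟩ := List.getElem?_eq_some_iff.1 h1
    simpa [Term.eval, termVal, Term.code] using (hcst c hc).symm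

theorem sigma_eq_iff (h : IsNumbering T e dec B K sz) {x y : Σ s, T.U s} (hxy : x.1 = y.1) :
    x = y ↔ e _ x.2 = e _ y.2 := by
  obtain ⟨s, x⟩ := x
  obtain ⟨s', y⟩ := y
  obtain rfl : s = s' := hxy
  constructor
  · intro h; rw [h]
  · intro h'
    have : x = y := by rw [← h.dec_e s x, ← h.dec_e s y]; exact congrArg (dec s) h'
    rw [this]

theorem termVals_eq (h : IsNumbering T e dec B K sz) (hV : ∀ c, V.constSort c = cs[c]?)
    (hcst : ∀ c < cs.length, dig B cst c = e _ (T.const c).2) {n : ℕ}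
    (hv : validVal B K sz n = true) {ts : List Term} {l : List ℕ}
    (hts : List.Forall₂ (fun t s => t.HasSort V s) ts l) (hK : ∀ t ∈ ts, t.code < K) :
    termVals B cst n (Encodable.encode (ts.map Term.code)) =
      (ts.map (Term.eval T (decodeVal T dec B n))).map fun d => e _ d.2 := by
  rw [termVals, Denumerable.ofNat_encode]
  induction hts with
  | nil => rfl
  | cons ht _ ih =>
    simp only [List.map_cons, ih fun t h => hK t (List.mem_cons_of_mem _ h), List.cons.injEq,
      and_true]
    exact (e_eval h hV hcst hv ht (hK _ List.mem_cons_self)).symm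

theorem map_eval_eq (h : IsNumbering T e dec B K sz) {ts ts' : List Term} {l : List ℕ}
    {ν ν' : Valuation T} (hts : List.Forall₂ (fun t s => t.HasSort V s) ts l)
    (hts' : List.Forall₂ (fun t s => t.HasSort V s) ts' l)
    (heq : (ts.map (Term.eval T ν)).map (fun d => e _ d.2) =
      (ts'.map (Term.eval T ν')).map (fun d => e _ d.2)) :
    ts.map (Term.eval T ν) = ts'.map (Term.eval T ν') := by
  induction hts generalizing ts' with
  | nil => cases hts'; rfl
  | cons ht _ ih =>
    cases hts' with
    | cons ht' hts' =>
      simp only [List.map_cons, List.cons.injEq] at heq ⊢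
      exact ⟨(sigma_eq_iff h ((eval_fst ht).trans (eval_fst ht').symm)).2 heq.1, ih hts' heq.2⟩

end Numbering

theorem sat_untl_iff {V : Vocab} {T : TemporalStructure.{u} V} {ν : Valuation T} {t : ℕ}
    {φ ψ : Formula} : (Formula.untl φ ψ).Sat T ν t ↔
      ψ.Sat T ν t ∨ (φ.Sat T ν t ∧ (Formula.untl φ ψ).Sat T ν (t + 1)) := by
  constructor
  · rintro ⟨j, hj, hk⟩
    cases j with
    | zero => exact Or.inl hj
    | succ j =>
      refine Or.inr ⟨hk 0 (by omega), j, ?_, fun k hkj => ?_⟩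
      · rwa [show t + 1 + j = t + (j + 1) by omega]
      · rw [show t + 1 + k = t + (k + 1) by omega]; exact hk _ (by omega)
  · rintro (h | ⟨h, j, hj, hk⟩)
    · exact ⟨0, h, fun k hk => absurd hk (by omega)⟩
    · refine ⟨j + 1, by rwa [show t + (j + 1) = t + 1 + j by omega], fun k hkj => ?_⟩
      cases k with
      | zero => exact h
      | succ k => rw [show t + (k + 1) = t + 1 + k by omega]; exact hk _ (by omega)

theorem sat_release_iff {V : Vocab} {T : TemporalStructure.{u} V} {ν : Valuation T} {t : ℕ}
    {φ ψ : Formula} : (Formula.release φ ψ).Sat T ν t ↔ ¬ (Formula.untl (.not φ) (.not ψ)).Sat T ν t :=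
  Iff.rfl

/-- The types of a structure are locally consistent. -/
theorem localStep_of_structure {V : Vocab} {T : TemporalStructure.{u} V} {e : ∀ s, T.U s → ℕ}
    {dec : ∀ s, ℕ → T.U s} {B K sz cst Sub : ℕ} {cs : List ℕ}
    (h : IsNumbering T e dec B K sz) (hV : ∀ c, V.constSort c = cs[c]?)
    (hcst : ∀ c < cs.length, dig B cst c = e _ (T.const c).2)
    (hSub : ∀ ψ < K, Sub.testBit ψ = true ↔ ∃ φ : Formula, φ.WellSorted V ∧ φ.code = ψ)
    {A : ℕ → ℕ} (hA : ∀ t (φ : Formula), φ.code < K → ∀ n < B ^ K,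
      (A t).testBit (Nat.pair φ.code n) = true ↔ φ.Sat T (decodeVal T dec B n) t)
    {φ : Formula} (hφ : φ.WellSorted V) (hK : φ.code < K) {n : ℕ} (hn : n < B ^ K)
    (hv : validVal B K sz n = true) (t : ℕ) :
    localStep B K sz cst Sub (A t) (A (t + 1)) φ.code n = true := by
  have hA1 := fun t => hA t φ hK n hn
  cases φ with
  | tru => simpa [localStep, localValue, Formula.code, Formula.Sat] using hA1 t
  | eq a b =>
    obtain ⟨s, ha, hb⟩ := hφ
    have h1 : a.code ≤ Formula.code (.eq a b) :=
      (Nat.left_le_pair _ b.code).trans (Nat.right_le_pair _ _)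
    have h2 : b.code ≤ Formula.code (.eq a b) :=
      (Nat.right_le_pair a.code _).trans (Nat.right_le_pair _ _)
    have h3 := hA1 t
    rw [Formula.Sat, sigma_eq_iff h ((eval_fst ha).trans (eval_fst hb).symm),
      e_eval h hV hcst hv ha (h1.trans_lt hK), e_eval h hV hcst hv hb (h2.trans_lt hK)] at h3
    simp only [Formula.code] at h3
    simp only [localStep, localValue, Formula.code, Nat.unpair_pair]
    simp
    rw [Bool.eq_iff_iff, h3]
    simp
  | rel R ts =>
    obtain ⟨l, hR, hl⟩ := hφ
    simp only [localStep, atomStep, Formula.code, Nat.unpair_pair, decide_true, cond_true,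
      allBelow_iff]
    intro ψ' hψ' n' hn'
    by_cases hc : (Sub.testBit ψ' && validVal B K sz n' && decide (ψ'.unpair.1 = 2) &&
        decide (ψ'.unpair.2.unpair.1 = R.code) &&
        decide (termVals B cst n (Encodable.encode (ts.map Term.code)) =
          termVals B cst n' ψ'.unpair.2.unpair.2)) = true
    · rw [hc]
      simp only [Bool.and_eq_true, decide_eq_true_eq] at hc
      obtain ⟨⟨⟨⟨hS, hv'⟩, htag⟩, hR'⟩, hvals⟩ := hc
      obtain ⟨φ', hw', rfl⟩ := (hSub ψ' hψ').1 hS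
      cases φ' with
      | rel R' ts' =>
        simp only [Formula.code, Nat.unpair_pair] at hR' hvals
        obtain rfl := RelSym.code_injective hR'
        obtain ⟨l', hR', hl'⟩ := hw'
        obtain rfl : l = l' := Option.some_inj.1 (hR.symm.trans hR')
        rw [termVals_eq h hV hcst hv hl fun t h => (code_le_of_mem h).trans_lt hK,
          termVals_eq h hV hcst hv' hl' fun t h => (code_le_of_mem h).trans_lt hψ'] at hvals
        have h1 := hA1 t
        have h2 := hA t _ hψ' n' hn'
        rw [Formula.Sat, map_eval_eq h hl hl' hvals] at h1
        have h3 := h1.trans h2.symm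
        simp only [Formula.code] at h3
        rw [Bool.not_true, Bool.false_or]
        exact decide_eq_true (Bool.eq_iff_iff.2 h3)
      | _ => simp [Formula.code] at htag
    · rw [Bool.not_eq_true] at hc
      rw [hc]; rfl
  | not φ =>
    have h1 : φ.code < K := (Nat.right_le_pair _ _).trans_lt hK
    have h2 := hA1 t
    rw [Formula.Sat, ← hA t φ h1 n hn] at h2
    simp only [Formula.code] at h2
    simp only [localStep, localValue, Formula.code, Nat.unpair_pair]
    simp
    rw [Bool.eq_iff_iff, h2]
    simp
  | or φ ψ =>
    have h1 : φ.code < K :=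
      ((Nat.left_le_pair _ _).trans (Nat.right_le_pair _ _)).trans_lt hK
    have h2 : ψ.code < K :=
      ((Nat.right_le_pair _ _).trans (Nat.right_le_pair _ _)).trans_lt hK
    have h3 := hA1 t
    rw [Formula.Sat, ← hA t φ h1 n hn, ← hA t ψ h2 n hn] at h3
    simp only [Formula.code] at h3
    simp only [localStep, localValue, Formula.code, Nat.unpair_pair]
    simp
    rw [Bool.eq_iff_iff, h3]
    simp
  | and φ ψ =>
    have h1 : φ.code < K :=
      ((Nat.left_le_pair _ _).trans (Nat.right_le_pair _ _)).trans_lt hK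
    have h2 : ψ.code < K :=
      ((Nat.right_le_pair _ _).trans (Nat.right_le_pair _ _)).trans_lt hK
    have h3 := hA1 t
    rw [Formula.Sat, ← hA t φ h1 n hn, ← hA t ψ h2 n hn] at h3
    simp only [Formula.code] at h3
    simp only [localStep, localValue, Formula.code, Nat.unpair_pair]
    simp
    rw [Bool.eq_iff_iff, h3]
    simp
  | ex s i φ =>
    have h1 : φ.code < K :=
      ((Nat.right_le_pair _ _).trans (Nat.right_le_pair _ _)).trans_lt hK
    have hp : Nat.pair s i < K :=
      ((Nat.left_le_pair _ φ.code).trans (Nat.right_le_pair 6 _)).trans_lt hK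
    have h3 := hA1 t
    rw [Formula.Sat, exists_variant (P := fun ν => φ.Sat T ν t) (b := true) h hn hv hp
      fun n hn _ => (hA t φ h1 n hn).symm] at h3
    simp only [Formula.code] at h3
    simp only [localStep, localValue, Formula.code, Nat.unpair_pair]
    simp
    rw [Bool.eq_iff_iff, h3]
  | all s i φ =>
    have h1 : φ.code < K :=
      ((Nat.right_le_pair _ _).trans (Nat.right_le_pair _ _)).trans_lt hK
    have hp : Nat.pair s i < K :=
      ((Nat.left_le_pair _ φ.code).trans (Nat.right_le_pair 7 _)).trans_lt hK
    have h2 := exists_variant (P := fun ν => ¬ φ.Sat T ν t) (A := A t) (φ := φ.code) (b := false)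
      h hn hv hp fun n hn _ => by rw [← hA t φ h1 n hn, Bool.not_eq_true]
    have h3 := hA1 t
    have h4 : (∀ d, φ.Sat T ((decodeVal T dec B n).update s i d) t) ↔
        ¬ anyVariant B K sz (A t) n (Nat.pair s i) φ.code false = true := by
      rw [← h2]; push Not; rfl
    rw [Formula.Sat, h4, Bool.not_eq_true] at h3
    simp only [Formula.code] at h3
    simp only [localStep, localValue, Formula.code, Nat.unpair_pair]
    simp
    rw [Bool.eq_iff_iff, h3]
    simp
  | next φ =>
    have h1 : φ.code < K := (Nat.right_le_pair _ _).trans_lt hK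
    have h2 := hA1 t
    rw [Formula.Sat, ← hA (t + 1) φ h1 n hn] at h2
    simp only [Formula.code] at h2
    simp only [localStep, localValue, Formula.code, Nat.unpair_pair]
    simp
    rw [Bool.eq_iff_iff, h2]
  | untl φ ψ =>
    have h1 : φ.code < K :=
      ((Nat.left_le_pair _ _).trans (Nat.right_le_pair _ _)).trans_lt hK
    have h2 : ψ.code < K :=
      ((Nat.right_le_pair _ _).trans (Nat.right_le_pair _ _)).trans_lt hK
    have h3 := hA1 t
    rw [sat_untl_iff, ← hA t φ h1 n hn, ← hA t ψ h2 n hn, ← hA1 (t + 1)] at h3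
    simp only [Formula.code] at h3
    simp only [localStep, localValue, Formula.code, Nat.unpair_pair]
    simp
    rw [Bool.eq_iff_iff, h3]
    simp
  | release φ ψ =>
    have h1 : φ.code < K :=
      ((Nat.left_le_pair _ _).trans (Nat.right_le_pair _ _)).trans_lt hK
    have h2 : ψ.code < K :=
      ((Nat.right_le_pair _ _).trans (Nat.right_le_pair _ _)).trans_lt hK
    have h3 := hA1 t
    have h4 : (Formula.release φ ψ).Sat T (decodeVal T dec B n) t ↔
        ψ.Sat T (decodeVal T dec B n) t ∧ (φ.Sat T (decodeVal T dec B n) t ∨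
          (Formula.release φ ψ).Sat T (decodeVal T dec B n) (t + 1)) := by
      rw [sat_release_iff, sat_untl_iff, sat_release_iff, not_or, not_and_or]
      exact and_congr not_not (or_congr not_not Iff.rfl)
    rw [h4, ← hA t φ h1 n hn, ← hA t ψ h2 n hn, ← hA1 (t + 1)] at h3
    simp only [Formula.code] at h3
    simp only [localStep, localValue, Formula.code, Nat.unpair_pair]
    simp
    rw [Bool.eq_iff_iff, h3]
    simp

theorem exists_isNumbering {V : Vocab} {T : TemporalStructure.{u} V} {B K : ℕ}
    (hfin : ∀ s, Finite (T.U s)) (hcard : ∀ s, Nat.card (T.U s) ≤ B) :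
    ∃ sz < B ^ K, ∃ e dec, IsNumbering T e dec B K sz := by
  classical
  have hpos : ∀ s, 0 < Nat.card (T.U s) := fun s =>
    haveI := T.nonempty s; haveI := hfin s; Nat.card_pos
  let q := fun s => (haveI := hfin s; Finite.equivFin (T.U s))
  obtain ⟨sz, hsz, hdig⟩ := exists_dig_eq B K (fun s => Nat.card (T.U s) - 1)
    fun s _ => by have := hpos s; have := hcard s; omega
  refine ⟨sz, hsz, fun s x => (q s x).val,
    fun s d => (q s).symm (if h : d < Nat.card (T.U s) then ⟨d, h⟩ else ⟨0, hpos s⟩), ?_, ?_, ?_, ?_⟩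
  · intro s x; simp
  · intro s x; exact (q s x).isLt.trans_le (hcard s)
  · intro s hs x; rw [hdig s hs]; have := (q s x).isLt; omega
  · intro s hs d hd
    rw [hdig s hs] at hd
    have := hpos s
    have hd' : d < Nat.card (T.U s) := by omega
    simp [hd']

theorem exists_formula_of_closed {V : Vocab} {K Sub : ℕ}
    (hSub : ∀ ψ < K, Sub.testBit ψ = true ↔ ∃ φ : Formula, φ.WellSorted V ∧ φ.code = ψ) :
    subClosed K Sub = true := by
  simp only [subClosed, allBelow_iff]
  intro ψ hψ
  by_cases h : Sub.testBit ψ = true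
  · obtain ⟨φ, hφ, rfl⟩ := (hSub ψ hψ).1 h
    have key : ∀ χ : Formula, χ.WellSorted V → χ.code ≤ φ.code → Sub.testBit χ.code = true :=
      fun χ hχ hle => (hSub _ (hle.trans_lt hψ)).2 ⟨χ, hχ, rfl⟩
    cases φ with
    | tru | eq | rel => simp [Formula.code]
    | not χ | next χ =>
      have := key χ hφ (Nat.right_le_pair _ _)
      simp [Formula.code, this]
    | ex s i χ | all s i χ =>
      have := key χ hφ.2 ((Nat.right_le_pair _ _).trans (Nat.right_le_pair _ _))
      simp [Formula.code, this]
    | or χ₁ χ₂ | and χ₁ χ₂ | untl χ₁ χ₂ | release χ₁ χ₂ =>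
      have h1 := key χ₁ hφ.1 ((Nat.left_le_pair _ _).trans (Nat.right_le_pair _ _))
      have h2 := key χ₂ hφ.2 ((Nat.right_le_pair _ _).trans (Nat.right_le_pair _ _))
      simp [Formula.code, h1, h2]
  · simp [h]

theorem exists_not_pending {V : Vocab} {T : TemporalStructure.{u} V} {dec : ∀ s, ℕ → T.U s}
    {B K : ℕ} {A : ℕ → ℕ} (hA : ∀ t (φ : Formula), φ.code < K → ∀ n < B ^ K,
      (A t).testBit (Nat.pair φ.code n) = true ↔ φ.Sat T (decodeVal T dec B n) t)
    {φ : Formula} (hK : φ.code < K) {n : ℕ} (hn : n < B ^ K) (t : ℕ) :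
    ∃ s ≥ t, pending (Nat.pair φ.code n) (A s) = false := by
  have hA1 := fun t => hA t φ hK n hn
  cases φ with
  | untl φ ψ =>
    have h2 : ψ.code < K :=
      ((Nat.right_le_pair _ _).trans (Nat.right_le_pair _ _)).trans_lt hK
    have hA2 := fun t => hA t ψ h2 n hn
    by_cases h : (Formula.untl φ ψ).Sat T (decodeVal T dec B n) t
    · obtain ⟨j, hj, -⟩ := h
      refine ⟨t + j, by omega, ?_⟩
      simp [pending, Formula.code, (hA2 _).2 hj]
    · rw [← hA1] at h
      refine ⟨t, le_rfl, ?_⟩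
      simp only [Formula.code] at h
      simp [pending, Formula.code, h]
  | release φ ψ =>
    have h2 : ψ.code < K :=
      ((Nat.right_le_pair _ _).trans (Nat.right_le_pair _ _)).trans_lt hK
    have hA2 := fun t => hA t ψ h2 n hn
    by_cases h : (Formula.release φ ψ).Sat T (decodeVal T dec B n) t
    · rw [← hA1] at h
      refine ⟨t, le_rfl, ?_⟩
      simp only [Formula.code] at h
      simp [pending, Formula.code, h]
    · obtain ⟨j, hj, -⟩ := not_not.1 h
      refine ⟨t + j, by omega, ?_⟩
      rw [← hA2, Bool.not_eq_true] at hj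
      simp [pending, Formula.code, hj]
  | _ => exact ⟨t, le_rfl, by simp [pending, Formula.code]⟩

theorem boundedSat_of_structure {V : Vocab} {B K : ℕ} {ψ : Formula} {cs : List ℕ}
    (hV : ∀ c, V.constSort c = cs[c]?) (hψ : ψ.WellSorted V) (hψK : ψ.code < K)
    (hcsK : cs.length ≤ K) (hcs : ∀ s ∈ cs, s < K)
    {T : TemporalStructure.{u} V} (hfin : ∀ s, Finite (T.U s))
    (hcard : ∀ s, Nat.card (T.U s) ≤ B) (hsat : ∀ ν : Valuation T, ψ.Sat T ν 0) :
    boundedSat B K ψ.code cs = true := by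
  obtain ⟨sz, hsz, e, dec, h⟩ := exists_isNumbering (K := K) hfin hcard
  obtain ⟨cst, hcst, hcdig⟩ := exists_dig_eq B K (fun c => e _ (T.const c).2) fun c _ => h.e_lt _ _
  obtain ⟨Sub, hSub, hSubb⟩ := exists_testBit_iff K
    fun ψ => ∃ φ : Formula, φ.WellSorted V ∧ φ.code = ψ
  choose A hA hAb using fun t => exists_testBit_iff ((K + B ^ K) ^ 2)
    fun q => ∃ φ : Formula, φ.code = q.unpair.1 ∧ φ.Sat T (decodeVal T dec B q.unpair.2) t
  obtain ⟨G, hG, hGb⟩ := exists_testBit_iff (typeBound B K) fun a => ∃ t, A t = a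
  have hGA : ∀ t, G.testBit (A t) = true := fun t => (hGb _ (hA t)).2 ⟨t, rfl⟩
  have hAs : ∀ t (φ : Formula), φ.code < K → ∀ n < B ^ K,
      (A t).testBit (Nat.pair φ.code n) = true ↔ φ.Sat T (decodeVal T dec B n) t := by
    intro t φ hφ n hn
    rw [hAb t _ (pair_lt_sq hφ hn)]
    simp only [Nat.unpair_pair]
    constructor
    · rintro ⟨φ', h1, h2⟩
      rwa [← Formula.code_injective h1]
    · exact fun h => ⟨φ, rfl, h⟩
  have hstep : ∀ t, typeStep B K sz cst Sub (A t) (A (t + 1)) = true := by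
    intro t
    simp only [typeStep, allBelow_iff]
    intro ψ hψ n hn
    by_cases hc : (Sub.testBit ψ && validVal B K sz n) = true
    · have hc' := Bool.and_eq_true_iff.1 hc
      obtain ⟨φ, hφ, rfl⟩ := (hSubb ψ hψ).1 hc'.1
      rw [localStep_of_structure h hV (fun c hc => hcdig c (hc.trans_le hcsK)) hSubb hAs hφ hψ hn
        hc'.2 t]
      simp
    · rw [Bool.not_eq_true] at hc; rw [hc]; rfl
  have hdis : ∀ ψ, Sub.testBit ψ = true → ∀ n < B ^ K, ∀ t, ∃ s ≥ t,
      pending (Nat.pair ψ n) (A s) = false := by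
    intro ψ hψ n hn t
    obtain ⟨φ, -, rfl⟩ := (hSubb ψ (lt_of_testBit hSub hψ)).1 hψ
    exact exists_not_pending hAs (lt_of_testBit hSub hψ) hn t
  simp only [boundedSat, anyBelow_iff, allBelow_iff, Bool.and_eq_true, Bool.or_eq_true,
    Bool.not_eq_true', ← Bool.not_eq_true, initialType, fairFor]
  refine ⟨sz, hsz, cst, hcst, ?_, Sub, hSub,
    ⟨exists_formula_of_closed hSubb, (hSubb _ hψK).2 ⟨ψ, hψ, rfl⟩⟩, G, hG,
    ⟨⟨A 0, hA 0, hGA 0, fun n hn => Or.inr ((hAs 0 ψ hψK n hn).2 (hsat _))⟩, ?_⟩, ?_⟩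
  · simp only [constsOk, allBelow_iff, decide_eq_true_eq]
    intro c hc
    rw [hcdig c (hc.trans_le hcsK)]
    have h1 : (T.const c).1 = cs.getD c 0 :=
      T.const_sort c _ (by rw [hV, List.getD_eq_getElem _ _ hc]; simp [hc])
    have h2 := h.e_le (T.const c).1 (by
      rw [h1, List.getD_eq_getElem _ _ hc]; exact hcs _ (List.getElem_mem hc)) (T.const c).2
    exact h2.trans (le_of_eq (congrArg (dig B sz) h1))
  · intro a ha
    by_cases hg : G.testBit a = true
    · obtain ⟨t, rfl⟩ := (hGb a ha).1 hg
      exact Or.inr ⟨A (t + 1), hA _, hGA _, hstep t⟩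
    · exact Or.inl hg
  · intro φ _ m hm
    by_cases hφ : Sub.testBit φ = true
    swap
    · exact Or.inl hφ
    right
    intro Z _
    by_contra hcon
    rw [not_or, not_not] at hcon
    obtain ⟨h1, h2⟩ := hcon
    apply h2
    have key : ∀ n t, pending (Nat.pair φ m) (A (t + n)) = false → Z.testBit (A t) = true := by
      intro n
      induction n with
      | zero =>
        intro t ht
        have h3 := ((h1 _ (hA t)).resolve_left fun h => h (hGA t)).1
        simpa [show pending (Nat.pair φ m) (A t) = false from ht] using h3
      | succ n ih =>
        intro t ht
        have h3 := ih (t + 1) (by rwa [show t + 1 + n = t + (n + 1) by omega])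
        exact (((h1 _ (hA t)).resolve_left fun h => h (hGA t)).2 _ (hA (t + 1))).resolve_left
          fun h => h ⟨⟨hGA _, h3⟩, hstep t⟩
    intro a ha
    by_cases hg : G.testBit a = true
    · obtain ⟨t, rfl⟩ := (hGb a ha).1 hg
      obtain ⟨s, hs, hp⟩ := hdis φ hφ m hm t
      obtain ⟨n, rfl⟩ := Nat.exists_eq_add_of_le hs
      exact Or.inr (key n t hp)
    · exact Or.inl hg

/-! ### Restriction to smaller universes -/

section Restrict

variable {V : Vocab}

open Classical in
/-- The restriction of a temporal structure to subsets of its universes. -/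
noncomputable def restrict (T : TemporalStructure.{u} V) (H : ∀ s, Set (T.U s))
    (hne : ∀ s, (H s).Nonempty) : TemporalStructure.{u} V where
  U s := H s
  nonempty s := (hne s).to_subtype
  const c := ⟨(T.const c).1, if h : (T.const c).2 ∈ H (T.const c).1 then ⟨(T.const c).2, h⟩
    else ⟨(hne _).some, (hne _).some_mem⟩⟩
  const_sort c s h := T.const_sort c s h
  rel t R ds := T.rel t R (ds.map fun x => ⟨x.1, x.2.1⟩)
  rel_sort t R ds h := by
    rw [T.rel_sort t R _ h, List.map_map]; rfl

variable {T : TemporalStructure.{u} V} {H : ∀ s, Set (T.U s)} {hne : ∀ s, (H s).Nonempty}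

/-- A valuation of the restriction as a valuation of the structure. -/
def liftVal (ν : Valuation (restrict T H hne)) : Valuation T := fun s i => (ν s i).1

theorem liftVal_update (ν : Valuation (restrict T H hne)) (s i : ℕ)
    (d : (restrict T H hne).U s) :
    liftVal (ν.update s i d) = (liftVal ν).update s i d.1 := by
  funext s' i'
  by_cases he : (s', i') = (s, i)
  · obtain ⟨rfl, rfl⟩ := Prod.mk.inj he
    rw [liftVal, Valuation.update_self, Valuation.update_self]
  · rw [liftVal, Valuation.update_of_ne _ _ he, Valuation.update_of_ne _ _ he]; rfl

/-- Inclusion of the restriction. -/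
def sigmaVal (x : Σ s, (restrict T H hne).U s) : Σ s, T.U s := ⟨x.1, x.2.1⟩

theorem sigmaVal_injective : Function.Injective (sigmaVal (T := T) (H := H) (hne := hne)) := by
  rintro ⟨s, x⟩ ⟨s', y⟩ h
  simp only [sigmaVal, Sigma.mk.injEq] at h
  obtain ⟨rfl, h⟩ := h
  rw [Subtype.ext (eq_of_heq h)]

/-- The subsets contain all constants of the vocabulary. -/
def ContainsConsts (T : TemporalStructure.{u} V) (H : ∀ s, Set (T.U s)) : Prop :=
  ∀ c s, V.constSort c = some s → (T.const c).2 ∈ H (T.const c).1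

theorem sigmaVal_eval (hC : ContainsConsts T H) (ν : Valuation (restrict T H hne)) {t : Term}
    {s : ℕ} (ht : t.HasSort V s) :
    sigmaVal (t.eval (restrict T H hne) ν) = t.eval T (liftVal ν) := by
  cases t with
  | var s' i => rfl
  | const c =>
    have h := hC c s ht
    simp only [Term.eval, restrict, sigmaVal, dif_pos h]

theorem map_sigmaVal_eval (hC : ContainsConsts T H) (ν : Valuation (restrict T H hne))
    {ts : List Term} {l : List ℕ} (h : List.Forall₂ (fun t s => t.HasSort V s) ts l) :
    (ts.map (Term.eval (restrict T H hne) ν)).map sigmaVal = ts.map (Term.eval T (liftVal ν)) := by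
  induction h with
  | nil => rfl
  | cons ht _ ih => simp only [List.map_cons, sigmaVal_eval hC ν ht, ih]

theorem sat_restrict_iff (hC : ContainsConsts T H) {φ : Formula} (hq : φ.QuantifierFree)
    (hw : φ.WellSorted V) (ν : Valuation (restrict T H hne)) (t : ℕ) :
    φ.Sat (restrict T H hne) ν t ↔ φ.Sat T (liftVal ν) t := by
  induction φ generalizing t with
  | tru => exact Iff.rfl
  | eq a b =>
    obtain ⟨s, ha, hb⟩ := hw
    simp only [Formula.Sat]
    rw [← sigmaVal_eval hC ν ha, ← sigmaVal_eval hC ν hb, sigmaVal_injective.eq_iff]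
  | rel R ts =>
    obtain ⟨l, -, hl⟩ := hw
    simp only [Formula.Sat]
    rw [← map_sigmaVal_eval hC ν hl]
    rfl
  | not φ ih => exact not_congr (ih hq hw t)
  | or φ ψ ih₁ ih₂ => exact or_congr (ih₁ hq.1 hw.1 t) (ih₂ hq.2 hw.2 t)
  | and φ ψ ih₁ ih₂ => exact and_congr (ih₁ hq.1 hw.1 t) (ih₂ hq.2 hw.2 t)
  | ex s i φ => exact hq.elim
  | all s i φ => exact hq.elim
  | next φ ih => exact ih hq hw (t + 1)
  | untl φ ψ ih₁ ih₂ | release φ ψ ih₁ ih₂ =>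
    simp only [Formula.Sat, ih₁ hq.1 hw.1, ih₂ hq.2 hw.2]

theorem Formula.IsAtom.quantifierFree {φ : Formula} (h : φ.IsAtom) : φ.QuantifierFree := by
  cases φ <;> trivial

/-- Formulas in negation normal form without existential quantifiers are preserved under
restriction. -/
theorem sat_restrict_of_noEx (hC : ContainsConsts T H) {φ : Formula} (hn : φ.NNF) (he : φ.NoEx)
    (hw : φ.WellSorted V) (ν : Valuation (restrict T H hne)) (t : ℕ)
    (h : φ.Sat T (liftVal ν) t) : φ.Sat (restrict T H hne) ν t := by
  induction φ generalizing ν t with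
  | tru => trivial
  | eq a b => exact (sat_restrict_iff hC (φ := .eq a b) trivial hw ν t).2 h
  | rel R ts => exact (sat_restrict_iff hC (φ := .rel R ts) trivial hw ν t).2 h
  | not φ => exact (sat_restrict_iff hC (φ := .not φ) hn.quantifierFree hw ν t).2 h
  | or φ ψ ih₁ ih₂ => exact h.imp (ih₁ hn.1 he.1 hw.1 ν t) (ih₂ hn.2 he.2 hw.2 ν t)
  | and φ ψ ih₁ ih₂ => exact h.imp (ih₁ hn.1 he.1 hw.1 ν t) (ih₂ hn.2 he.2 hw.2 ν t)
  | ex s i φ => exact he.elim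
  | all s i φ ih =>
    intro d
    refine ih hn he hw.2 _ t ?_
    rw [liftVal_update]
    exact h d.1
  | next φ ih => exact ih hn he hw ν (t + 1) h
  | untl φ ψ ih₁ ih₂ =>
    obtain ⟨j, hj, hk⟩ := h
    exact ⟨j, ih₂ hn.2 he.2 hw.2 ν _ hj, fun k hkj => ih₁ hn.1 he.1 hw.1 ν _ (hk k hkj)⟩
  | release φ ψ ih₁ ih₂ =>
    rintro ⟨j, hj, hk⟩
    exact h ⟨j, fun h' => hj (ih₂ hn.2 he.2 hw.2 ν _ h'),
      fun k hkj h' => hk k hkj (ih₁ hn.1 he.1 hw.1 ν _ h')⟩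

end Restrict

/-! ### Free variables -/

theorem eval_congr {V : Vocab} {T : TemporalStructure.{u} V} {ν ν' : Valuation T} {t : Term}
    (h : ∀ x ∈ t.fv, ν x.1 x.2 = ν' x.1 x.2) : t.eval T ν = t.eval T ν' := by
  cases t with
  | var s i => simp [Term.eval, h (s, i) (by simp [Term.fv])]
  | const c => rfl

theorem fv_subset_termsFv {ts : List Term} {t : Term} (h : t ∈ ts) : t.fv ⊆ termsFv ts := by
  induction ts with
  | nil => simp at h
  | cons a ts ih =>
    intro x hx
    simp only [termsFv, List.foldr_cons, Finset.mem_union]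
    rcases List.mem_cons.1 h with rfl | h
    · exact Or.inl hx
    · exact Or.inr (ih h hx)

theorem update_congr {V : Vocab} {T : TemporalStructure.{u} V} {ν ν' : Valuation T} {s i : ℕ}
    {F : Finset (ℕ × ℕ)} (h : ∀ x ∈ F.erase (s, i), ν x.1 x.2 = ν' x.1 x.2) (d : T.U s) :
    ∀ x ∈ F, ν.update s i d x.1 x.2 = ν'.update s i d x.1 x.2 := by
  rintro ⟨s', i'⟩ hx
  by_cases he : (s', i') = (s, i)
  · obtain ⟨rfl, rfl⟩ := Prod.mk.inj he
    simp only [Valuation.update_self]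
  · simp only [Valuation.update_of_ne _ _ he]
    exact h (s', i') (Finset.mem_erase.2 ⟨he, hx⟩)

theorem sat_congr {V : Vocab} {T : TemporalStructure.{u} V} {φ : Formula} {ν ν' : Valuation T}
    (h : ∀ x ∈ φ.fv, ν x.1 x.2 = ν' x.1 x.2) (t : ℕ) : φ.Sat T ν t ↔ φ.Sat T ν' t := by
  induction φ generalizing ν ν' t with
  | tru => exact Iff.rfl
  | eq a b =>
    simp only [Formula.Sat, eval_congr fun x hx => h x (Finset.mem_union_left _ hx),
      eval_congr fun x hx => h x (Finset.mem_union_right _ hx)]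
  | rel R ts =>
    have : ts.map (Term.eval T ν) = ts.map (Term.eval T ν') :=
      List.map_congr_left fun a ha => eval_congr fun x hx => h x (fv_subset_termsFv ha hx)
    simp only [Formula.Sat, this]
  | not φ ih => exact not_congr (ih h t)
  | next φ ih => exact ih h (t + 1)
  | ex s i φ ih => exact exists_congr fun d => ih (update_congr h d) t
  | all s i φ ih => exact forall_congr' fun d => ih (update_congr h d) t
  | or φ ψ ih₁ ih₂ | and φ ψ ih₁ ih₂ | untl φ ψ ih₁ ih₂ | release φ ψ ih₁ ih₂ =>
    simp only [Formula.Sat, ih₁ fun x hx => h x (Finset.mem_union_left _ hx),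
      ih₂ fun x hx => h x (Finset.mem_union_right _ hx)]

theorem Formula.Closed.sat_iff {V : Vocab} {T : TemporalStructure.{u} V} {φ : Formula}
    (h : φ.Closed) (ν ν' : Valuation T) (t : ℕ) : φ.Sat T ν t ↔ φ.Sat T ν' t :=
  sat_congr (fun x hx => by rw [show φ.fv = ∅ from h] at hx; simp at hx) t

/-! ### Small universes suffice -/

/-- Growth of the universes at a quantifier. -/
def grow (b : ℕ) : ℕ := b + b * b

theorem noEx_of_proj {V : Vocab} {φ : Formula} (hw : φ.WellSorted V)
    (h : ∀ s < V.numSorts, (φ.proj V s).NoEx) : φ.NoEx := by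
  induction φ with
  | tru => trivial
  | eq => trivial
  | rel => trivial
  | not φ ih => exact ih hw h
  | next φ ih => exact ih hw h
  | ex s i φ => have := h s hw.1; simp [Formula.proj, Formula.NoEx] at this
  | all s i φ ih =>
    refine ih hw.2 fun s' hs' => ?_
    have := h s' hs'
    simp only [Formula.proj] at this
    split at this <;> exact this
  | or φ ψ ih₁ ih₂ | and φ ψ ih₁ ih₂ | untl φ ψ ih₁ ih₂ | release φ ψ ih₁ ih₂ =>
    exact ⟨ih₁ hw.1 fun s hs => (h s hs).1, ih₂ hw.2 fun s hs => (h s hs).2⟩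

theorem grow_iterate_le {a c b : ℕ} (h : a < c) : grow^[a] (grow b) ≤ grow^[c] b := by
  rw [← Function.iterate_succ_apply]
  exact Function.monotone_iterate_of_id_le (fun b => Nat.le_add_right b (b * b)) h b

theorem Formula.ExPrefix.of_ex {s i : ℕ} {φ : Formula} (h : ExPrefix (.ex s i φ)) :
    ExPrefix φ := by
  cases h with
  | base h => exact h.elim
  | ex _ _ h => exact h

theorem Formula.ExPrefix.noEx_of_all {s i : ℕ} {φ : Formula} (h : ExPrefix (.all s i φ)) :
    φ.NoEx := by
  cases h with
  | base h => exact h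

/-- There is a finite restriction of `T` extending `H₀`, and equal to it on the sorts over which `φ`
does not quantify existentially, in which `φ` holds under the valuations in `Ns`. -/
def HasSmallRestriction {V : Vocab} (T : TemporalStructure.{u} V) (φ : Formula)
    (H₀ : ∀ s, Finset (T.U s)) (Ns : Finset (Valuation T)) (b : ℕ) : Prop :=
  ∃ H : ∀ s, Finset (T.U s), (∀ s, H₀ s ⊆ H s) ∧
    (∀ s < V.numSorts, (φ.proj V s).NoEx → H s = H₀ s) ∧
    (∀ s, (H s).card ≤ grow^[φ.code] b) ∧
    ∀ hne, ∀ ν : Valuation (restrict T (fun s => (H s : Set (T.U s))) hne),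
      liftVal ν ∈ Ns → φ.Sat _ ν 0

theorem hasSmallRestriction_of_noEx {V : Vocab} {T : TemporalStructure.{u} V} {φ : Formula}
    (hn : φ.NNF) (hw : φ.WellSorted V) (he : φ.NoEx) {H₀ : ∀ s, Finset (T.U s)}
    (hC : ContainsConsts T fun s => (H₀ s : Set (T.U s))) {Ns : Finset (Valuation T)} {b : ℕ}
    (hHb : ∀ s, (H₀ s).card ≤ b) (hsat : ∀ ν ∈ Ns, φ.Sat T ν 0) :
    HasSmallRestriction T φ H₀ Ns b :=
  ⟨H₀, fun _ => Finset.Subset.refl _, fun _ _ _ => rfl, fun s => (hHb s).trans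
    (Function.id_le_iterate_of_id_le (fun b => Nat.le_add_right b (b * b)) _ b),
    fun _ ν hν => sat_restrict_of_noEx hC hn he hw ν 0 (hsat _ hν)⟩

open Classical in
/-- A formula whose projections are existentially prefixed and that holds under finitely many
valuations also holds under them in a finite restriction of the structure. -/
theorem exists_finite_restriction {V : Vocab} (T : TemporalStructure.{u} V) (φ : Formula)
    (hn : φ.NNF) (hw : φ.WellSorted V) (hp : ∀ s < V.numSorts, (φ.proj V s).ExPrefix)
    (H₀ : ∀ s, Finset (T.U s)) (hC : ContainsConsts T fun s => (H₀ s : Set (T.U s)))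
    (Ns : Finset (Valuation T)) (hNs : ∀ ν ∈ Ns, ∀ s i, ν s i ∈ H₀ s) (b : ℕ)
    (hNb : Ns.card ≤ b) (hHb : ∀ s, (H₀ s).card ≤ b) (hsat : ∀ ν ∈ Ns, φ.Sat T ν 0) :
    HasSmallRestriction T φ H₀ Ns b := by
  induction φ generalizing H₀ Ns b with
  | ex s i φ ih =>
    have hex : ∀ ν : Valuation T, ∃ d, ν ∈ Ns → φ.Sat T (ν.update s i d) 0 := by
      intro ν
      by_cases hν : ν ∈ Ns
      · obtain ⟨d, hd⟩ := hsat ν hν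
        exact ⟨d, fun _ => hd⟩
      · exact ⟨(T.nonempty s).some, fun h => absurd h hν⟩
    choose wit hwit using hex
    let H₁ : ∀ s, Finset (T.U s) := fun s' =>
      H₀ s' ∪ Ns.image fun ν => ν.update s i (wit ν) s' i
    have hH₁ : ∀ s', s' ≠ s → H₁ s' = H₀ s' := by
      intro s' hs'
      refine Finset.union_eq_left.2 fun x hx => ?_
      obtain ⟨ν, hν, rfl⟩ := Finset.mem_image.1 hx
      rw [Valuation.update_of_ne _ _ (fun h => hs' (Prod.mk.inj h).1)]
      exact hNs ν hν s' i
    have hsub : ∀ s', H₀ s' ⊆ H₁ s' := fun s' => Finset.subset_union_left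
    have hw₁ : ∀ ν ∈ Ns, wit ν ∈ H₁ s := fun ν hν =>
      Finset.mem_union_right _ (Finset.mem_image.2 ⟨ν, hν, Valuation.update_self _ _ _ _⟩)
    have hp' : ∀ s' < V.numSorts, (φ.proj V s').ExPrefix := by
      intro s' hs'
      have := hp s' hs'
      simp only [Formula.proj] at this
      split at this
      · exact this.of_ex
      · exact this
    have hbb : b + b ≤ grow b := Nat.add_le_add_left (Nat.le_mul_self b) b
    obtain ⟨H, h1, h2, h3, h4⟩ := ih hn hw.2 hp' H₁ (fun c s h => hsub _ (hC c s h))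
      (Ns.image fun ν => ν.update s i (wit ν))
      (by
        intro ν hν s' i'
        obtain ⟨μ, hμ, rfl⟩ := Finset.mem_image.1 hν
        by_cases he : (s', i') = (s, i)
        · obtain ⟨rfl, rfl⟩ := Prod.mk.inj he
          rw [Valuation.update_self]; exact hw₁ μ hμ
        · rw [Valuation.update_of_ne _ _ he]; exact hsub _ (hNs μ hμ _ _))
      (grow b) (Finset.card_image_le.trans (hNb.trans (Nat.le_add_right _ _)))
      (fun s' => (Finset.card_union_le _ _).trans
        ((Nat.add_le_add (hHb s') (Finset.card_image_le.trans hNb)).trans hbb))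
      (by
        intro ν hν
        obtain ⟨μ, hμ, rfl⟩ := Finset.mem_image.1 hν
        exact hwit μ hμ)
    refine ⟨H, fun s' => (hsub s').trans (h1 s'), ?_, fun s' => (h3 s').trans (grow_iterate_le ?_), ?_⟩
    · intro s' hs' he
      simp only [Formula.proj] at he
      split at he
      · exact he.elim
      · next hne => rw [h2 s' hs' he, hH₁ s' fun h => hne h.symm]
    · exact (Nat.lt_of_le_of_lt (Nat.right_le_pair (Nat.pair s i) _)
        (Nat.lt_of_lt_of_le (Nat.lt_add_of_pos_left (by norm_num)) (Nat.add_le_pair 6 _)))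
    · intro hne ν hν
      let d : (restrict T (fun s => (H s : Set (T.U s))) hne).U s :=
        ⟨wit (liftVal ν), h1 s (hw₁ _ hν)⟩
      refine ⟨d, h4 hne _ ?_⟩
      rw [liftVal_update]
      exact Finset.mem_image.2 ⟨_, hν, rfl⟩
  | all s i φ ih =>
    have hclosed : (φ.proj V s).NoEx := by
      have := hp s hw.1
      rw [Formula.proj, if_pos rfl] at this
      exact this.noEx_of_all
    have hp' : ∀ s' < V.numSorts, (φ.proj V s').ExPrefix := by
      intro s' hs'
      have := hp s' hs'
      simp only [Formula.proj] at this
      split at this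
      · exact .base this.noEx_of_all
      · exact this
    obtain ⟨H, h1, h2, h3, h4⟩ := ih hn hw.2 hp' H₀ hC
      ((Ns ×ˢ H₀ s).image fun p => p.1.update s i p.2)
      (by
        intro ν hν s' i'
        obtain ⟨⟨μ, d⟩, hμ, rfl⟩ := Finset.mem_image.1 hν
        obtain ⟨hμ, hd⟩ := Finset.mem_product.1 hμ
        by_cases he : (s', i') = (s, i)
        · obtain ⟨rfl, rfl⟩ := Prod.mk.inj he
          rw [Valuation.update_self]; exact hd
        · rw [Valuation.update_of_ne _ _ he]; exact hNs μ hμ _ _)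
      (grow b)
      (by
        refine Finset.card_image_le.trans ?_
        rw [Finset.card_product]
        exact (Nat.mul_le_mul hNb (hHb s)).trans (Nat.le_add_left _ _))
      (fun s' => (hHb s').trans (Nat.le_add_right _ _))
      (by
        intro ν hν
        obtain ⟨⟨μ, d⟩, hμ, rfl⟩ := Finset.mem_image.1 hν
        exact hsat μ (Finset.mem_product.1 hμ).1 d)
    refine ⟨H, h1, fun s' hs' he => h2 s' hs' ?_, fun s' => (h3 s').trans (grow_iterate_le ?_), ?_⟩
    · simp only [Formula.proj] at he
      split at he <;> exact he
    · exact (Nat.lt_of_le_of_lt (Nat.right_le_pair (Nat.pair s i) _)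
        (Nat.lt_of_lt_of_le (Nat.lt_add_of_pos_left (by norm_num)) (Nat.add_le_pair 7 _)))
    · intro hne ν hν d
      refine h4 hne _ ?_
      rw [liftVal_update]
      refine Finset.mem_image.2 ⟨(liftVal ν, d.1), Finset.mem_product.2 ⟨hν, ?_⟩, rfl⟩
      rw [← h2 s hw.1 hclosed]
      exact d.2
  | tru | eq | rel => exact hasSmallRestriction_of_noEx hn hw trivial hC hHb hsat
  | not | or | and | next | untl | release =>
    refine hasSmallRestriction_of_noEx hn hw (noEx_of_proj hw fun _ hs => ?_) hC hHb hsat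
    cases hp _ hs with
    | base h => exact h

/-- A closed formula whose projections are existentially prefixed and that holds in `T` also holds
in a restriction of `T` with universes of bounded size. -/
theorem exists_small_restriction {V : Vocab} {cs : List ℕ} (hV : ∀ c, V.constSort c = cs[c]?)
    (T : TemporalStructure.{u} V) {φ : Formula} (hφ : φ.BSFOLTL V) {ν : Valuation T}
    (hsat : φ.Sat T ν 0) :
    ∃ (H : ∀ s, Set (T.U s)) (hne : ∀ s, (H s).Nonempty), ContainsConsts T H ∧
      (∀ s, Finite (H s)) ∧ (∀ s, Nat.card (H s) ≤ grow^[φ.code] (cs.length + 1)) ∧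
      ∀ ν : Valuation (restrict T H hne), φ.Sat _ ν 0 := by
  classical
  let δ : ∀ s, T.U s := fun s => (T.nonempty s).some
  let H₀ : ∀ s, Finset (T.U s) := fun s => insert (δ s) ((Finset.range cs.length).image
    fun c => if h : (T.const c).1 = s then h ▸ (T.const c).2 else δ s)
  have hδ : ∀ s, δ s ∈ H₀ s := fun s => Finset.mem_insert_self _ _
  have hC : ContainsConsts T fun s => (H₀ s : Set (T.U s)) := by
    intro c s hc
    obtain ⟨hc', -⟩ := List.getElem?_eq_some_iff.1 ((hV c).symm.trans hc)
    refine Finset.mem_coe.2 (Finset.mem_insert_of_mem (Finset.mem_image.2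
      ⟨c, Finset.mem_range.2 hc', ?_⟩))
    simp
  obtain ⟨H, h1, -, h3, h4⟩ := exists_finite_restriction T φ hφ.nnf hφ.wellSorted hφ.proj H₀ hC
    {fun s _ => δ s}
    (by
      intro ν hν s i
      rw [Finset.mem_singleton.1 hν]
      exact hδ s)
    (cs.length + 1) (by simp)
    (fun s => (Finset.card_insert_le _ _).trans (Nat.add_le_add_right
      (Finset.card_image_le.trans (Finset.card_range _).le) 1))
    (by
      intro ν' hν'
      exact (hφ.closed.sat_iff _ _ _).1 hsat)
  refine ⟨fun s => (H s : Set (T.U s)), fun s => ⟨δ s, h1 s (hδ s)⟩,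
    fun c s hc => h1 _ (hC c s hc), fun s => Finset.finite_toSet (H s) |>.to_subtype, fun s => ?_,
    fun ν => ?_⟩
  · simpa using h3 s
  · let ν₀ : Valuation (restrict T (fun s => (H s : Set (T.U s))) fun s => ⟨δ s, h1 s (hδ s)⟩) :=
      fun s _ => ⟨δ s, h1 s (hδ s)⟩
    refine (hφ.closed.sat_iff ν₀ _ _).1 (h4 _ _ ?_)
    exact Finset.mem_singleton.2 rfl

open Formula

/-! ### Derived connectives -/

namespace Formula

variable {V : Vocab} {T : TemporalStructure.{u} V} {ν : Valuation T} {t : ℕ}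

theorem sat_bigAnd {l : List Formula} : (bigAnd l).Sat T ν t ↔ ∀ φ ∈ l, φ.Sat T ν t := by
  induction l with
  | nil => simp [bigAnd, Sat]
  | cons φ l ih =>
    rw [List.forall_mem_cons, ← ih]
    rfl

theorem sat_globally {φ : Formula} : φ.globally.Sat T ν t ↔ ∀ j, φ.Sat T ν (t + j) := by
  simp [globally, eventually, Sat]

theorem sat_imp {φ ψ : Formula} : (imp φ ψ).Sat T ν t ↔ (φ.Sat T ν t → ψ.Sat T ν t) :=
  imp_iff_not_or.symm

theorem sat_iff {φ ψ : Formula} :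
    (Formula.iff φ ψ).Sat T ν t ↔ (φ.Sat T ν t ↔ ψ.Sat T ν t) :=
  (and_congr sat_imp sat_imp).trans iff_def.symm

theorem sat_exN {xs : List (ℕ × ℕ)} {φ : Formula} : (exN xs φ).Sat T ν t ↔
    ∃ μ : Valuation T, (∀ s i, (s, i) ∉ xs → μ s i = ν s i) ∧ φ.Sat T μ t := by
  induction xs generalizing ν with
  | nil =>
    refine ⟨fun h => ⟨ν, fun _ _ _ => rfl, h⟩, ?_⟩
    rintro ⟨μ, h1, h2⟩
    obtain rfl : μ = ν := funext fun s => funext fun i => h1 s i (by simp)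
    exact h2
  | cons x xs ih =>
    change (∃ d, (exN xs φ).Sat T (ν.update x.1 x.2 d) t) ↔ _
    simp only [ih]
    constructor
    · rintro ⟨d, μ, h1, h2⟩
      refine ⟨μ, fun s i hsi => ?_, h2⟩
      rw [List.mem_cons, not_or] at hsi
      rw [h1 s i hsi.2, Valuation.update_of_ne _ _ hsi.1]
    · rintro ⟨μ, h1, h2⟩
      refine ⟨μ x.1 x.2, μ, fun s i hsi => ?_, h2⟩
      by_cases he : (s, i) = x
      · subst he; rw [Valuation.update_self]
      · rw [Valuation.update_of_ne _ _ he]; exact h1 s i (by simp [he, hsi])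

theorem sat_allN {xs : List (ℕ × ℕ)} {φ : Formula} : (allN xs φ).Sat T ν t ↔
    ∀ μ : Valuation T, (∀ s i, (s, i) ∉ xs → μ s i = ν s i) → φ.Sat T μ t := by
  induction xs generalizing ν with
  | nil =>
    refine ⟨fun h μ h1 => ?_, fun h => h ν fun _ _ _ => rfl⟩
    obtain rfl : μ = ν := funext fun s => funext fun i => h1 s i (by simp)
    exact h
  | cons x xs ih =>
    change (∀ d, (allN xs φ).Sat T (ν.update x.1 x.2 d) t) ↔ _
    simp only [ih]
    constructor
    · intro h μ h1
      refine h (μ x.1 x.2) μ fun s i hsi => ?_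
      by_cases he : (s, i) = x
      · subst he; rw [Valuation.update_self]
      · rw [Valuation.update_of_ne _ _ he]; exact h1 s i (by simp [he, hsi])
    · intro h d μ h1
      refine h μ fun s i hsi => ?_
      rw [List.mem_cons, not_or] at hsi
      rw [h1 s i hsi.2, Valuation.update_of_ne _ _ hsi.1]

theorem wellSorted_bigAnd {l : List Formula} (h : ∀ φ ∈ l, φ.WellSorted V) :
    (bigAnd l).WellSorted V := by
  induction l with
  | nil => trivial
  | cons φ l ih =>
    exact ⟨h φ List.mem_cons_self, ih fun φ hφ => h φ (List.mem_cons_of_mem _ hφ)⟩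

theorem wellSorted_bigOr {l : List Formula} (h : ∀ φ ∈ l, φ.WellSorted V) :
    (bigOr l).WellSorted V := by
  induction l with
  | nil => trivial
  | cons φ l ih =>
    exact ⟨h φ List.mem_cons_self, ih fun φ hφ => h φ (List.mem_cons_of_mem _ hφ)⟩

theorem wellSorted_exN {xs : List (ℕ × ℕ)} {φ : Formula} (hx : ∀ x ∈ xs, x.1 < V.numSorts)
    (h : φ.WellSorted V) : (exN xs φ).WellSorted V := by
  induction xs with
  | nil => exact h
  | cons x xs ih =>
    exact ⟨hx x List.mem_cons_self, ih fun y hy => hx y (List.mem_cons_of_mem _ hy)⟩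

theorem wellSorted_allN {xs : List (ℕ × ℕ)} {φ : Formula} (hx : ∀ x ∈ xs, x.1 < V.numSorts)
    (h : φ.WellSorted V) : (allN xs φ).WellSorted V := by
  induction xs with
  | nil => exact h
  | cons x xs ih =>
    exact ⟨hx x List.mem_cons_self, ih fun y hy => hx y (List.mem_cons_of_mem _ hy)⟩

theorem quantifierFree_bigAnd {l : List Formula} (h : ∀ φ ∈ l, φ.QuantifierFree) :
    (bigAnd l).QuantifierFree := by
  induction l with
  | nil => trivial
  | cons φ l ih =>
    exact ⟨h φ List.mem_cons_self, ih fun φ hφ => h φ (List.mem_cons_of_mem _ hφ)⟩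

theorem quantifierFree_bigOr {l : List Formula} (h : ∀ φ ∈ l, φ.QuantifierFree) :
    (bigOr l).QuantifierFree := by
  induction l with
  | nil => trivial
  | cons φ l ih =>
    exact ⟨h φ List.mem_cons_self, ih fun φ hφ => h φ (List.mem_cons_of_mem _ hφ)⟩

end Formula

/-! ### The control flow graph -/

theorem edgesFrom_block (w : Workflow) : ∀ n e m i, ∀ ed ∈ w.edgesFrom n e m i,
    ed.block = idBlock ∨ (i ≤ ed.idx ∧ w.blocks[ed.idx - i]? = some ed.block) := by
  induction w with
  | block b =>
    intro n e m i ed hed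
    simp only [Workflow.edgesFrom, List.mem_singleton] at hed
    subst hed
    exact Or.inr ⟨le_rfl, by simp [Workflow.blocks]⟩
  | seq b w ih =>
    intro n e m i ed hed
    rcases List.mem_cons.1 hed with rfl | hed
    · exact Or.inr ⟨le_rfl, by simp [Workflow.blocks]⟩
    · refine (ih _ _ _ _ ed hed).imp_right fun ⟨h1, h2⟩ => ⟨by omega, ?_⟩
      rw [Workflow.blocks, show ed.idx - i = ed.idx - (i + 1) + 1 by omega,
        List.getElem?_cons_succ, h2]
  | loop w ih =>
    intro n e m i ed hed
    rcases List.mem_cons.1 hed with rfl | hed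
    · exact Or.inl rfl
    · split at hed
      · rcases List.mem_cons.1 hed with rfl | hed
        · exact Or.inl rfl
        · exact ih _ _ _ _ ed hed
      · exact ih _ _ _ _ ed hed
  | choose w w' ih ih' =>
    intro n e m i ed hed
    rcases List.mem_cons.1 hed with rfl | hed
    · exact Or.inl rfl
    rcases List.mem_cons.1 hed with rfl | hed
    · exact Or.inl rfl
    rcases List.mem_append.1 hed with hed | hed
    · refine (ih _ _ _ _ ed hed).imp_right fun ⟨h1, h2⟩ => ⟨h1, ?_⟩
      obtain ⟨h3, h4⟩ := List.getElem?_eq_some_iff.1 h2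
      rw [Workflow.blocks, List.getElem?_append_left h3, h2]
    · refine (ih' _ _ _ _ ed hed).imp_right fun ⟨h1, h2⟩ => ⟨by omega, ?_⟩
      rw [Workflow.blocks, List.getElem?_append_right (by omega), ← h2]
      congr 1; omega

theorem edgesFrom_lt (w : Workflow) (N : ℕ) : ∀ n e m i, n < N → e < N → m + w.numInner ≤ N →
    ∀ ed ∈ w.edgesFrom n e m i, ed.src < N ∧ ed.dst < N := by
  induction w with
  | block b =>
    intro n e m i hn he hm ed hed
    simp only [Workflow.edgesFrom, List.mem_singleton] at hed
    subst hed
    exact ⟨hn, he⟩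
  | seq b w ih =>
    intro n e m i hn he hm ed hed
    rw [Workflow.numInner] at hm
    rcases List.mem_cons.1 hed with rfl | hed
    · exact ⟨hn, show m < N by omega⟩
    · exact ih _ _ _ _ (by omega) he (by omega) ed hed
  | loop w ih =>
    intro n e m i hn he hm ed hed
    rw [Workflow.numInner] at hm
    rcases List.mem_cons.1 hed with rfl | hed
    · exact ⟨hn, he⟩
    · split at hed
      · next hl =>
        rw [if_pos hl] at hm
        rcases List.mem_cons.1 hed with rfl | hed
        · exact ⟨hn, show m < N by omega⟩
        · exact ih _ _ _ _ (by omega) hn (by omega) ed hed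
      · exact ih _ _ _ _ hn hn (by omega) ed hed
  | choose w w' ih ih' =>
    intro n e m i hn he hm ed hed
    rw [Workflow.numInner] at hm
    rcases List.mem_cons.1 hed with rfl | hed
    · exact ⟨hn, show m < N by omega⟩
    rcases List.mem_cons.1 hed with rfl | hed
    · exact ⟨hn, show m + 1 < N by omega⟩
    rcases List.mem_append.1 hed with hed | hed
    · exact ih _ _ _ _ (by omega) he (by omega) ed hed
    · exact ih' _ _ _ _ (by omega) he (by omega) ed hed

theorem block_of_mem_edges {w : Workflow} {e : Edge} (he : e ∈ w.edges) :
    e.block = idBlock ∨ w.blocks[e.idx]? = some e.block := by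
  rcases List.mem_cons.1 he with rfl | he
  · exact Or.inl rfl
  · exact (edgesFrom_block w _ _ _ _ e he).imp_right fun h => h.2

theorem nodes_of_mem_edges {w : Workflow} {e : Edge} (he : e ∈ w.edges) :
    e.src ∈ w.nodes ∧ e.dst ∈ w.nodes := by
  simp only [Workflow.nodes, List.mem_range]
  rcases List.mem_cons.1 he with rfl | he
  · exact ⟨by simp [Workflow.endNode]; omega, by simp [Workflow.endNode]; omega⟩
  · exact edgesFrom_lt w _ _ _ _ _ (by simp [Workflow.entryNode])
      (by simp [Workflow.endNode]; omega) le_rfl e he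

/-! ### The specification of a workflow is well-sorted -/

theorem Term.HasSort.vocab {σ : Signature} {w : Workflow} {t : Term} {s : ℕ}
    (h : t.HasSort σ.vocab s) : t.HasSort (w.vocab σ) s := by
  cases t <;> exact h

theorem forall₂_hasSort_vocab {σ : Signature} {w : Workflow} {ts : List Term} {l : List ℕ}
    (h : List.Forall₂ (fun t s => t.HasSort σ.vocab s) ts l) :
    List.Forall₂ (fun t s => t.HasSort (w.vocab σ) s) ts l :=
  h.imp fun _ _ h => h.vocab

theorem Formula.WellSorted.vocab {σ : Signature} {w : Workflow} {φ : Formula}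
    (h : φ.WellSorted σ.vocab) : φ.WellSorted (w.vocab σ) := by
  induction φ with
  | tru => trivial
  | eq a b => obtain ⟨s, h1, h2⟩ := h; exact ⟨s, h1.vocab, h2.vocab⟩
  | rel R ts =>
    obtain ⟨l, hR, hl⟩ := h
    refine ⟨l, ?_, forall₂_hasSort_vocab hl⟩
    cases R with
    | wf k => exact hR
    | high k => exact hR
    | node k => simp [Signature.vocab] at hR
    | aux k => simp [Signature.vocab] at hR
  | not φ ih => exact ih h
  | next φ ih => exact ih h
  | ex s i φ ih => exact ⟨h.1, ih h.2⟩
  | all s i φ ih => exact ⟨h.1, ih h.2⟩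
  | or φ ψ ih₁ ih₂ | and φ ψ ih₁ ih₂ | untl φ ψ ih₁ ih₂ | release φ ψ ih₁ ih₂ =>
    exact ⟨ih₁ h.1, ih₂ h.2⟩

theorem hasSort_ofVar {V : Vocab} {xs : List (ℕ × ℕ)} (h : ∀ x ∈ xs, x.1 < V.numSorts) :
    List.Forall₂ (fun t s => t.HasSort V s) (xs.map Term.ofVar) (xs.map Prod.fst) := by
  induction xs with
  | nil => exact .nil
  | cons x xs ih =>
    exact .cons ⟨rfl, h x List.mem_cons_self⟩ (ih fun y hy => h y (List.mem_cons_of_mem _ hy))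

theorem tuple_map_fst (b : Block) (l : List ℕ) : (b.tuple l).map Prod.fst = l := by
  rw [Block.tuple, List.map_map]
  exact List.zipIdx_map_fst 0 l

theorem tuple_fst_lt {b : Block} {l : List ℕ} {N : ℕ} (h : ∀ s ∈ l, s < N) :
    ∀ y ∈ b.tuple l, y.1 < N := fun y hy =>
  h _ (by have := List.mem_map_of_mem (f := Prod.fst) hy; rwa [tuple_map_fst] at this)

theorem tuple_length (b : Block) (l : List ℕ) : (b.tuple l).length = l.length := by
  simp [Block.tuple]

theorem le_foldr_max {l : List ℕ} {a : ℕ} (h : a ∈ l) : a ≤ l.foldr max 0 := by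
  induction l with
  | nil => simp at h
  | cons b l ih =>
    rcases List.mem_cons.1 h with rfl | h
    · exact le_max_left _ _
    · exact (ih h).trans (le_max_right _ _)

theorem tuple_not_mem_vars {b : Block} {l : List ℕ} {y : ℕ × ℕ} (hy : y ∈ b.tuple l) :
    y ∉ b.vars := by
  intro hv
  obtain ⟨p, -, rfl⟩ := List.mem_map.1 hy
  have := le_foldr_max (List.mem_map_of_mem (f := Prod.snd) hv)
  dsimp only at this
  omega

theorem wellSorted_atNode {σ : Signature} {w : Workflow} {n : ℕ} (h : n ∈ w.nodes) :
    (atNode n).WellSorted (w.vocab σ) :=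
  ⟨[], if_pos h, .nil⟩

theorem wellSorted_wfRel {σ : Signature} (hσ : σ.WellFormed) {w : Workflow} {l : List ℕ} {k : ℕ}
    (h : (l, k) ∈ σ.wfRels.zipIdx) (b : Block) :
    (Formula.rel (.wf k) ((b.tuple l).map Term.ofVar)).WellSorted (w.vocab σ) := by
  have h1 : σ.wfRels[k]? = some l := by simpa using (List.mk_mem_zipIdx_iff_getElem?.1 h)
  have := hasSort_ofVar (V := w.vocab σ)
    (tuple_fst_lt (b := b) (hσ.2.2.1 l (List.mem_of_getElem? h1)))
  rw [tuple_map_fst] at this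
  exact ⟨l, h1, this⟩

/-- The matrix of `Block.selects`. -/
def Block.selectsBody (b : Block) (i : ℕ) (st : Stmt) (ys : List (ℕ × ℕ)) : Formula :=
  .and st.guard
    (.and (if b.may then .rel (.aux i) (b.vars.map Term.ofVar) else .tru)
      (bigAnd (List.zipWith (fun y t => .eq (Term.ofVar y) t) ys st.args)))

theorem wellSorted_zipWith_eq {V : Vocab} {ys : List (ℕ × ℕ)} {ts : List Term} {l : List ℕ}
    (h : List.Forall₂ (fun t s => t.HasSort V s) ts l) (hys : ys.map Prod.fst = l)
    (hlt : ∀ y ∈ ys, y.1 < V.numSorts) :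
    ∀ φ ∈ List.zipWith (fun y t => Formula.eq (Term.ofVar y) t) ys ts, φ.WellSorted V := by
  induction h generalizing ys with
  | nil => simp
  | cons ht _ ih =>
    cases ys with
    | nil => simp
    | cons y ys =>
      simp only [List.map_cons, List.cons.injEq] at hys
      obtain ⟨rfl, hys⟩ := hys
      intro φ hφ
      rcases List.mem_cons.1 hφ with rfl | hφ
      · exact ⟨y.1, ⟨rfl, hlt y List.mem_cons_self⟩, ht⟩
      · exact ih hys (fun y hy => hlt y (List.mem_cons_of_mem _ hy)) φ hφ

theorem wellSorted_selectsBody {σ : Signature} (hσ : σ.WellFormed) {w : Workflow} {b : Block}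
    {i : ℕ} (hb : b.WellFormed σ) (hi : w.blocks[i]? = some b) {st : Stmt} (hst : st ∈ b.stmts)
    {l : List ℕ} (hl : σ.wfRels[st.rel]? = some l) :
    (b.selectsBody i st (b.tuple l)).WellSorted (w.vocab σ) := by
  have h := hb.stmts_wf st hst
  refine ⟨h.wellSorted.vocab, ?_, wellSorted_bigAnd ?_⟩
  · split
    · next hm =>
      exact ⟨b.vars.map Prod.fst, by simp [Workflow.vocab, hi, hm], hasSort_ofVar hb.vars_sort⟩
    · trivial
  · obtain ⟨l', hl', hargs⟩ := h.args_sort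
    obtain rfl : l = l' := Option.some_inj.1 (hl.symm.trans hl')
    exact wellSorted_zipWith_eq (forall₂_hasSort_vocab hargs) (tuple_map_fst b l)
      (tuple_fst_lt (hσ.2.2.1 l (List.mem_of_getElem? hl)))

theorem wellSorted_post {σ : Signature} (hσ : σ.WellFormed) {w : Workflow} {b : Block}
    {i : ℕ} (hb : b = idBlock ∨ (b.WellFormed σ ∧ w.blocks[i]? = some b)) {l : List ℕ} {k : ℕ}
    (h : (l, k) ∈ σ.wfRels.zipIdx) : (b.post i k (b.tuple l)).WellSorted (w.vocab σ) := by
  have h1 : σ.wfRels[k]? = some l := by simpa using (List.mk_mem_zipIdx_iff_getElem?.1 h)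
  have key : ∀ (sts : List Stmt) (acc : Formula), (∀ st ∈ sts, st ∈ b.stmts) →
      acc.WellSorted (w.vocab σ) → (sts.foldl (fun acc st =>
        if st.rel = k then
          if st.add then Formula.or acc (b.selects i st (b.tuple l))
          else .and acc (.not (b.selects i st (b.tuple l)))
        else acc) acc).WellSorted (w.vocab σ) := by
    intro sts
    induction sts with
    | nil => intro acc _ h; exact h
    | cons st sts ih =>
      intro acc hsts hacc
      refine ih _ (fun st hst => hsts st (List.mem_cons_of_mem _ hst)) ?_
      beta_reduce
      split
      · next hk =>
        have hst := hsts st List.mem_cons_self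
        have hsel : (b.selects i st (b.tuple l)).WellSorted (w.vocab σ) := by
          rcases hb with rfl | ⟨hb, hi⟩
          · simp [idBlock] at hst
          · exact wellSorted_exN hb.vars_sort (wellSorted_selectsBody hσ hb hi hst (hk ▸ h1))
        split
        · exact ⟨hacc, hsel⟩
        · exact ⟨hacc, hsel⟩
      · exact hacc
  exact key b.stmts _ (fun _ h => h) (wellSorted_wfRel hσ h b)

theorem block_cases_of_mem_edges {σ : Signature} {w : Workflow} (hw : w.WellFormed σ) {e : Edge}
    (he : e ∈ w.edges) :
    e.block = idBlock ∨ (e.block.WellFormed σ ∧ w.blocks[e.idx]? = some e.block) :=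
  (block_of_mem_edges he).imp_right fun h => ⟨hw _ (List.mem_of_getElem? h), h⟩

theorem wellSorted_cfg {σ : Signature} {w : Workflow} : w.cfg.WellSorted (w.vocab σ) := by
  refine ⟨trivial, wellSorted_bigAnd ?_⟩
  simp only [List.forall_mem_map]
  intro n hn
  refine ⟨wellSorted_atNode hn, wellSorted_bigOr ?_⟩
  simp only [List.forall_mem_map, List.mem_filter]
  exact fun e he => wellSorted_atNode (nodes_of_mem_edges he.1).2

theorem wellSorted_sanity {σ : Signature} {w : Workflow} : w.sanity.WellSorted (w.vocab σ) := by
  refine ⟨trivial, wellSorted_bigAnd ?_⟩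
  simp only [List.forall_mem_map, List.mem_filter]
  intro p hp
  have := List.mem_product.1 (show (p.1, p.2) ∈ _ from hp.1)
  exact ⟨wellSorted_atNode this.1, wellSorted_atNode this.2⟩

theorem wellSorted_init {σ : Signature} (hσ : σ.WellFormed) {w : Workflow} :
    (w.init σ).WellSorted (w.vocab σ) := by
  refine ⟨⟨wellSorted_atNode (by simp [Workflow.nodes, Workflow.entryNode]),
    wellSorted_bigAnd ?_⟩, wellSorted_bigAnd ?_⟩
  · simp only [List.forall_mem_map, List.mem_filter]
    exact fun n hn => wellSorted_atNode hn.1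
  · simp only [List.forall_mem_map]
    rintro ⟨l, k⟩ hp
    have h1 : σ.wfRels[k]? = some l := by simpa using (List.mk_mem_zipIdx_iff_getElem?.1 hp)
    exact wellSorted_allN (tuple_fst_lt (hσ.2.2.1 l (List.mem_of_getElem? h1)))
      (wellSorted_wfRel hσ hp _)

theorem wellSorted_exec {σ : Signature} (hσ : σ.WellFormed) {w : Workflow} (hw : w.WellFormed σ) :
    (w.exec σ).WellSorted (w.vocab σ) := by
  refine ⟨trivial, wellSorted_bigAnd ?_⟩
  simp only [List.forall_mem_map]
  intro e he
  have hn := nodes_of_mem_edges he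
  refine ⟨⟨wellSorted_atNode hn.1, wellSorted_atNode hn.2⟩, wellSorted_bigAnd ?_⟩
  simp only [List.forall_mem_map]
  rintro ⟨l, k⟩ hp
  have h1 : σ.wfRels[k]? = some l := by simpa using (List.mk_mem_zipIdx_iff_getElem?.1 hp)
  have h2 := wellSorted_wfRel (w := w) hσ hp e.block
  have h3 := wellSorted_post hσ (block_cases_of_mem_edges hw he) hp
  exact wellSorted_allN (tuple_fst_lt (hσ.2.2.1 l (List.mem_of_getElem? h1)))
    ⟨⟨h2, h3⟩, ⟨h3, h2⟩⟩

theorem wellSorted_wf {σ : Signature} (hσ : σ.WellFormed) {w : Workflow} (hw : w.WellFormed σ) :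
    (w.wf σ).WellSorted (w.vocab σ) :=
  ⟨wellSorted_cfg, wellSorted_sanity, wellSorted_init hσ, wellSorted_exec hσ hw⟩

/-! ### Restrictions of executions of a workflow -/

section RestrictWf

variable {σ : Signature} {w : Workflow} {T : TemporalStructure.{u} (w.vocab σ)}
  {H : ∀ s, Set (T.U s)} {hne : ∀ s, (H s).Nonempty}

theorem mem_termsFv {ts : List Term} {x : ℕ × ℕ} :
    x ∈ termsFv ts ↔ Term.var x.1 x.2 ∈ ts := by
  induction ts with
  | nil => simp [termsFv]
  | cons t ts ih =>
    simp only [termsFv, List.foldr_cons, Finset.mem_union, List.mem_cons] at ih ⊢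
    rw [ih]
    cases t <;> simp [Term.fv, Prod.ext_iff]

theorem exists_mem_zipWith {α β γ : Type*} (f : α → β → γ) {l : List α} {l' : List β}
    (h : l.length = l'.length) {b : β} (hb : b ∈ l') : ∃ a ∈ l, f a b ∈ List.zipWith f l l' := by
  obtain ⟨i, hi, rfl⟩ := List.getElem_of_mem hb
  exact ⟨l[i], List.getElem_mem _, List.mem_iff_getElem.2 ⟨i, by simp [h, hi], by simp⟩⟩

/-- In a non-omitting block, the choice of the block variables is determined by the updated tuple,
so that the effect of the block does not depend on elements outside the restriction. -/
theorem sat_selects_restrict (hσ : σ.WellFormed) (hC : ContainsConsts T H) {b : Block} {i : ℕ}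
    (hb : b.WellFormed σ) (hi : w.blocks[i]? = some b) {st : Stmt} (hst : st ∈ b.stmts)
    (hno : termsFv st.args = b.vars.toFinset ∧ st.guard.QuantifierFree)
    {l : List ℕ} (hl : σ.wfRels[st.rel]? = some l) (ν : Valuation (restrict T H hne)) (t : ℕ) :
    (b.selects i st (b.tuple l)).Sat (restrict T H hne) ν t ↔
      (b.selects i st (b.tuple l)).Sat T (liftVal ν) t := by
  classical
  have hq : (b.selectsBody i st (b.tuple l)).QuantifierFree := by
    refine ⟨hno.2, ?_, quantifierFree_bigAnd fun φ hφ => ?_⟩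
    · split <;> trivial
    · obtain ⟨k, hk, rfl⟩ := List.mem_iff_getElem.1 hφ
      rw [List.getElem_zipWith]; trivial
  have hws := wellSorted_selectsBody hσ hb hi hst hl
  have hiff := fun μ => sat_restrict_iff (hne := hne) hC hq hws μ t
  change (exN b.vars (b.selectsBody i st (b.tuple l))).Sat _ ν t ↔
    (exN b.vars (b.selectsBody i st (b.tuple l))).Sat _ (liftVal ν) t
  rw [sat_exN, sat_exN]
  constructor
  · rintro ⟨μ, h1, h2⟩
    exact ⟨liftVal μ, fun s i hsi => congrArg Subtype.val (h1 s i hsi), (hiff μ).1 h2⟩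
  · rintro ⟨μ, h1, h2⟩
    have hmem : ∀ s j, (s, j) ∈ b.vars → μ s j ∈ H s := by
      intro s j hsj
      have harg : Term.var s j ∈ st.args := by
        rw [← mem_termsFv (x := (s, j)), hno.1]; simpa using hsj
      obtain ⟨l', hl', hargs⟩ := (hb.stmts_wf st hst).args_sort
      obtain rfl : l = l' := Option.some_inj.1 (hl.symm.trans hl')
      obtain ⟨y, hy, hyeq⟩ := exists_mem_zipWith (fun y t => Formula.eq (Term.ofVar y) t)
        ((tuple_length b l).trans hargs.length_eq.symm) harg
      have h3 : (⟨y.1, μ y.1 y.2⟩ : Σ s, T.U s) = ⟨s, μ s j⟩ := sat_bigAnd.1 h2.2.2 _ hyeq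
      have h4 : μ y.1 y.2 ∈ H y.1 := by
        rw [h1 y.1 y.2 (tuple_not_mem_vars hy)]
        exact (ν y.1 y.2).2
      have h5 : ∀ x y : Σ s, T.U s, x = y → x.2 ∈ H x.1 → y.2 ∈ H y.1 := by
        rintro x _ rfl h; exact h
      exact h5 _ _ h3 h4
    let μ' : Valuation (restrict T H hne) := fun s j =>
      if h : (s, j) ∈ b.vars then ⟨μ s j, hmem s j h⟩ else ν s j
    have hμ' : liftVal μ' = μ := by
      funext s j
      by_cases h : (s, j) ∈ b.vars
      · simp [liftVal, μ', h]
      · rw [h1 s j h]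
        exact congrArg Subtype.val (dif_neg h)
    refine ⟨μ', fun s j h => dif_neg h, (hiff μ').2 ?_⟩
    rw [hμ']; exact h2

theorem sat_post_restrict (hσ : σ.WellFormed) (hC : ContainsConsts T H) {b : Block} {i : ℕ}
    (hb : b = idBlock ∨ (b.WellFormed σ ∧ w.blocks[i]? = some b)) (hno : w.NonOmitting)
    {l : List ℕ} {k : ℕ} (h : (l, k) ∈ σ.wfRels.zipIdx) (ν : Valuation (restrict T H hne)) (t : ℕ) :
    (b.post i k (b.tuple l)).Sat (restrict T H hne) ν t ↔
      (b.post i k (b.tuple l)).Sat T (liftVal ν) t := by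
  have h1 : σ.wfRels[k]? = some l := by simpa using (List.mk_mem_zipIdx_iff_getElem?.1 h)
  have key : ∀ (sts : List Stmt) (acc : Formula), (∀ st ∈ sts, st ∈ b.stmts) →
      (acc.Sat (restrict T H hne) ν t ↔ acc.Sat T (liftVal ν) t) →
      ∀ φ, φ = (sts.foldl (fun acc st =>
        if st.rel = k then
          if st.add then Formula.or acc (b.selects i st (b.tuple l))
          else .and acc (.not (b.selects i st (b.tuple l)))
        else acc) acc) → (φ.Sat (restrict T H hne) ν t ↔ φ.Sat T (liftVal ν) t) := by
    intro sts
    induction sts with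
    | nil => rintro acc _ h _ rfl; exact h
    | cons st sts ih =>
      intro acc hsts hacc
      refine ih _ (fun st hst => hsts st (List.mem_cons_of_mem _ hst)) ?_
      beta_reduce
      split
      · next hk =>
        have hst := hsts st List.mem_cons_self
        have hsel : (b.selects i st (b.tuple l)).Sat (restrict T H hne) ν t ↔
            (b.selects i st (b.tuple l)).Sat T (liftVal ν) t := by
          rcases hb with rfl | ⟨hb, hi⟩
          · simp [idBlock] at hst
          · exact sat_selects_restrict hσ hC hb hi hst (hno b (List.mem_of_getElem? hi) st hst)
              (hk ▸ h1) ν t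
        split
        · exact or_congr hacc hsel
        · exact and_congr hacc (not_congr hsel)
      · exact hacc
  exact key b.stmts _ (fun _ h => h)
    (sat_restrict_iff (φ := .rel _ _) hC trivial (wellSorted_wfRel hσ h b) ν t) _ rfl

theorem nnf_noEx_bigAnd {l : List Formula} (h : ∀ φ ∈ l, φ.NNF ∧ φ.NoEx) :
    (bigAnd l).NNF ∧ (bigAnd l).NoEx := by
  induction l with
  | nil => exact ⟨trivial, trivial⟩
  | cons φ l ih =>
    have h1 := h φ List.mem_cons_self
    have h2 := ih fun φ hφ => h φ (List.mem_cons_of_mem _ hφ)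
    exact ⟨⟨h1.1, h2.1⟩, ⟨h1.2, h2.2⟩⟩

theorem nnf_noEx_allN {xs : List (ℕ × ℕ)} {φ : Formula} (h : φ.NNF ∧ φ.NoEx) :
    (allN xs φ).NNF ∧ (allN xs φ).NoEx := by
  induction xs with
  | nil => exact h
  | cons x xs ih => exact ih

theorem nnf_noEx_init : (w.init σ).NNF ∧ (w.init σ).NoEx := by
  have h1 := nnf_noEx_bigAnd
    (l := (w.nodes.filter fun n => n ≠ Workflow.entryNode).map fun n => .not (atNode n)) (by
      simp only [List.forall_mem_map]; exact fun _ _ => ⟨trivial, trivial⟩)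
  have h2 := nnf_noEx_bigAnd (l := σ.wfRels.zipIdx.map fun p =>
      allN (idBlock.tuple p.1) (.not (.rel (.wf p.2) ((idBlock.tuple p.1).map Term.ofVar)))) (by
      simp only [List.forall_mem_map]; exact fun _ _ => nnf_noEx_allN ⟨trivial, trivial⟩)
  exact ⟨⟨⟨trivial, h1.1⟩, h2.1⟩, ⟨⟨trivial, h1.2⟩, h2.2⟩⟩

theorem quantifierFree_cfg : w.cfg.QuantifierFree := by
  refine ⟨trivial, quantifierFree_bigAnd ?_⟩
  simp only [List.forall_mem_map]
  intro n _
  refine ⟨trivial, quantifierFree_bigOr ?_⟩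
  simp only [List.forall_mem_map]
  exact fun _ _ => trivial

theorem quantifierFree_sanity : w.sanity.QuantifierFree := by
  refine ⟨trivial, quantifierFree_bigAnd ?_⟩
  simp only [List.forall_mem_map]
  exact fun _ _ => ⟨trivial, trivial⟩

/-- Restrictions of executions of a non-omitting workflow are executions. -/
theorem restrict_mem_sem (hσ : σ.WellFormed) (hw : w.WellFormed σ) (hno : w.NonOmitting)
    (hC : ContainsConsts T H) (hT : T ∈ w.sem σ) : restrict T H hne ∈ w.sem σ := by
  intro ν
  obtain ⟨h1, h2, h3, h4⟩ := hT (liftVal ν)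
  refine ⟨(sat_restrict_iff hC quantifierFree_cfg wellSorted_cfg ν 0).2 h1,
    (sat_restrict_iff hC quantifierFree_sanity wellSorted_sanity ν 0).2 h2,
    sat_restrict_of_noEx hC nnf_noEx_init.1 nnf_noEx_init.2 (wellSorted_init hσ) ν 0 h3, ?_⟩
  refine sat_globally.2 fun j => sat_bigAnd.2 ?_
  simp only [List.forall_mem_map]
  intro e he
  have h5 := sat_bigAnd.1 (sat_globally.1 h4 j) _ (List.mem_map_of_mem he)
  have hn := nodes_of_mem_edges he
  rw [Edge.exec, sat_imp] at h5 ⊢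
  intro h6
  have h7 := h5 ((sat_restrict_iff (φ := .and (atNode e.src) (.next (atNode e.dst))) hC
    ⟨trivial, trivial⟩ ⟨wellSorted_atNode hn.1, wellSorted_atNode hn.2⟩ ν _).1 h6)
  rw [sat_bigAnd] at h7 ⊢
  simp only [List.forall_mem_map] at h7 ⊢
  rintro ⟨l, k⟩ hp
  have h8 := h7 _ hp
  rw [sat_allN] at h8 ⊢
  intro μ hμ
  have h9 := h8 (liftVal μ) fun s i hsi => congrArg Subtype.val (hμ s i hsi)
  rw [sat_iff] at h9 ⊢
  rw [sat_post_restrict hσ hC (block_cases_of_mem_edges hw he) hno hp, ← h9]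
  exact sat_restrict_iff (φ := .next (.rel _ _)) hC trivial (wellSorted_wfRel hσ hp e.block) μ _

end RestrictWf

/-! ### Computing the Gödel number of the specification of a workflow -/

namespace Code

def tru : ℕ := Nat.pair 0 0
def eq (a b : ℕ) : ℕ := Nat.pair 1 (Nat.pair a b)
def rel (R : ℕ) (ts : List ℕ) : ℕ := Nat.pair 2 (Nat.pair R (Encodable.encode ts))
def not (a : ℕ) : ℕ := Nat.pair 3 a
def or (a b : ℕ) : ℕ := Nat.pair 4 (Nat.pair a b)
def and (a b : ℕ) : ℕ := Nat.pair 5 (Nat.pair a b)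
def ex (x : ℕ × ℕ) (a : ℕ) : ℕ := Nat.pair 6 (Nat.pair (Nat.pair x.1 x.2) a)
def all (x : ℕ × ℕ) (a : ℕ) : ℕ := Nat.pair 7 (Nat.pair (Nat.pair x.1 x.2) a)
def next (a : ℕ) : ℕ := Nat.pair 8 a
def imp (a b : ℕ) : ℕ := or (not a) b
def iff (a b : ℕ) : ℕ := and (imp a b) (imp b a)
def globally (a : ℕ) : ℕ := not (Nat.pair 9 (Nat.pair tru (not a)))
def bigAnd (l : List ℕ) : ℕ := l.foldr (fun a b => and a b) tru
def bigOr (l : List ℕ) : ℕ := l.foldr (fun a b => or a b) (not tru)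
def exN (xs : List (ℕ × ℕ)) (a : ℕ) : ℕ := xs.foldr (fun x b => ex x b) a
def allN (xs : List (ℕ × ℕ)) (a : ℕ) : ℕ := xs.foldr (fun x b => all x b) a
def atNode (n : ℕ) : ℕ := rel (Nat.pair 2 n) []
def ofVar (x : ℕ × ℕ) : ℕ := Nat.pair 0 (Nat.pair x.1 x.2)

/-- The variables of a block. -/
def vars (b : ℕ) : List (ℕ × ℕ) := Denumerable.ofNat (List (ℕ × ℕ)) b.unpair.1

/-- The codes of the statements of a block. -/
def stmts (b : ℕ) : List ℕ := Denumerable.ofNat (List ℕ) b.unpair.2.unpair.2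

/-- The codes of the arguments of a statement. -/
def args (st : ℕ) : List ℕ := Denumerable.ofNat (List ℕ) st.unpair.2.unpair.2.unpair.2

def tuple (b : ℕ) (l : List ℕ) : List (ℕ × ℕ) :=
  (List.range l.length).map fun j =>
    (l.getD j 0, ((vars b).map fun x => x.2).foldr (fun x y => max x y) 0 + 1 + j)

def eqs (ys : List (ℕ × ℕ)) (ts : List ℕ) : List ℕ :=
  (List.range (min ys.length ts.length)).map fun j => eq (ofVar (ys.getD j (0, 0))) (ts.getD j 0)

def selects (b i st : ℕ) (ys : List (ℕ × ℕ)) : ℕ :=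
  exN (vars b) (and st.unpair.1
    (and (bif decide (b.unpair.2.unpair.1 = 1) then
        rel (Nat.pair 3 i) ((vars b).map fun x => ofVar x) else tru)
      (bigAnd (eqs ys (args st)))))

/-- The effect of the statement `st` of the block `b` on the content `acc` of the relation `k`. -/
def update (b i k : ℕ) (ys : List (ℕ × ℕ)) (acc st : ℕ) : ℕ :=
  bif decide (st.unpair.2.unpair.2.unpair.1 = k) then
    bif decide (st.unpair.2.unpair.1 = 1) then or acc (selects b i st ys)
    else and acc (not (selects b i st ys))
  else acc

def post (b i k : ℕ) (ys : List (ℕ × ℕ)) : ℕ :=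
  (stmts b).foldl (fun acc st => update b i k ys acc st)
    (rel (Nat.pair 0 k) (ys.map fun y => ofVar y))

def execRel (b i k : ℕ) (ys : List (ℕ × ℕ)) : ℕ :=
  allN ys (iff (next (rel (Nat.pair 0 k) (ys.map fun y => ofVar y))) (post b i k ys))

def exec (rels : List (List ℕ)) (e : ℕ × ℕ × ℕ × ℕ) : ℕ :=
  imp (and (atNode e.1) (next (atNode e.2.1)))
    (bigAnd ((List.range rels.length).map fun k =>
      execRel e.2.2.2 e.2.2.1 k (tuple e.2.2.2 (rels.getD k []))))

/-- The parts of a workflow, with their entry and exit nodes; `x` is the code of the workflow with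
its own entry and exit, and `m` the next free node. -/
def stepTasks (x : ℕ × ℕ × ℕ) (m : ℕ) : List (ℕ × ℕ × ℕ) :=
  [[], [(x.1.unpair.2.unpair.2, m, x.2.2)],
    bif decide (x.1.unpair.2.unpair.1 = 2) then [(x.1.unpair.2, m, x.2.1)]
    else [(x.1.unpair.2, x.2.1, x.2.1)]].getD x.1.unpair.1
    [(x.1.unpair.2.unpair.1, m, x.2.2), (x.1.unpair.2.unpair.2, m + 1, x.2.2)]

/-- The edges of a workflow that do not belong to its parts. -/
def stepEdges (x : ℕ × ℕ × ℕ) (m i : ℕ) : List (ℕ × ℕ × ℕ × ℕ) :=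
  [[(x.2.1, x.2.2, i, x.1.unpair.2)], [(x.2.1, m, i, x.1.unpair.2.unpair.1)],
    (x.2.1, x.2.2, 0, idBlock.code) :: bif decide (x.1.unpair.2.unpair.1 = 2) then
      [(x.2.1, m, 0, idBlock.code)] else []].getD x.1.unpair.1
    [(x.2.1, m, 0, idBlock.code), (x.2.1, m + 1, 0, idBlock.code)]

/-- One step of the construction of the control flow graph. The state consists of a stack of
workflows together with their entry and exit nodes, the next free node, the index of the next
block, and the edges found so far. -/
def step (s : List (ℕ × ℕ × ℕ) × (ℕ × ℕ) × List (ℕ × ℕ × ℕ × ℕ)) :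
    List (ℕ × ℕ × ℕ) × (ℕ × ℕ) × List (ℕ × ℕ × ℕ × ℕ) :=
  let x := s.1.getD 0 (0, 0, 0)
  bif decide (s.1.length = 0) then s
  else (stepTasks x s.2.1.1 ++ s.1.tail,
    (s.2.1.1 + [0, 1, bif decide (x.1.unpair.2.unpair.1 = 2) then 1 else 0].getD x.1.unpair.1 2,
      s.2.1.2 + [1, 1, 0].getD x.1.unpair.1 0),
    s.2.2 ++ stepEdges x s.2.1.1 s.2.1.2)

def graph (w : ℕ) : List (ℕ × ℕ × ℕ) × (ℕ × ℕ) × List (ℕ × ℕ × ℕ × ℕ) :=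
  (fun s => step s)^[w + 1] ([(w, 0, 1)], (2, 0), [])

def edges (w : ℕ) : List (ℕ × ℕ × ℕ × ℕ) := (1, 1, 0, idBlock.code) :: (graph w).2.2

def nodes (w : ℕ) : List ℕ := List.range (graph w).2.1.1

def cfg (w : ℕ) : ℕ :=
  globally (bigAnd ((nodes w).map fun n => imp (atNode n)
    (next (bigOr (((edges w).filter fun e => decide (e.1 = n)).map fun e => atNode e.2.1)))))

def sanity (w : ℕ) : ℕ :=
  globally (bigAnd ((((nodes w).flatMap fun a => (nodes w).map fun b => (a, b)).filter
    fun p => !decide (p.1 = p.2)).map fun p => not (and (atNode p.1) (atNode p.2))))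

def init (rels : List (List ℕ)) (w : ℕ) : ℕ :=
  and (and (atNode 0)
      (bigAnd (((nodes w).filter fun n => !decide (n = 0)).map fun n => not (atNode n))))
    (bigAnd ((List.range rels.length).map fun k =>
      allN (tuple idBlock.code (rels.getD k []))
        (not (rel (Nat.pair 0 k) ((tuple idBlock.code (rels.getD k [])).map fun y => ofVar y)))))

def wf (rels : List (List ℕ)) (w : ℕ) : ℕ :=
  and (cfg w) (and (sanity w) (and (init rels w)
    (globally (bigAnd ((edges w).map fun e => exec rels e)))))

section Primrec

variable {α : Type*} [Primcodable α]

@[fun_prop] theorem primrec_eq {f g : α → ℕ} (hf : Primrec f) (hg : Primrec g) :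
    Primrec (fun a => eq (f a) (g a)) := by unfold eq; fun_prop
@[fun_prop] theorem primrec_rel {f : α → ℕ} {g : α → List ℕ} (hf : Primrec f) (hg : Primrec g) :
    Primrec (fun a => rel (f a) (g a)) := by unfold rel; fun_prop
@[fun_prop] theorem primrec_not {f : α → ℕ} (hf : Primrec f) :
    Primrec (fun a => not (f a)) := by unfold not; fun_prop
@[fun_prop] theorem primrec_or {f g : α → ℕ} (hf : Primrec f) (hg : Primrec g) :
    Primrec (fun a => or (f a) (g a)) := by unfold or; fun_prop
@[fun_prop] theorem primrec_and {f g : α → ℕ} (hf : Primrec f) (hg : Primrec g) :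
    Primrec (fun a => and (f a) (g a)) := by unfold and; fun_prop
@[fun_prop] theorem primrec_ex {f : α → ℕ × ℕ} {g : α → ℕ} (hf : Primrec f) (hg : Primrec g) :
    Primrec (fun a => ex (f a) (g a)) := by unfold ex; fun_prop
@[fun_prop] theorem primrec_all {f : α → ℕ × ℕ} {g : α → ℕ} (hf : Primrec f) (hg : Primrec g) :
    Primrec (fun a => all (f a) (g a)) := by unfold all; fun_prop
@[fun_prop] theorem primrec_next {f : α → ℕ} (hf : Primrec f) :
    Primrec (fun a => next (f a)) := by unfold next; fun_prop
@[fun_prop] theorem primrec_imp {f g : α → ℕ} (hf : Primrec f) (hg : Primrec g) :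
    Primrec (fun a => imp (f a) (g a)) := by unfold imp; fun_prop
@[fun_prop] theorem primrec_iff {f g : α → ℕ} (hf : Primrec f) (hg : Primrec g) :
    Primrec (fun a => iff (f a) (g a)) := by unfold iff; fun_prop
@[fun_prop] theorem primrec_globally {f : α → ℕ} (hf : Primrec f) :
    Primrec (fun a => globally (f a)) := by unfold globally; fun_prop
@[fun_prop] theorem primrec_bigAnd {f : α → List ℕ} (hf : Primrec f) :
    Primrec (fun a => bigAnd (f a)) := by unfold bigAnd; fun_prop
@[fun_prop] theorem primrec_bigOr {f : α → List ℕ} (hf : Primrec f) :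
    Primrec (fun a => bigOr (f a)) := by unfold bigOr; fun_prop
@[fun_prop] theorem primrec_exN {f : α → List (ℕ × ℕ)} {g : α → ℕ} (hf : Primrec f)
    (hg : Primrec g) : Primrec (fun a => exN (f a) (g a)) := by unfold exN; fun_prop
@[fun_prop] theorem primrec_allN {f : α → List (ℕ × ℕ)} {g : α → ℕ} (hf : Primrec f)
    (hg : Primrec g) : Primrec (fun a => allN (f a) (g a)) := by unfold allN; fun_prop
@[fun_prop] theorem primrec_atNode {f : α → ℕ} (hf : Primrec f) :
    Primrec (fun a => atNode (f a)) := by unfold atNode; fun_prop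
@[fun_prop] theorem primrec_ofVar {f : α → ℕ × ℕ} (hf : Primrec f) :
    Primrec (fun a => ofVar (f a)) := by unfold ofVar; fun_prop
@[fun_prop] theorem primrec_vars {f : α → ℕ} (hf : Primrec f) :
    Primrec (fun a => vars (f a)) := by unfold vars; fun_prop
@[fun_prop] theorem primrec_stmts {f : α → ℕ} (hf : Primrec f) :
    Primrec (fun a => stmts (f a)) := by unfold stmts; fun_prop
@[fun_prop] theorem primrec_args {f : α → ℕ} (hf : Primrec f) :
    Primrec (fun a => args (f a)) := by unfold args; fun_prop
@[fun_prop] theorem primrec_tuple {f : α → ℕ} {g : α → List ℕ} (hf : Primrec f)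
    (hg : Primrec g) : Primrec (fun a => tuple (f a) (g a)) := by unfold tuple; fun_prop
@[fun_prop] theorem primrec_eqs {f : α → List (ℕ × ℕ)} {g : α → List ℕ} (hf : Primrec f)
    (hg : Primrec g) : Primrec (fun a => eqs (f a) (g a)) := by unfold eqs; fun_prop
@[fun_prop] theorem primrec_selects {f g h : α → ℕ} {l : α → List (ℕ × ℕ)} (hf : Primrec f)
    (hg : Primrec g) (hh : Primrec h) (hl : Primrec l) :
    Primrec (fun a => selects (f a) (g a) (h a) (l a)) := by unfold selects; fun_prop
@[fun_prop] theorem primrec_update {f g h i j : α → ℕ} {l : α → List (ℕ × ℕ)}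
    (hf : Primrec f) (hg : Primrec g) (hh : Primrec h) (hl : Primrec l) (hi : Primrec i)
    (hj : Primrec j) : Primrec (fun a => update (f a) (g a) (h a) (l a) (i a) (j a)) := by
  unfold update; fun_prop
@[fun_prop] theorem primrec_post {f g h : α → ℕ} {l : α → List (ℕ × ℕ)} (hf : Primrec f)
    (hg : Primrec g) (hh : Primrec h) (hl : Primrec l) :
    Primrec (fun a => post (f a) (g a) (h a) (l a)) := by unfold post; fun_prop
@[fun_prop] theorem primrec_execRel {f g h : α → ℕ} {l : α → List (ℕ × ℕ)} (hf : Primrec f)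
    (hg : Primrec g) (hh : Primrec h) (hl : Primrec l) :
    Primrec (fun a => execRel (f a) (g a) (h a) (l a)) := by unfold execRel; fun_prop
@[fun_prop] theorem primrec_exec {f : α → List (List ℕ)} {g : α → ℕ × ℕ × ℕ × ℕ}
    (hf : Primrec f) (hg : Primrec g) : Primrec (fun a => exec (f a) (g a)) := by
  unfold exec; fun_prop
@[fun_prop] theorem primrec_stepTasks {f : α → ℕ × ℕ × ℕ} {g : α → ℕ} (hf : Primrec f)
    (hg : Primrec g) : Primrec (fun a => stepTasks (f a) (g a)) := by unfold stepTasks; fun_prop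
@[fun_prop] theorem primrec_stepEdges {f : α → ℕ × ℕ × ℕ} {g h : α → ℕ} (hf : Primrec f)
    (hg : Primrec g) (hh : Primrec h) : Primrec (fun a => stepEdges (f a) (g a) (h a)) := by
  unfold stepEdges; fun_prop
@[fun_prop] theorem primrec_step
    {f : α → List (ℕ × ℕ × ℕ) × (ℕ × ℕ) × List (ℕ × ℕ × ℕ × ℕ)} (hf : Primrec f) :
    Primrec (fun a => step (f a)) := by
  unfold step; fun_prop
@[fun_prop] theorem primrec_graph {f : α → ℕ} (hf : Primrec f) :
    Primrec (fun a => graph (f a)) := by unfold graph; fun_prop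
@[fun_prop] theorem primrec_edges {f : α → ℕ} (hf : Primrec f) :
    Primrec (fun a => edges (f a)) := by unfold edges; fun_prop
@[fun_prop] theorem primrec_nodes {f : α → ℕ} (hf : Primrec f) :
    Primrec (fun a => nodes (f a)) := by unfold nodes; fun_prop
@[fun_prop] theorem primrec_cfg {f : α → ℕ} (hf : Primrec f) :
    Primrec (fun a => cfg (f a)) := by unfold cfg; fun_prop
@[fun_prop] theorem primrec_sanity {f : α → ℕ} (hf : Primrec f) :
    Primrec (fun a => sanity (f a)) := by unfold sanity; fun_prop
@[fun_prop] theorem primrec_init {f : α → List (List ℕ)} {g : α → ℕ} (hf : Primrec f)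
    (hg : Primrec g) : Primrec (fun a => init (f a) (g a)) := by unfold init; fun_prop
@[fun_prop] theorem primrec_wf {f : α → List (List ℕ)} {g : α → ℕ} (hf : Primrec f)
    (hg : Primrec g) : Primrec (fun a => wf (f a) (g a)) := by unfold wf; fun_prop

end Primrec

theorem decide_encode_bool (b : Bool) : decide (Encodable.encode b = 1) = b := by
  cases b <;> simp

theorem code_imp (φ ψ : Formula) : (Formula.imp φ ψ).code = imp φ.code ψ.code := rfl
theorem code_iff (φ ψ : Formula) : (Formula.iff φ ψ).code = iff φ.code ψ.code := rfl
theorem code_globally (φ : Formula) : (Formula.globally φ).code = globally φ.code := rfl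

theorem code_bigAnd (l : List Formula) :
    (Formula.bigAnd l).code = bigAnd (l.map Formula.code) := by
  induction l with
  | nil => rfl
  | cons φ l ih => exact congrArg (and φ.code) ih

theorem code_bigOr (l : List Formula) : (Formula.bigOr l).code = bigOr (l.map Formula.code) := by
  induction l with
  | nil => rfl
  | cons φ l ih => exact congrArg (or φ.code) ih

theorem code_exN (xs : List (ℕ × ℕ)) (φ : Formula) :
    (Formula.exN xs φ).code = exN xs φ.code := by
  induction xs with
  | nil => rfl
  | cons x xs ih => exact congrArg (ex x) ih

theorem code_allN (xs : List (ℕ × ℕ)) (φ : Formula) :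
    (Formula.allN xs φ).code = allN xs φ.code := by
  induction xs with
  | nil => rfl
  | cons x xs ih => exact congrArg (all x) ih

theorem code_relVars (k : ℕ) (ys : List (ℕ × ℕ)) :
    (Formula.rel (.wf k) (ys.map Term.ofVar)).code =
      rel (Nat.pair 0 k) (ys.map fun y => ofVar y) := by
  simp only [Formula.code, List.map_map]
  rfl

theorem vars_code (b : Block) : vars b.code = b.vars := by
  simp [vars, Block.code, Denumerable.ofNat_encode]

theorem stmts_code (b : Block) : stmts b.code = b.stmts.map Stmt.code := by
  simp [stmts, Block.code, Denumerable.ofNat_encode]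

theorem args_code (st : Stmt) : args st.code = st.args.map Term.code := by
  simp [args, Stmt.code, Denumerable.ofNat_encode]

theorem tuple_code (b : Block) (l : List ℕ) : tuple b.code l = b.tuple l := by
  unfold tuple Block.tuple
  rw [vars_code]
  refine List.ext_getElem (by simp) fun j h1 h2 => ?_
  have hj : j < l.length := by simpa using h1
  simp [hj]

theorem eqs_code (ys : List (ℕ × ℕ)) (ts : List Term) :
    eqs ys (ts.map Term.code) =
      (List.zipWith (fun y t => Formula.eq (Term.ofVar y) t) ys ts).map Formula.code := by
  unfold eqs
  refine List.ext_getElem (by simp) fun j h1 h2 => ?_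
  have hj : j < ys.length ∧ j < ts.length := by simpa using h1
  simp only [List.getElem_map, List.getElem_range, List.getElem_zipWith, Formula.code]
  rw [List.getD_eq_getElem _ _ hj.1, List.getD_eq_getElem _ _ (by simpa using hj.2)]
  simp [eq, ofVar, Term.ofVar, Term.code]

theorem selects_code (b : Block) (i : ℕ) (st : Stmt) (ys : List (ℕ × ℕ)) :
    selects b.code i st.code ys = (b.selects i st ys).code := by
  unfold selects Block.selects
  rw [code_exN, vars_code, args_code, eqs_code, ← code_bigAnd]
  have h1 : st.code.unpair.1 = st.guard.code := by simp [Stmt.code]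
  have h2 : b.code.unpair.2.unpair.1 = Encodable.encode b.may := by simp [Block.code]
  rw [h1, h2, decide_encode_bool]
  cases h : b.may with
  | false => rfl
  | true =>
    simp only [cond_true, if_true, Formula.code, List.map_map]
    rfl

theorem update_code (b : Block) (i k : ℕ) (ys : List (ℕ × ℕ)) (φ : Formula) (st : Stmt) :
    update b.code i k ys φ.code st.code =
      (if st.rel = k then
        if st.add then Formula.or φ (b.selects i st ys)
        else Formula.and φ (.not (b.selects i st ys))
      else φ).code := by
  unfold update
  have h1 : st.code.unpair.2.unpair.2.unpair.1 = st.rel := by simp [Stmt.code]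
  have h2 : st.code.unpair.2.unpair.1 = Encodable.encode st.add := by simp [Stmt.code]
  rw [h1, h2, decide_encode_bool, selects_code]
  by_cases h : st.rel = k
  · cases h' : st.add <;> simp [h] <;> rfl
  · simp [h]

theorem post_code (b : Block) (i k : ℕ) (ys : List (ℕ × ℕ)) :
    post b.code i k ys = (b.post i k ys).code := by
  unfold post Block.post
  rw [stmts_code, ← code_relVars]
  generalize Formula.rel (.wf k) (ys.map Term.ofVar) = φ
  induction b.stmts generalizing φ with
  | nil => rfl
  | cons st l ih =>
    simp only [List.map_cons, List.foldl_cons]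
    rw [update_code]
    exact ih _

theorem execRel_code (b : Block) (i k : ℕ) (ys : List (ℕ × ℕ)) :
    execRel b.code i k ys = (Formula.allN ys (Formula.iff
      (.next (.rel (.wf k) (ys.map Term.ofVar))) (b.post i k ys))).code := by
  rw [code_allN, code_iff, ← post_code]
  unfold execRel
  rw [← code_relVars]
  rfl

theorem map_range_getD {α : Type*} (l : List (List ℕ)) (f : ℕ → List ℕ → α) :
    ((List.range l.length).map fun k => f k (l.getD k [])) =
      l.zipIdx.map fun p => f p.2 p.1 := by
  refine List.ext_getElem (by simp) fun j h1 h2 => ?_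
  have hj : j < l.length := by simpa using h1
  simp [hj]

end Code

/-- An edge with the code of its label. -/
def Edge.code (e : Edge) : ℕ × ℕ × ℕ × ℕ := (e.src, e.dst, e.idx, e.block.code)

namespace Code

theorem exec_code (σ : Signature) (e : Edge) : exec σ.wfRels e.code = (e.exec σ).code := by
  unfold exec Edge.exec
  rw [code_imp, code_bigAnd, List.map_map]
  refine congrArg (imp _) (congrArg bigAnd ?_)
  rw [map_range_getD σ.wfRels fun k l => execRel e.code.2.2.2 e.code.2.2.1 k
    (tuple e.code.2.2.2 l)]
  refine List.map_congr_left fun p _ => ?_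
  simp only [Edge.code, tuple_code, execRel_code, Function.comp]

theorem unpair_code_eq_two (w : Workflow) : decide (w.code.unpair.1 = 2) = w.isLoop := by
  cases w <;> simp [Workflow.code, Workflow.isLoop]

theorem step_nil (m : ℕ × ℕ) (out : List (ℕ × ℕ × ℕ × ℕ)) : step ([], m, out) = ([], m, out) :=
  rfl

section Step

variable (b : Block) (w w' : Workflow) (n e m i : ℕ) (st : List (ℕ × ℕ × ℕ))
  (out : List (ℕ × ℕ × ℕ × ℕ))

theorem step_block : step (((Workflow.block b).code, n, e) :: st, (m, i), out) =
    (st, (m, i + 1), out ++ [(n, e, i, b.code)]) := by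
  simp [step, stepTasks, stepEdges, Workflow.code]

theorem step_seq : step (((Workflow.seq b w).code, n, e) :: st, (m, i), out) =
    ((w.code, m, e) :: st, (m + 1, i + 1), out ++ [(n, m, i, b.code)]) := by
  simp [step, stepTasks, stepEdges, Workflow.code]

theorem step_loop : step ((w.loop.code, n, e) :: st, (m, i), out) =
    ((w.code, if w.isLoop then m else n, n) :: st, (m + if w.isLoop then 1 else 0, i),
      out ++ (n, e, 0, idBlock.code) :: if w.isLoop then [(n, m, 0, idBlock.code)] else []) := by
  have hl := unpair_code_eq_two w
  cases hw : w.isLoop <;> rw [hw] at hl <;>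
    simp only [decide_eq_true_eq, decide_eq_false_iff_not] at hl <;>
    simp [step, stepTasks, stepEdges, Workflow.code, hl]

theorem step_choose : step (((w.choose w').code, n, e) :: st, (m, i), out) =
    ((w.code, m, e) :: (w'.code, m + 1, e) :: st, (m + 2, i),
      out ++ [(n, m, 0, idBlock.code), (n, m + 1, 0, idBlock.code)]) := by
  simp [step, stepTasks, stepEdges, Workflow.code]

end Step

theorem iterate_step (w : Workflow) (n e m i : ℕ) (st : List (ℕ × ℕ × ℕ))
    (out : List (ℕ × ℕ × ℕ × ℕ)) : ∃ k ≤ w.code + 1,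
      (fun s => step s)^[k] ((w.code, n, e) :: st, (m, i), out) =
        (st, (m + w.numInner, i + w.blocks.length),
          out ++ (w.edgesFrom n e m i).map Edge.code) := by
  induction w generalizing n e m i st out with
  | block b => exact ⟨1, by omega, step_block b n e m i st out⟩
  | seq b w ih =>
    obtain ⟨k, hk, h⟩ := ih m e (m + 1) (i + 1) st (out ++ [(n, m, i, b.code)])
    have h1 := Nat.add_le_pair 1 (Nat.pair b.code w.code)
    have h2 := Nat.add_le_pair b.code w.code
    refine ⟨k + 1, by simp only [Workflow.code]; omega, ?_⟩
    rw [Function.iterate_succ_apply, step_seq, h]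
    simp [Workflow.numInner, Workflow.blocks, Workflow.edgesFrom, Edge.code, add_assoc, add_comm]
  | loop w ih =>
    have h1 := Nat.add_le_pair 2 w.code
    obtain ⟨k, hk, h⟩ := ih (if w.isLoop then m else n) n (m + if w.isLoop then 1 else 0) i st
      (out ++ (n, e, 0, idBlock.code) :: if w.isLoop then [(n, m, 0, idBlock.code)] else [])
    refine ⟨k + 1, by simp only [Workflow.code]; omega, ?_⟩
    rw [Function.iterate_succ_apply, step_loop, h]
    cases hw : w.isLoop <;>
      simp [Workflow.numInner, Workflow.blocks, Workflow.edgesFrom, Edge.code, hw, add_assoc]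
  | choose w w' ih ih' =>
    obtain ⟨k, hk, h⟩ := ih m e (m + 2) i ((w'.code, m + 1, e) :: st)
      (out ++ [(n, m, 0, idBlock.code), (n, m + 1, 0, idBlock.code)])
    obtain ⟨k', hk', h'⟩ := ih' (m + 1) e (m + 2 + w.numInner) (i + w.blocks.length) st
      (out ++ [(n, m, 0, idBlock.code), (n, m + 1, 0, idBlock.code)] ++
        (w.edgesFrom m e (m + 2) i).map Edge.code)
    have h1 := Nat.add_le_pair 3 (Nat.pair w.code w'.code)
    have h2 := Nat.add_le_pair w.code w'.code
    refine ⟨k' + k + 1, by simp only [Workflow.code]; omega, ?_⟩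
    rw [Function.iterate_succ_apply, step_choose, Function.iterate_add_apply, h, h']
    simp [Workflow.numInner, Workflow.blocks, Workflow.edgesFrom, Edge.code, add_assoc]

theorem graph_code (w : Workflow) :
    graph w.code = ([], (2 + w.numInner, w.blocks.length),
      (w.edgesFrom Workflow.entryNode Workflow.endNode 2 0).map Edge.code) := by
  obtain ⟨k, hk, h⟩ := iterate_step w 0 1 2 0 [] []
  have hk' : w.code + 1 = (w.code + 1 - k) + k := by omega
  unfold graph
  rw [hk', Function.iterate_add_apply, h]
  rw [Function.iterate_fixed (step_nil _ _)]
  simp [Workflow.entryNode, Workflow.endNode]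

theorem edges_code (w : Workflow) : edges w.code = w.edges.map Edge.code := by
  rw [edges, graph_code]
  rfl

theorem nodes_code (w : Workflow) : nodes w.code = w.nodes := by
  rw [nodes, graph_code]
  rfl

theorem cfg_code (w : Workflow) : cfg w.code = w.cfg.code := by
  unfold cfg Workflow.cfg
  rw [code_globally, code_bigAnd, nodes_code, edges_code, List.map_map]
  refine congrArg (fun l => globally (bigAnd l)) (List.map_congr_left fun n _ => ?_)
  simp only [Function.comp, code_imp, Formula.code, code_bigOr, List.filter_map, List.map_map]
  rfl

theorem sanity_code (w : Workflow) : sanity w.code = w.sanity.code := by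
  unfold sanity Workflow.sanity
  rw [code_globally, code_bigAnd, nodes_code, List.map_map]
  refine congrArg (fun l => globally (bigAnd l)) ?_
  have : (w.nodes ×ˢ w.nodes) = w.nodes.flatMap fun a => w.nodes.map fun b => (a, b) := rfl
  rw [this]
  simp only [ne_eq, decide_not]
  rfl

theorem init_code (σ : Signature) (w : Workflow) :
    init σ.wfRels w.code = (w.init σ).code := by
  unfold init Workflow.init
  simp only [Formula.code, code_bigAnd, nodes_code, List.map_map]
  rw [map_range_getD σ.wfRels fun k l => allN (tuple idBlock.code l)
    (not (rel (Nat.pair 0 k) ((tuple idBlock.code l).map fun y => ofVar y)))]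
  refine congrArg₂ and ?_ (congrArg bigAnd (List.map_congr_left fun p _ => ?_))
  · simp only [ne_eq, decide_not]
    rfl
  · rw [tuple_code, ← code_relVars, Function.comp_apply, code_allN]
    rfl

theorem wf_code (σ : Signature) (w : Workflow) : wf σ.wfRels w.code = (w.wf σ).code := by
  unfold wf Workflow.wf
  rw [cfg_code, sanity_code, init_code, edges_code, List.map_map]
  simp only [Formula.code, Workflow.exec, code_globally, code_bigAnd, List.map_map]
  have : (fun e => exec σ.wfRels e) ∘ Edge.code = Formula.code ∘ Edge.exec σ :=
    funext fun e => exec_code σ e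
  rw [this]
  rfl

end Code

/-! ### The decision procedure -/

/-- The decision procedure; `x` consists of the codes of a signature, a workflow and a formula. -/
def decider (x : ℕ × ℕ × ℕ) : Bool :=
  let cs := Denumerable.ofNat (List ℕ) x.1.unpair.2.unpair.1
  let rels := Denumerable.ofNat (List (List ℕ)) x.1.unpair.2.unpair.2.unpair.1
  let ψ := Code.and (Code.wf rels x.2.1) x.2.2
  !boundedSat ((fun b => grow b)^[x.2.2] (cs.length + 1)) (ψ + cs.length + x.1 + 1) ψ cs

@[fun_prop] theorem primrec_grow {α : Type*} [Primcodable α] {f : α → ℕ} (hf : Primrec f) :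
    Primrec (fun a => grow (f a)) := by unfold grow; fun_prop

theorem computable_decider : Computable decider := by
  have h : Primrec decider := by unfold decider; fun_prop
  exact h.to_comp

theorem decider_code (σ : Signature) (w : Workflow) (φ : Formula) :
    decider (σ.code, w.code, φ.code) = !boundedSat (grow^[φ.code] (σ.consts.length + 1))
      ((Formula.and (w.wf σ) φ).code + σ.consts.length + σ.code + 1)
      (Formula.and (w.wf σ) φ).code σ.consts := by
  have h1 : Denumerable.ofNat (List ℕ) σ.code.unpair.2.unpair.1 = σ.consts := by
    simp [Signature.code, Denumerable.ofNat_encode]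
  have h2 : Denumerable.ofNat (List (List ℕ)) σ.code.unpair.2.unpair.2.unpair.1 = σ.wfRels := by
    simp [Signature.code, Denumerable.ofNat_encode]
  unfold decider
  simp only [h1, h2, Code.wf_code]
  rfl

/-- Some execution of the workflow satisfies the formula iff there is one within the bound. -/
theorem boundedSat_iff {σ : Signature} {w : Workflow} {φ : Formula} (hσ : σ.WellFormed)
    (hw : w.WellFormed σ) (hno : w.NonOmitting) (hφ : φ.BSFOLTL (w.vocab σ)) :
    boundedSat (grow^[φ.code] (σ.consts.length + 1))
      ((Formula.and (w.wf σ) φ).code + σ.consts.length + σ.code + 1)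
      (Formula.and (w.wf σ) φ).code σ.consts = true ↔
    ∃ T ∈ Workflow.sem.{u} σ w, ∃ ν : Valuation T, φ.Sat T ν 0 := by
  have hV : ∀ c, (w.vocab σ).constSort c = σ.consts[c]? := fun _ => rfl
  have hψ : (Formula.and (w.wf σ) φ).WellSorted (w.vocab σ) :=
    ⟨wellSorted_wf hσ hw, hφ.wellSorted⟩
  constructor
  · intro h
    obtain ⟨T, hT⟩ := exists_structure_of_boundedSat.{u} hV hψ h
    exact ⟨T, fun ν => (hT ν).1, fun s _ => (T.nonempty s).some, (hT _).2⟩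
  · rintro ⟨T, hT, ν, hν⟩
    obtain ⟨H, hne, hC, hfin, hcard, hsat⟩ := exists_small_restriction hV T hφ hν
    have hle : Encodable.encode σ.consts ≤ σ.code :=
      (Nat.left_le_pair _ _).trans (Nat.right_le_pair _ _)
    refine boundedSat_of_structure hV hψ (by omega) (by omega)
      (fun s hs => ?_) (T := restrict T H hne) hfin hcard
      fun ν => ⟨restrict_mem_sem hσ hw hno hC hT ν, hsat ν⟩
    have := le_encode_of_mem hs
    omega

end FOWorkflow

/-- There is an algorithm which, given (the codes of) a signature, a non-omitting workflow `w` and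
a BS-FOLTL formula `φ` over the signature of `w`, decides whether `w ⊨ ¬φ`. -/
theorem mainTheorem5 :
    ∃ decider : ℕ × ℕ × ℕ → Bool, Computable decider ∧
      ∀ (σ : FOWorkflow.Signature) (w : FOWorkflow.Workflow) (φ : FOWorkflow.Formula),
        σ.WellFormed → w.WellFormed σ → w.NonOmitting →
        FOWorkflow.Formula.BSFOLTL (w.vocab σ) φ →
        (decider (σ.code, w.code, φ.code) = true ↔
          FOWorkflow.Workflow.Satisfies.{u} σ w (FOWorkflow.Formula.not φ)) := by
  refine ⟨FOWorkflow.decider, FOWorkflow.computable_decider, fun σ w φ hσ hw hno hφ => ?_⟩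
  rw [FOWorkflow.decider_code, Bool.not_eq_true', ← Bool.not_eq_true,
    FOWorkflow.boundedSat_iff.{u} hσ hw hno hφ]
  exact ⟨fun h T hT ν hν => h ⟨T, hT, ν, hν⟩, fun h ⟨T, hT, ν, hν⟩ => h T hT ν hν⟩
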